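/- Let $\mathcal C$ be a combinatorial model category and let $\mathsf{SS}$ be the category of simplicial sets with the Kan–Quillen model structure. A \emph{weak simplicial tensoring} of $\mathcal C$ is a left Quillen bifunctor $\otimes:\mathsf{SS}\times\mathcal C\to\mathcal C$ together with a natural transformation $\Delta^0\otimes-\to\mathrm{id}_{\mathcal C}$ whose component $\Delta^0\otimes A\to A$ is a weak equivalence for every cofibrant object $A\in\mathcal C$. (A left Quillen bifunctor preserves small colimits separately in each variable and satisfies the pushout-product axiom for cofibrations and trivial cofibrations.) For a simplicial set $K$, write $(-)^K$ for the right adjoint of $K\otimes-:\mathcal C\to\mathcal C$. For a simplicial object $X:\mathbf\Delta^{\mathrm{op}}\to\mathcal C$ put $|X|=\int^{[n]\in\mathbf\Delta}\Delta^n\otimes X_n$, and for a cosimplicial object $X:\mathbf\Delta\to\mathcal C$ put $\mathrm{Tot}(X)=\int_{[n]\in\mathbf\Delta}(X^n)^{\Delta^n}$. The maps $\Delta^n\otimes X_n\to\Delta^0\otimes X_n\to X_n$ induce a map $|X|\to\operatorname{colim}_{\mathbf\Delta^{\mathrm{op}}}X$, and the maps $X^n\to(X^n)^{\Delta^n}$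 adjoint to $\Delta^n\otimes X^n\to\Delta^0\otimes X^n\to X^n$ induce a map $\lim_{\mathbf\Delta}X\to\mathrm{Tot}(X)$. For a small category $\mathcal I$ and a diagram $F:\mathcal I\to\mathcal C$, a map $\alpha:\operatorname{colim}_{\mathcal I}F\to C$ \emph{exhibits $C$ as a homotopy colimit of $F$} if there is an objectwise weak equivalence $F'\to F$ with $F'$ projectively cofibrant such that the composite $\operatorname{colim}_{\mathcal I}F'\to\operatorname{colim}_{\mathcal I}F\to C$ is a weak equivalence. Dually, a map $C\to\lim_{\mathcal I}F$ \emph{exhibits $C$ as a homotopy limit of $F$} if there is an objectwise weak equivalence $F\to F''$ with $F''$ injectively fibrant such that the composite $C\to\lim_{\mathcal I}F\to\lim_{\mathcal I}F''$ is a weak equivalence. Suppose that $\mathcal C$ is equipped with a weak simplicial tensoring. Then the following hold. 1. Let $X:\mathbf\Delta^{\mathrm{op}}\to\mathcal C$ be a Reedy cofibrant simplicial object. A map $f:\operatorname{colim}_{\mathbf\Delta^{\mathrm{op}}}X\to C$ in $\mathcal C$ exhibits $C$ as a homotopy colimit of $X$ if and only if the composite $|X|\to\operatorname{colim}_{\mathbf\Delta^{\mathrm{op}}}X\xrightarrow{f}C$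 is a weak equivalence. 2. Let $X:\mathbf\Delta\to\mathcal C$ be a Reedy fibrant cosimplicial object. A map $f:C\to\lim_{\mathbf\Delta}X$ in $\mathcal C$ exhibits $C$ as a homotopy limit of $X$ if and only if the composite $C\xrightarrow{f}\lim_{\mathbf\Delta}X\to\mathrm{Tot}(X)$ is a weak equivalence. -/

import Mathlib

open CategoryTheory Limits Opposite HomotopicalAlgebra MonoidalCategory Simplicial

universe w w' v u u'

namespace WeakSimplicial

/-! ### Locally presentable categories: right adjoints and limits -/

/-- A cocontinuous functor out of a locally presentable category has a right adjoint. -/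
theorem isLeftAdjoint_of_cocontinuous {C : Type u} [Category.{v} C] [IsLocallyPresentable.{v} C]
    {D : Type u'} [Category.{v} D] (F : C ⥤ D) [PreservesColimitsOfSize.{v, v} F] :
    F.IsLeftAdjoint := by
  obtain ⟨κ, _, _⟩ := IsLocallyPresentable.exists_cardinal.{v} C
  obtain ⟨P, _, hP⟩ := HasCardinalFilteredGenerator.exists_generator C κ
  have : HasColimits C := inferInstance
  suffices F.op.IsRightAdjoint from
    inferInstanceAs (((opOpEquivalence C).inverse ⋙ F.op.op ⋙
      (opOpEquivalence D).functor)).IsLeftAdjoint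
  have : PreservesLimits F.op := preservesLimits_op F
  apply isRightAdjoint_of_preservesLimits_of_solutionSetCondition
  rintro ⟨A⟩
  have : HasColimitsOfShape (CostructuredArrow (P.ι ⋙ F) A) C :=
    hasColimitsOfShape_of_equivalence (equivSmallModel.{v} _).symm
  have : PreservesColimitsOfShape (CostructuredArrow (P.ι ⋙ F) A) F :=
    preservesColimitsOfShape_of_equiv (equivSmallModel.{v} _).symm F
  let G : CostructuredArrow (P.ι ⋙ F) A ⥤ C := CostructuredArrow.proj _ _ ⋙ P.ι
  let cc : Cocone (G ⋙ F) := ⟨A, { app := fun s => s.hom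
                                   naturality := fun s s' f => by
                                    have := CostructuredArrow.w f
                                    exact this.trans (Category.comp_id _).symm }⟩
  have hT := isColimitOfPreserves F (colimit.isColimit G)
  let t : F.obj (colimit G) ⟶ A := hT.desc cc
  have ht (s) : F.map (colimit.ι G s) ≫ t = s.hom := hT.fac cc s
  refine ⟨PUnit, fun _ => op (colimit G), fun _ => t.op, ?_⟩
  rintro ⟨X⟩ h
  obtain ⟨J, _, _, ⟨p⟩⟩ := hP.exists_colimitsOfShape X
  let L (j : J) : CostructuredArrow (P.ι ⋙ F) A :=
    CostructuredArrow.mk (Y := ⟨p.diag.obj j, p.prop_diag_obj j⟩) (F.map (p.ι.app j) ≫ h.unop)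
  let m {i j : J} (f : i ⟶ j) : L i ⟶ L j :=
    CostructuredArrow.homMk (ObjectProperty.homMk (p.diag.map f)) (by
      have := p.w f
      simp only [L, CostructuredArrow.mk_hom_eq_self, Functor.comp_map]
      rw [← this, F.map_comp, Category.assoc]
      rfl)
  let c : Cocone p.diag := ⟨colimit G,
    { app := fun j => colimit.ι G (L j)
      naturality := fun i j f =>
        (colimit.w G (m f)).trans (Category.comp_id _).symm }⟩
  refine ⟨PUnit.unit, (p.isColimit.desc c).op, Quiver.Hom.unop_inj ?_⟩
  refine (isColimitOfPreserves F p.isColimit).hom_ext fun j => ?_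
  have hj : p.ι.app j ≫ p.isColimit.desc c = colimit.ι G (L j) := p.isColimit.fac c j
  have : F.map (p.ι.app j) ≫ F.map (p.isColimit.desc c) ≫ t = F.map (p.ι.app j) ≫ h.unop := by
    rw [← Category.assoc, ← F.map_comp, hj]
    exact ht (L j)
  simpa using this

theorem hasLimits_of_isLocallyPresentable (C : Type u) [Category.{v} C]
    [IsLocallyPresentable.{v} C] : HasLimits C where
  has_limits_of_shape _ _ := hasLimitsOfShape_iff_isLeftAdjoint_const.2
    (isLeftAdjoint_of_cocontinuous _)

/-! ### Combinatorial model categories -/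

/-- A model category is combinatorial if it is locally presentable and cofibrantly generated:
there are small sets of generating cofibrations and of generating trivial cofibrations. -/
class IsCombinatorial (C : Type u) [Category.{v} C] [ModelCategory C] : Prop
    extends IsLocallyPresentable.{v} C where
  exists_generatingCofibrations :
    ∃ I : MorphismProperty C, MorphismProperty.IsSmall.{v} I ∧ trivialFibrations C = I.rlp
  exists_generatingTrivialCofibrations :
    ∃ J : MorphismProperty C, MorphismProperty.IsSmall.{v} J ∧ fibrations C = J.rlp

instance (C : Type u) [Category.{v} C] [ModelCategory C] [IsCombinatorial C] : HasColimits C := by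
  obtain ⟨κ, _, _⟩ := IsLocallyPresentable.exists_cardinal.{v} C
  infer_instance

instance (C : Type u) [Category.{v} C] [ModelCategory C] [IsCombinatorial C] : HasLimits C :=
  hasLimits_of_isLocallyPresentable C

/-! ### The Kan--Quillen model structure on simplicial sets

The cofibrations (the monomorphisms) and the fibrations (the Kan fibrations) are those of
`SSet.modelCategoryQuillen`; the weak equivalences are the maps which induce bijections on
simplicial homotopy classes of maps to Kan complexes. -/

/-- Homotopy classes of maps `X ⟶ Z`: the quotient of the set of maps by the equivalence relation
generated by simplicial homotopy (which is an equivalence relation if `Z` is a Kan complex). -/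
def HomotopyClasses (X Z : SSet.{u}) : Type u :=
  Quot fun f g : X ⟶ Z => Nonempty (SSet.Homotopy f g)

theorem homotopic_precomp {X Y Z : SSet.{u}} (f : X ⟶ Y) {g h : Y ⟶ Z}
    (H : Nonempty (SSet.Homotopy g h)) : Nonempty (SSet.Homotopy (f ≫ g) (f ≫ h)) :=
  H.map fun (H : (SSet.RelativeMorphism.botEquiv.symm g).Homotopy
      (SSet.RelativeMorphism.botEquiv.symm h)) =>
    H.precomp (SSet.RelativeMorphism.botEquiv.symm f)
      (SSet.Subcomplex.isInitialBot.hom_ext _ (SSet.Subcomplex.isInitialBot.to _))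

/-- Precomposition with `f : X ⟶ Y` on homotopy classes. -/
def HomotopyClasses.precomp {X Y : SSet.{u}} (f : X ⟶ Y) (Z : SSet.{u}) :
    HomotopyClasses Y Z → HomotopyClasses X Z :=
  Quot.map (fun g => f ≫ g) fun _ _ => homotopic_precomp f

open scoped SSet.modelCategoryQuillen

instance : CategoryWithWeakEquivalences SSet.{u} where
  weakEquivalences _ _ f :=
    ∀ (Z : SSet.{u}) [SSet.KanComplex Z], Function.Bijective (HomotopyClasses.precomp f Z)

/-! ### Left Quillen bifunctors and weak simplicial tensorings -/

/-- A bifunctor `F` is a left Quillen bifunctor if it preserves small colimits separately in each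
variable and satisfies the pushout-product axiom: for cofibrations `i : A ⟶ A'` and `j : B ⟶ B'`,
the map `F(A', B) ⨿_{F(A, B)} F(A, B') ⟶ F(A', B')` is a cofibration, which is trivial as soon as
`i` or `j` is trivial. -/
structure IsLeftQuillenBifunctor {A B D : Type*} [Category.{v} A] [Category.{v} B] [Category.{v} D]
    [CategoryWithCofibrations A] [CategoryWithWeakEquivalences A]
    [CategoryWithCofibrations B] [CategoryWithWeakEquivalences B]
    [CategoryWithCofibrations D] [CategoryWithWeakEquivalences D] [HasPushouts D]
    (F : A ⥤ B ⥤ D) : Prop where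
  preservesColimits_obj (a : A) : PreservesColimitsOfSize.{v, v} (F.obj a)
  preservesColimits_flip_obj (b : B) : PreservesColimitsOfSize.{v, v} (F.flip.obj b)
  cofibration {a a' : A} {b b' : B} (i : a ⟶ a') (j : b ⟶ b') [Cofibration i] [Cofibration j] :
    Cofibration (Functor.PushoutObjObj.ofHasPushout F i j).ι
  weakEquivalence_left {a a' : A} {b b' : B} (i : a ⟶ a') (j : b ⟶ b')
    [Cofibration i] [Cofibration j] [WeakEquivalence i] :
    WeakEquivalence (Functor.PushoutObjObj.ofHasPushout F i j).ι
  weakEquivalence_right {a a' : A} {b b' : B} (i : a ⟶ a') (j : b ⟶ b')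
    [Cofibration i] [Cofibration j] [WeakEquivalence j] :
    WeakEquivalence (Functor.PushoutObjObj.ofHasPushout F i j).ι

/-- A weak simplicial tensoring of a model category `C`: a left Quillen bifunctor
`⊗ : SSet × C ⟶ C` with a natural transformation `Δ[0] ⊗ - ⟶ 𝟭 C` which is a weak equivalence
on cofibrant objects. -/
structure WeakSimplicialTensoring (C : Type u) [Category.{v} C] [ModelCategory C] where
  tensor : SSet.{v} ⥤ C ⥤ C
  isLeftQuillenBifunctor : IsLeftQuillenBifunctor tensor
  counit : tensor.obj Δ[0] ⟶ 𝟭 C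
  weakEquivalence_counit_app (X : C) [IsCofibrant X] : WeakEquivalence (counit.app X)

/-! ### Geometric realization and totalization -/

section Cotensor

variable {C : Type u} [Category.{v} C] (T : SSet.{v} ⥤ C ⥤ C) [∀ K, (T.obj K).IsLeftAdjoint]

/-- The bifunctor `(K, X) ↦ X ^ K`, where `(-) ^ K` is the right adjoint of `K ⊗ -`. -/
noncomputable def cotensor : SSet.{v}ᵒᵖ ⥤ C ⥤ C where
  obj K := (T.obj K.unop).rightAdjoint
  map {K L} f := conjugateEquiv (Adjunction.ofIsLeftAdjoint (T.obj K.unop))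
    (Adjunction.ofIsLeftAdjoint (T.obj L.unop)) (T.map f.unop)
  map_id K := by simp
  map_comp f g := by simp

/-- The adjunctions `K ⊗ - ⊣ (-) ^ K`, naturally in `K`. -/
noncomputable def cotensorAdj : T ⊣₂ cotensor T where
  adj K := Adjunction.ofIsLeftAdjoint (T.obj K)
  unit_whiskerRight_map {K L} f := by
    ext X
    exact (unit_conjugateEquiv (Adjunction.ofIsLeftAdjoint (T.obj L))
      (Adjunction.ofIsLeftAdjoint (T.obj K)) (T.map f) X).symm

end Cotensor

section Realization

variable {C : Type u} [Category.{v} C] (T : SSet.{v} ⥤ C ⥤ C)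

/-- The bifunctor `([m], [n]) ↦ Δ[n] ⊗ X_m`. -/
def realizationBifunctor (X : SimplexCategoryᵒᵖ ⥤ C) :
    SimplexCategoryᵒᵖ ⥤ SimplexCategory ⥤ C :=
  X ⋙ T.flip ⋙ (Functor.whiskeringLeft _ _ _).obj SSet.stdSimplex

/-- The geometric realization: the coend of `Δ[n] ⊗ X_n`. -/
noncomputable def realization [HasColimitsOfSize.{0, 0} C] (X : SimplexCategoryᵒᵖ ⥤ C) : C :=
  coend (realizationBifunctor T X)

/-- The bifunctor `([m], [n]) ↦ (X^n) ^ Δ[m]`. -/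
noncomputable def totalizationBifunctor [∀ K, (T.obj K).IsLeftAdjoint] (X : SimplexCategory ⥤ C) :
    SimplexCategoryᵒᵖ ⥤ SimplexCategory ⥤ C :=
  SSet.stdSimplex.op ⋙ cotensor T ⋙ (Functor.whiskeringLeft _ _ _).obj X

/-- The totalization: the end of `(X^n) ^ Δ[n]`. -/
noncomputable def totalization [∀ K, (T.obj K).IsLeftAdjoint] [HasLimitsOfSize.{0, 0} C]
    (X : SimplexCategory ⥤ C) : C :=
  end_ (totalizationBifunctor T X)

end Realization

namespace WeakSimplicialTensoring

variable {C : Type u} [Category.{v} C] [ModelCategory C] (T : WeakSimplicialTensoring C)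

/-- The natural transformation `Δ[n] ⊗ - ⟶ Δ[0] ⊗ - ⟶ 𝟭 C`. -/
noncomputable def collapse (n : SimplexCategory) :
    T.tensor.obj (SSet.stdSimplex.obj n) ⟶ 𝟭 C :=
  T.tensor.map (SSet.stdSimplex.map (SimplexCategory.isTerminalZero.from n)) ≫ T.counit

theorem map_collapse {m n : SimplexCategory} (f : m ⟶ n) :
    T.tensor.map (SSet.stdSimplex.map f) ≫ T.collapse n = T.collapse m := by
  have h : SSet.stdSimplex.map f ≫
      SSet.stdSimplex.map (SimplexCategory.isTerminalZero.from n) =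
        SSet.stdSimplex.map (SimplexCategory.isTerminalZero.from m) :=
    (Functor.map_comp _ _ _).symm.trans
      (congrArg _ (SimplexCategory.isTerminalZero.hom_ext _ _))
  rw [collapse, collapse, ← h, Functor.map_comp, Category.assoc]

variable [IsCombinatorial C]

instance (K : SSet.{v}) : (T.tensor.obj K).IsLeftAdjoint :=
  have := T.isLeftQuillenBifunctor.preservesColimits_obj K
  isLeftAdjoint_of_cocontinuous _

/-- The canonical map `|X| ⟶ colim X`, induced by the maps
`Δ[n] ⊗ X_n ⟶ Δ[0] ⊗ X_n ⟶ X_n ⟶ colim X`. -/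
noncomputable def realizationToColimit (X : SimplexCategoryᵒᵖ ⥤ C) :
    realization T.tensor X ⟶ colimit X :=
  coend.desc (F := realizationBifunctor T.tensor X)
    (fun n => (T.collapse n).app (X.obj (op n)) ≫ colimit.ι X (op n))
    (fun m n f => by
      have h₁ : (T.tensor.obj (SSet.stdSimplex.obj m)).map (X.map f.op) ≫
          (T.collapse m).app (X.obj (op m)) = (T.collapse m).app (X.obj (op n)) ≫ X.map f.op :=
        (T.collapse m).naturality (X.map f.op)
      have h₂ : (T.tensor.map (SSet.stdSimplex.map f)).app (X.obj (op n)) ≫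
          (T.collapse n).app (X.obj (op n)) = (T.collapse m).app (X.obj (op n)) :=
        NatTrans.congr_app (T.map_collapse f) (X.obj (op n))
      change (T.tensor.obj (SSet.stdSimplex.obj m)).map (X.map f.op) ≫
          (T.collapse m).app (X.obj (op m)) ≫ colimit.ι X (op m) =
        (T.tensor.map (SSet.stdSimplex.map f)).app (X.obj (op n)) ≫
          (T.collapse n).app (X.obj (op n)) ≫ colimit.ι X (op n)
      rw [← Category.assoc, h₁, ← Category.assoc, h₂, Category.assoc, colimit.w])

/-- The map `A ⟶ A ^ Δ[n]` adjoint to the composite `Δ[n] ⊗ A ⟶ Δ[0] ⊗ A ⟶ A`. -/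
noncomputable def toCotensor (n : SimplexCategory) (A : C) :
    A ⟶ ((cotensor T.tensor).obj (op (SSet.stdSimplex.obj n))).obj A :=
  (cotensorAdj T.tensor).homEquiv ((T.collapse n).app A)

/-- The canonical map `lim X ⟶ Tot X`, induced by the maps `lim X ⟶ X^n ⟶ (X^n) ^ Δ[n]`. -/
noncomputable def limitToTotalization (X : SimplexCategory ⥤ C) :
    limit X ⟶ totalization T.tensor X :=
  end_.lift (F := totalizationBifunctor T.tensor X)
    (fun n => limit.π X n ≫ T.toCotensor n (X.obj n))
    (fun m n f => by
      have h₁ : T.toCotensor m (X.obj m) ≫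
          ((cotensor T.tensor).obj (op (SSet.stdSimplex.obj m))).map (X.map f) =
            X.map f ≫ T.toCotensor m (X.obj n) := by
        rw [toCotensor, toCotensor, ← ParametrizedAdjunction.homEquiv_naturality_three,
          ← ParametrizedAdjunction.homEquiv_naturality_two]
        exact congrArg _ ((T.collapse m).naturality (X.map f)).symm
      have h₂ : T.toCotensor n (X.obj n) ≫
          ((cotensor T.tensor).map (SSet.stdSimplex.map f).op).app (X.obj n) =
            T.toCotensor m (X.obj n) := by
        rw [toCotensor, toCotensor, ← ParametrizedAdjunction.homEquiv_naturality_one]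
        exact congrArg _ (NatTrans.congr_app (T.map_collapse f) (X.obj n))
      change (limit.π X m ≫ T.toCotensor m (X.obj m)) ≫
          ((cotensor T.tensor).obj (op (SSet.stdSimplex.obj m))).map (X.map f) =
        (limit.π X n ≫ T.toCotensor n (X.obj n)) ≫
          ((cotensor T.tensor).map (SSet.stdSimplex.map f).op).app (X.obj n)
      rw [Category.assoc, h₁, Category.assoc, h₂, ← Category.assoc, limit.w])

end WeakSimplicialTensoring

/-! ### Reedy cofibrant simplicial objects and Reedy fibrant cosimplicial objects -/

section Reedy

variable {C : Type u} [Category.{v} C]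

/-- The non-invertible epimorphisms `[n] ⟶ [m]` of the simplex category. -/
def isProperQuotient (n : SimplexCategory) : ObjectProperty (Under n) :=
  fun f => Epi f.hom ∧ ¬ IsIso f.hom

/-- The diagram `([n] ↠ [m]) ↦ X_m` indexed by the proper quotients of `[n]`, whose colimit is
the latching object `L_n X`. -/
def latchingDiagram (X : SimplexCategoryᵒᵖ ⥤ C) (n : SimplexCategory) :
    (isProperQuotient n).FullSubcategoryᵒᵖ ⥤ C :=
  ((isProperQuotient n).ι ⋙ Under.forget n).op ⋙ X

/-- The latching map `L_n X ⟶ X_n`. -/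
noncomputable def latchingMap [HasColimitsOfSize.{0, 0} C] (X : SimplexCategoryᵒᵖ ⥤ C)
    (n : SimplexCategory) : colimit (latchingDiagram X n) ⟶ X.obj (op n) :=
  colimit.desc (latchingDiagram X n)
    { pt := X.obj (op n)
      ι :=
        { app := fun f => X.map f.unop.obj.hom.op
          naturality := fun f g φ => by
            have h : g.unop.obj.hom ≫ φ.unop.hom.right = f.unop.obj.hom := Under.w φ.unop.hom
            change X.map φ.unop.hom.right.op ≫ X.map g.unop.obj.hom.op =
              X.map f.unop.obj.hom.op ≫ 𝟙 _
            rw [← X.map_comp, ← op_comp, h, Category.comp_id] } }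

/-- The diagram `([n] ↠ [m]) ↦ X^m` indexed by the proper quotients of `[n]`, whose limit is
the matching object `M^n X`. -/
def matchingDiagram (X : SimplexCategory ⥤ C) (n : SimplexCategory) :
    (isProperQuotient n).FullSubcategory ⥤ C :=
  (isProperQuotient n).ι ⋙ Under.forget n ⋙ X

/-- The matching map `X^n ⟶ M^n X`. -/
noncomputable def matchingMap [HasLimitsOfSize.{0, 0} C] (X : SimplexCategory ⥤ C)
    (n : SimplexCategory) : X.obj n ⟶ limit (matchingDiagram X n) :=
  limit.lift (matchingDiagram X n)
    { pt := X.obj n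
      π :=
        { app := fun f => X.map f.obj.hom
          naturality := fun f g φ => by
            have h : f.obj.hom ≫ φ.hom.right = g.obj.hom := Under.w φ.hom
            change 𝟙 _ ≫ X.map g.obj.hom = X.map f.obj.hom ≫ X.map φ.hom.right
            rw [← X.map_comp, h, Category.id_comp] } }

/-- A simplicial object is Reedy cofibrant if all its latching maps are cofibrations. -/
def IsReedyCofibrant [HasColimitsOfSize.{0, 0} C] [CategoryWithCofibrations C]
    (X : SimplexCategoryᵒᵖ ⥤ C) : Prop :=
  ∀ n : SimplexCategory, Cofibration (latchingMap X n)

/-- A cosimplicial object is Reedy fibrant if all its matching maps are fibrations. -/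
def IsReedyFibrant [HasLimitsOfSize.{0, 0} C] [CategoryWithFibrations C]
    (X : SimplexCategory ⥤ C) : Prop :=
  ∀ n : SimplexCategory, Fibration (matchingMap X n)

end Reedy

/-! ### Homotopy colimits and homotopy limits -/

section HomotopyColimit

variable {J : Type w} [Category.{w'} J] {C : Type u} [Category.{v} C] [ModelCategory C]

/-- `F` is cofibrant for the projective model structure on `J ⥤ C`: the map from the initial object
has the left lifting property with respect to the objectwise trivial fibrations. -/
def IsProjectivelyCofibrant (F : J ⥤ C) : Prop :=
  ((trivialFibrations C).functorCategory J).llp (initial.to F)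

/-- `F` is fibrant for the injective model structure on `J ⥤ C`: the map to the terminal object
has the right lifting property with respect to the objectwise trivial cofibrations. -/
def IsInjectivelyFibrant (F : J ⥤ C) : Prop :=
  ((trivialCofibrations C).functorCategory J).rlp (terminal.from F)

/-- The map `f : colim F ⟶ Y` exhibits `Y` as a homotopy colimit of `F`. -/
def ExhibitsHomotopyColimit [HasColimitsOfShape J C] (F : J ⥤ C) {Y : C} (f : colimit F ⟶ Y) :
    Prop :=
  ∃ (F' : J ⥤ C) (α : F' ⟶ F), (weakEquivalences C).functorCategory J α ∧
    IsProjectivelyCofibrant F' ∧ WeakEquivalence (colimMap α ≫ f)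

/-- The map `f : Y ⟶ lim F` exhibits `Y` as a homotopy limit of `F`. -/
def ExhibitsHomotopyLimit [HasLimitsOfShape J C] (F : J ⥤ C) {Y : C} (f : Y ⟶ limit F) :
    Prop :=
  ∃ (F'' : J ⥤ C) (α : F ⟶ F''), (weakEquivalences C).functorCategory J α ∧
    IsInjectivelyFibrant F'' ∧ WeakEquivalence (f ≫ limMap α)

end HomotopyColimit

end WeakSimplicial

open WeakSimplicial

namespace WeakSimplicial

/-! ### Weak equivalences of simplicial sets -/

section SSetWeakEquivalences

/-! Everything is expressed through the weighted coend `∫ⁿ V n ⊗ X n` of a cosimplicial weight `V`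
and a simplicial object `X`. The weight `Δ[•]` gives the realization, and the weight constant at
`Δ[0]` gives `Δ[0] ⊗ colim X`. Let `F ⟶ X` be an objectwise weak equivalence from a projectively
cofibrant `F` to a Reedy cofibrant `X`. In the square comparing `|F| ⟶ colim F` with `|X| ⟶ colim
X`, two-out-of-three reduces the first claim to showing that `|F| ⟶ colim F` and `|F| ⟶ |X|` are
weak equivalences, and that such an `F` exists.

Three invariance properties carry this. If `F` is projectively cofibrant, its coend sends every
objectwise weak equivalence of weights to a weak equivalence
(`QuillenTensor.weakEquivalence_map_app`). If `V` is projectively cofibrant, its coend preserves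
weak equivalences between objectwise cofibrant diagrams (`QuillenTensor.weakEquivalence_obj_map`).
If `X` is Reedy cofibrant, its coend sends to weak equivalences those objectwise weak equivalences
of weights whose source and target have monic latching maps
(`QuillenTensor.weakEquivalence_map_app_of_isReedyMonomorphic`). Mapping cylinders reduce each to
objectwise monomorphisms or cofibrations, where transposing a lifting problem against a fibration
turns it into one against objectwise trivial fibrations or relative matching maps.

The first property, applied to `Δ[•] ⟶ Δ[0]`, handles `|F| ⟶ colim F`. For `|F| ⟶ |X|`, replace
`Δ[•]` by a projectively cofibrant weight and use all three. The existence of `F` follows by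
replacing the bimodule of representable weights, whose coend with `X` is `Δ[0] ⊗ X`.

The second claim is the first one in the opposite category. The structure `QuillenTensor` is
symmetric under passing to opposites, except that `A ⟶ A ^ Δ[0]` must be shown to be a weak
equivalence for fibrant `A`. This holds because in the homotopy category it is the mate of an
isomorphism (`QuillenTensor.weakEquivalence_unit_app`). -/

theorem HomotopyClasses.precomp_comp {X Y Z : SSet.{u}} (f : X ⟶ Y) (g : Y ⟶ Z) (E : SSet.{u}) :
    HomotopyClasses.precomp (f ≫ g) E =
      HomotopyClasses.precomp f E ∘ HomotopyClasses.precomp g E := by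
  funext x
  induction x using Quot.ind with
  | mk h => exact congrArg (Quot.mk _) (Category.assoc f g h)

theorem HomotopyClasses.precomp_id (X : SSet.{u}) (E : SSet.{u}) :
    HomotopyClasses.precomp (𝟙 X) E = id := by
  funext x
  induction x using Quot.ind with
  | mk h => exact congrArg (Quot.mk _) (Category.id_comp h)

theorem sset_weakEquivalence_iff {X Y : SSet.{u}} (f : X ⟶ Y) :
    WeakEquivalence f ↔
      ∀ (Z : SSet.{u}) [SSet.KanComplex Z], Function.Bijective (HomotopyClasses.precomp f Z) :=
  _root_.HomotopicalAlgebra.weakEquivalence_iff f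

instance : (weakEquivalences SSet.{u}).HasTwoOutOfThreeProperty where
  comp_mem f g hf hg Z hZ := by
    rw [HomotopyClasses.precomp_comp]
    exact (hf Z).comp (hg Z)
  of_postcomp f g hg hfg Z hZ := by
    have := hfg Z
    rw [HomotopyClasses.precomp_comp] at this
    exact (Function.Bijective.of_comp_iff _ (hg Z)).1 this
  of_precomp f g hf hfg Z hZ := by
    have := hfg Z
    rw [HomotopyClasses.precomp_comp] at this
    exact (Function.Bijective.of_comp_iff' (hf Z) _).1 this

/-- A homotopy `X ⊗ Δ[1] ⟶ Y` between its two ends. -/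
def homotopyOfHom {X Y : SSet.{u}} {f g : X ⟶ Y} (h : X ⊗ Δ[1] ⟶ Y)
    (h₀ : SSet.ι₀ ≫ h = f) (h₁ : SSet.ι₁ ≫ h = g) : SSet.Homotopy f g where
  h := h
  h₀ := h₀
  h₁ := h₁
  -- The homotopy is relative to the empty subcomplex, so the condition is void.
  rel := by
    ext n ⟨x, _⟩
    exact x.2.elim

theorem homotopic_postcomp {X Y Z : SSet.{u}} {f g : X ⟶ Y} (H : Nonempty (SSet.Homotopy f g))
    (h : Y ⟶ Z) : Nonempty (SSet.Homotopy (f ≫ h) (g ≫ h)) := by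
  obtain ⟨H⟩ := H
  refine ⟨homotopyOfHom (SSet.RelativeMorphism.Homotopy.h H ≫ h) ?_ ?_⟩
  · rw [← Category.assoc]; exact congrArg (· ≫ h) (SSet.Homotopy.h₀ H)
  · rw [← Category.assoc]; exact congrArg (· ≫ h) (SSet.Homotopy.h₁ H)

/-- A map with a homotopy inverse is a weak equivalence. -/
theorem sset_weakEquivalence_of_homotopyInverse {X Y : SSet.{u}} (f : X ⟶ Y) (g : Y ⟶ X)
    (H₁ : Nonempty (SSet.Homotopy (f ≫ g) (𝟙 X)) ∨ Nonempty (SSet.Homotopy (𝟙 X) (f ≫ g)))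
    (H₂ : Nonempty (SSet.Homotopy (g ≫ f) (𝟙 Y)) ∨ Nonempty (SSet.Homotopy (𝟙 Y) (g ≫ f))) :
    WeakEquivalence f := by
  rw [sset_weakEquivalence_iff]
  intro Z _
  -- The direction of the homotopy is irrelevant because `HomotopyClasses` is the quotient by the
  -- generated equivalence relation.
  have key : ∀ {A : SSet.{u}} (k : A ⟶ A),
      (Nonempty (SSet.Homotopy k (𝟙 A)) ∨ Nonempty (SSet.Homotopy (𝟙 A) k)) →
      HomotopyClasses.precomp k Z = id := by
    intro A k hk
    funext x
    induction x using Quot.ind with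
    | mk h =>
      have e : (Quot.mk (fun f g : A ⟶ Z => Nonempty (SSet.Homotopy f g)) (𝟙 A ≫ h)) =
        Quot.mk _ h := congrArg _ (Category.id_comp h)
      rcases hk with hk | hk
      · exact (Quot.sound (homotopic_postcomp hk h)).trans e
      · exact (Quot.sound (homotopic_postcomp hk h)).symm.trans e
  rw [Function.bijective_iff_has_inverse]
  refine ⟨HomotopyClasses.precomp g Z, fun x => ?_, fun x => ?_⟩
  · exact (congrFun (HomotopyClasses.precomp_comp g f Z) x).symm.trans (congrFun (key _ H₂) x)
  · exact (congrFun (HomotopyClasses.precomp_comp f g Z) x).symm.trans (congrFun (key _ H₁) x)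

/-- The trivial Kan fibrations: the maps with the right lifting property with respect to
monomorphisms. -/
def trivialKanFibrations : MorphismProperty SSet.{u} :=
  (MorphismProperty.monomorphisms SSet.{u}).rlp

/-- Each end is split by the projection to `X`, and the two ends are disjoint because the
`Δ[1]`-coordinate is constant at `0` on one and at `1` on the other. -/
theorem mono_desc_ι (X : SSet.{u}) :
    Mono (coprod.desc (SSet.ι₀ : X ⟶ X ⊗ Δ[1]) SSet.ι₁) := by
  rw [NatTrans.mono_iff_mono_app]
  rintro ⟨n⟩
  induction n using SimplexCategory.rec with | _ n
  rw [CategoryTheory.mono_iff_injective]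
  have h₀ : ∀ x : X.obj (op ⦋n⦌), (coprod.desc (SSet.ι₀ : X ⟶ X ⊗ Δ[1]) SSet.ι₁).app _
      ((coprod.inl : X ⟶ X ⨿ X).app _ x) = SSet.ι₀.app _ x := fun x =>
    ConcreteCategory.congr_hom (NatTrans.congr_app
      (coprod.inl_desc (SSet.ι₀ : X ⟶ X ⊗ Δ[1]) SSet.ι₁) (op ⦋n⦌)) x
  have h₁ : ∀ x : X.obj (op ⦋n⦌), (coprod.desc (SSet.ι₀ : X ⟶ X ⊗ Δ[1]) SSet.ι₁).app _
      ((coprod.inr : X ⟶ X ⨿ X).app _ x) = SSet.ι₁.app _ x := fun x =>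
    ConcreteCategory.congr_hom (NatTrans.congr_app
      (coprod.inr_desc (SSet.ι₀ : X ⟶ X ⊗ Δ[1]) SSet.ι₁) (op ⦋n⦌)) x
  have hs : ∀ z : (X ⨿ X).obj (op ⦋n⦌), (∃ x : X.obj (op ⦋n⦌), z = (coprod.inl : X ⟶ X ⨿ X).app _ x) ∨
      ∃ x : X.obj (op ⦋n⦌), z = (coprod.inr : X ⟶ X ⨿ X).app _ x := by
    intro z
    obtain ⟨⟨_ | _⟩, x, hx⟩ := Types.jointly_surjective _ (isColimitOfPreserves
      ((evaluation _ _).obj (op ⦋n⦌)) (coprodIsCoprod X X)) z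
    · exact .inl ⟨x, hx.symm⟩
    · exact .inr ⟨x, hx.symm⟩
  have ne (x y : X.obj (op ⦋n⦌)) : (SSet.ι₀ : X ⟶ X ⊗ Δ[1]).app _ x ≠ SSet.ι₁.app _ y := by
    intro h
    have := congrArg (fun z : (X ⊗ Δ[1]).obj (op ⦋n⦌) => (z.2 : Δ[1] _⦋n⦌) 0) h
    exact absurd (show (0 : Fin 2) = 1 from this) (by decide)
  intro a b hab
  rcases hs a with ⟨x, rfl⟩ | ⟨x, rfl⟩ <;> rcases hs b with ⟨y, rfl⟩ | ⟨y, rfl⟩ <;>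
    simp only [h₀, h₁] at hab
  · obtain rfl : x = y := congrArg Prod.fst hab
    rfl
  · exact (ne _ _ hab).elim
  · exact (ne _ _ hab.symm).elim
  · obtain rfl : x = y := congrArg Prod.fst hab
    rfl

/-- Lifting against `∅ ⟶ Y` produces a section `s`; lifting against the two ends of the cylinder on
`X` produces a homotopy from `p ≫ s` to the identity. Thus `p` is a homotopy equivalence. -/
theorem weakEquivalence_of_trivialKanFibration {X Y : SSet.{u}} (p : X ⟶ Y)
    (hp : trivialKanFibrations p) : WeakEquivalence p := by
  have h₁ := hp (initial.to Y) (MorphismProperty.monomorphisms.infer_property _)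
  have sq₁ : CommSq (initial.to X) (initial.to Y) p (𝟙 Y) := ⟨initialIsInitial.hom_ext _ _⟩
  obtain ⟨s, hs⟩ : ∃ s : Y ⟶ X, s ≫ p = 𝟙 Y := ⟨sq₁.lift, sq₁.fac_right⟩
  have hm := mono_desc_ι X
  have h₂ := hp (coprod.desc (SSet.ι₀ : X ⟶ X ⊗ Δ[1]) SSet.ι₁)
    (MorphismProperty.monomorphisms.infer_property _)
  have sq₂ : CommSq (coprod.desc (p ≫ s) (𝟙 X)) (coprod.desc (SSet.ι₀ : X ⟶ X ⊗ Δ[1]) SSet.ι₁) p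
      (CartesianMonoidalCategory.fst _ _ ≫ p) := ⟨by
    apply coprod.hom_ext
    · rw [coprod.inl_desc_assoc, coprod.inl_desc_assoc, Category.assoc, hs, Category.comp_id]
      rfl
    · rw [coprod.inr_desc_assoc, coprod.inr_desc_assoc, Category.id_comp]
      rfl⟩
  refine sset_weakEquivalence_of_homotopyInverse p s (.inl ⟨homotopyOfHom sq₂.lift ?_ ?_⟩)
    (.inl ⟨homotopyOfHom (CartesianMonoidalCategory.fst _ _) ?_ ?_⟩)
  · simpa only [coprod.inl_desc_assoc, coprod.inl_desc] using coprod.inl ≫= sq₂.fac_left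
  · simpa only [coprod.inr_desc_assoc, coprod.inr_desc] using coprod.inr ≫= sq₂.fac_left
  · exact hs.symm
  · rfl

/-- The contraction of `Δ[n]` onto its first vertex. -/
def stdSimplexContraction (n : ℕ) : (Δ[n] : SSet.{u}) ⊗ Δ[1] ⟶ Δ[n] where
  app m := ↾fun x => SSet.stdSimplex.objEquiv.symm (SimplexCategory.Hom.mk
    { toFun := fun i => if SSet.stdSimplex.asOrderHom x.2 i = 0 then 0
        else SSet.stdSimplex.asOrderHom x.1 i
      monotone' := fun i j hij => by
        have h₁ := (SSet.stdSimplex.asOrderHom x.1).monotone hij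
        have h₂ := (SSet.stdSimplex.asOrderHom x.2).monotone hij
        dsimp only
        split_ifs with hi hj
        · exact le_rfl
        · exact Fin.zero_le _
        · rename_i hj
          rw [hj] at h₂
          exact (hi (le_antisymm h₂ (Fin.zero_le _))).elim
        · exact h₁ })
  naturality m m' f := by
    ext x
    rfl

theorem weakEquivalence_stdSimplex_toZero (n : ℕ) :
    WeakEquivalence (SSet.stdSimplex.{u}.map (SimplexCategory.isTerminalZero.from ⦋n⦌)) := by
  have e : SimplexCategory.const ⦋0⦌ ⦋n⦌ 0 ≫ SimplexCategory.isTerminalZero.from ⦋n⦌ = 𝟙 _ :=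
    SimplexCategory.isTerminalZero.hom_ext _ _
  refine sset_weakEquivalence_of_homotopyInverse _
    (SSet.stdSimplex.{u}.map (SimplexCategory.const ⦋0⦌ ⦋n⦌ 0))
    (.inl ⟨homotopyOfHom (stdSimplexContraction n) ?_ ?_⟩)
    (.inl ⟨homotopyOfHom (CartesianMonoidalCategory.fst _ _) ?_ ?_⟩)
  · ext m x
    rfl
  · ext m x
    apply SSet.stdSimplex.objEquiv.injective
    ext i : 3
    exact if_neg (t := (0 : Fin (n + 1))) (show ¬ (1 : Fin 2) = 0 by decide)
  · exact (CategoryTheory.Functor.map_id SSet.stdSimplex.{u} _).symm.trans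
      ((congrArg SSet.stdSimplex.{u}.map e.symm).trans
      (Functor.map_comp _ _ _))
  · rfl

theorem weakEquivalence_stdSimplex_map {m n : SimplexCategory} (f : m ⟶ n) :
    WeakEquivalence (SSet.stdSimplex.{u}.map f) := by
  have h : SSet.stdSimplex.{u}.map f ≫
      SSet.stdSimplex.map (SimplexCategory.isTerminalZero.from n) =
        SSet.stdSimplex.map (SimplexCategory.isTerminalZero.from m) :=
    (Functor.map_comp _ _ _).symm.trans
      (congrArg _ (SimplexCategory.isTerminalZero.hom_ext _ _))
  induction m using SimplexCategory.rec with | _ m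
  induction n using SimplexCategory.rec with | _ n
  have := weakEquivalence_stdSimplex_toZero.{u} m
  have := weakEquivalence_stdSimplex_toZero.{u} n
  exact weakEquivalence_of_postcomp_of_fac h

end SSetWeakEquivalences


/-! ### Trivial Kan fibrations in categories of diagrams -/

section TrivialFibrationFactorization

theorem trivialKanFibrations_eq_rlp :
    trivialKanFibrations.{u} = SSet.modelCategoryQuillen.I.rlp :=
  SSet.rlp_monomorphisms

variable {E : Type u'} [Category.{v} E] {ι : Type w} (R : ι → E ⥤ SSet.{v})

/-- The maps which become trivial Kan fibrations after applying all the functors `R i`. -/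
def jointTrivialKanFibrations : MorphismProperty E :=
  fun _ _ f => ∀ i, trivialKanFibrations ((R i).map f)

variable {R} {L : ι → SSet.{v} ⥤ E}

variable (L) in
/-- The images of the boundary inclusions under a family of functors out of simplicial sets. -/
def jointBoundaryInclusions : MorphismProperty E :=
  MorphismProperty.ofHoms (fun x : ι × ℕ => (L x.1).map (∂Δ[x.2] : (Δ[x.2] : SSet.{v}).Subcomplex).ι)

theorem jointBoundaryInclusions_rlp (adj : ∀ i, L i ⊣ R i) :
    (jointBoundaryInclusions L).rlp = jointTrivialKanFibrations R := by
  ext X Y f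
  constructor
  · intro hf i
    rw [trivialKanFibrations_eq_rlp]
    rintro _ _ _ ⟨n⟩
    exact ((adj i).hasLiftingProperty_iff _ _).1 (hf _ (.mk (i, n)))
  · rintro hf _ _ _ ⟨⟨i, n⟩⟩
    exact ((adj i).hasLiftingProperty_iff _ _).2
      (hf i _ (MorphismProperty.monomorphisms.infer_property _))

/-- Small object argument at `ℵ₀`: the boundaries `∂Δ[n]` are finitely presentable, and the `L i`
keep them so because their right adjoints `R i` are accessible. -/
theorem hasFunctorialFactorization_jointTrivialKanFibrations (adj : ∀ i, L i ⊣ R i)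
    [Small.{v} ι] [HasColimits E] [Fact Cardinal.aleph0.{v}.IsRegular]
    [∀ i, (R i).IsCardinalAccessible Cardinal.aleph0.{v}] :
    MorphismProperty.HasFunctorialFactorization (jointTrivialKanFibrations R).llp
      (jointTrivialKanFibrations R) := by
  let _ := Cardinal.orderBotAleph0OrdToType.{v}
  have : MorphismProperty.IsSmall.{v} (jointBoundaryInclusions L) :=
    MorphismProperty.isSmall_ofHoms ..
  have : MorphismProperty.IsCardinalForSmallObjectArgument (jointBoundaryInclusions L)
      Cardinal.aleph0.{v} :=
    { preservesColimit := by
        rintro _ _ _ _ _ ⟨⟨i, n⟩⟩ f hf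
        have := (adj i).isCardinalPresentable_leftAdjoint_obj Cardinal.aleph0.{v}
          (∂Δ[n] : (Δ[n] : SSet.{v}).Subcomplex).toSSet
        infer_instance }
  have : MorphismProperty.HasSmallObjectArgument.{v} (jointBoundaryInclusions L) :=
    ⟨.aleph0, inferInstance, inferInstance, inferInstance⟩
  rw [← jointBoundaryInclusions_rlp adj]
  infer_instance

end TrivialFibrationFactorization

section Diagrams

variable (J : Type) [SmallCategory J] (K : Type) [SmallCategory K]

/-- Source of projectively cofibrant weights and of mapping cylinders of weights. -/
instance : MorphismProperty.HasFunctorialFactorization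
    (trivialKanFibrations.{v}.functorCategory J).llp (trivialKanFibrations.{v}.functorCategory J) :=
  have := Cardinal.fact_isRegular_aleph0.{v}
  hasFunctorialFactorization_jointTrivialKanFibrations
    (R := fun j : J => (evaluation J SSet.{v}).obj j) (fun j => evaluationAdjunctionRight SSet.{v} j)

/-- The same for bimodules; it is needed to replace the bimodule of representable weights. -/
instance : MorphismProperty.HasFunctorialFactorization
    ((trivialKanFibrations.{v}.functorCategory J).functorCategory K).llp
    ((trivialKanFibrations.{v}.functorCategory J).functorCategory K) := by
  have := Cardinal.fact_isRegular_aleph0.{v}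
  have e : (trivialKanFibrations.{v}.functorCategory J).functorCategory K =
      jointTrivialKanFibrations (fun x : K × J =>
        (evaluation K (J ⥤ SSet.{v})).obj x.1 ⋙ (evaluation J SSet.{v}).obj x.2) := by
    ext X Y f
    exact ⟨fun h x => h x.1 x.2, fun h k j => h (k, j)⟩
  rw [e]
  exact hasFunctorialFactorization_jointTrivialKanFibrations
    (fun x => (evaluationAdjunctionRight SSet.{v} x.2).comp
      (evaluationAdjunctionRight (J ⥤ SSet.{v}) x.1))

end Diagrams

/-! ### Monomorphisms as a left lifting class, and injective simplicial sets -/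

section Mono

instance : MorphismProperty.HasSmallObjectArgument.{u} SSet.modelCategoryQuillen.I.{u} := by
  have := Cardinal.fact_isRegular_aleph0.{u}
  let _ := Cardinal.orderBotAleph0OrdToType.{u}
  have : MorphismProperty.IsSmall.{u} SSet.modelCategoryQuillen.I.{u} :=
    MorphismProperty.isSmall_ofHoms ..
  have : MorphismProperty.IsCardinalForSmallObjectArgument SSet.modelCategoryQuillen.I.{u}
      Cardinal.aleph0.{u} :=
    { preservesColimit := by
        rintro _ _ _ _ _ ⟨n⟩ f hf
        infer_instance }
  exact ⟨.aleph0, inferInstance, inferInstance, inferInstance⟩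

instance : MorphismProperty.HasFunctorialFactorization trivialKanFibrations.{u}.llp
    trivialKanFibrations.{u} := by
  rw [trivialKanFibrations_eq_rlp]
  infer_instance

/-- By the small object argument the left class consists of retracts of transfinite compositions of
pushouts of coproducts of boundary inclusions, and monomorphisms are closed under all these
operations. -/
theorem llp_trivialKanFibrations :
    trivialKanFibrations.{u}.llp = MorphismProperty.monomorphisms SSet.{u} := by
  apply le_antisymm
  · rw [trivialKanFibrations_eq_rlp, MorphismProperty.llp_rlp_of_hasSmallObjectArgument]
    exact MorphismProperty.retracts_le_iff.2 (MorphismProperty.transfiniteCompositions_le_iff.2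
      (MorphismProperty.pushouts_le_iff.2 (MorphismProperty.coproducts_le_iff.2
        SSet.modelCategoryQuillen.I_le_monomorphisms)))
  · exact MorphismProperty.le_llp_rlp _

/-- A simplicial set is injective if its map to the point is a trivial Kan fibration. -/
theorem exists_mono_injective (X : SSet.{u}) :
    ∃ (E : SSet.{u}) (i : X ⟶ E), Mono i ∧ Injective E := by
  obtain ⟨⟨E, i, p, fac, hi, hp⟩⟩ : Nonempty (MorphismProperty.MapFactorizationData
    trivialKanFibrations.{u}.llp trivialKanFibrations.{u} (terminal.from X)) := ⟨MorphismProperty.factorizationData _ _ _⟩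
  rw [llp_trivialKanFibrations] at hi
  refine ⟨E, i, hi, ⟨fun {A B} g f _ => ?_⟩⟩
  have := hp f (MorphismProperty.monomorphisms.infer_property _)
  have sq : CommSq g f p (terminal.from _) := ⟨terminal.hom_ext _ _⟩
  exact ⟨sq.lift, sq.fac_left⟩

end Mono

/-! ### Objectwise consequences of projective lifting properties -/

section Objectwise

variable {D : Type u} [Category.{v} D] [HasLimitsOfSize.{0, 0} D] {J : Type} [SmallCategory J]

/-- Powers of this kind are the values of the map of cofree diagrams induced by `p`. -/
theorem rlp_pi_lift {Q : MorphismProperty D} {A B : D} {p : A ⟶ B} (I : Type) (hp : Q.rlp p) :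
    Q.rlp (Pi.lift fun g => Pi.π (fun _ : I => A) g ≫ p : (∏ᶜ fun _ : I => A) ⟶ ∏ᶜ fun _ => B) := by
  intro X Y k hk
  have := hp k hk
  refine ⟨fun {a b} sq => ?_⟩
  have sq' (g : I) : CommSq (a ≫ Pi.π _ g) k p (b ≫ Pi.π _ g) := ⟨by
    simpa using sq.w =≫ Pi.π _ g⟩
  exact ⟨⟨⟨Pi.lift fun g => (sq' g).lift, Pi.hom_ext _ _ fun g => by simp,
    Pi.hom_ext _ _ fun g => by simp⟩⟩⟩

/-- A projective cofibration is objectwise a cofibration. -/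
theorem llp_app_of_llp_functorCategory {Q : MorphismProperty D} {F G : J ⥤ D} {i : F ⟶ G}
    (hi : (Q.rlp.functorCategory J).llp i) (j : J) : Q.rlp.llp (i.app j) := by
  intro A B p hp
  -- Evaluation at `j` is left adjoint to the cofree diagram functor, whose value at `c` is the
  -- power indexed by `c ⟶ j`.
  refine ((evaluationAdjunctionLeft D j).hasLiftingProperty_iff i p).2 (hi _ fun c => ?_)
  exact rlp_pi_lift (c ⟶ j) hp

/-- Lifting against objectwise right lifting classes is inherited by functors with left
adjoints. -/
theorem llp_map_of_adjunction {A B : Type*} [Category A] [Category B] {L : A ⥤ B} {R : B ⥤ A}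
    (adj : L ⊣ R) {P : MorphismProperty A} {Q : MorphismProperty B}
    (h : ∀ ⦃X Y : B⦄ (p : X ⟶ Y), Q p → P (R.map p)) {X Y : A} {i : X ⟶ Y} (hi : P.llp i) :
    Q.llp (L.map i) := fun _ _ p hp =>
  (adj.hasLiftingProperty_iff i p).2 (hi _ (h p hp))

end Objectwise


/-! ### Weighted coends -/

section WeightedCoend

variable {J : Type} [SmallCategory J] {S : Type u'} [Category.{v} S] {D : Type u} [Category.{v} D]

/-- The bifunctor `(m, n) ↦ V n ⊗ X m`, functorially in `V` and `X`. -/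
abbrev weightedBifunctor (T : S ⥤ D ⥤ D) : (J ⥤ S) ⥤ (Jᵒᵖ ⥤ D) ⥤ Jᵒᵖ ⥤ J ⥤ D :=
  Functor.whiskeringLeft J S D ⋙
    (Functor.whiskeringLeft D (S ⥤ D) (J ⥤ D)).obj T.flip ⋙
      Functor.whiskeringRight Jᵒᵖ D (J ⥤ D)

/-- The weighted coend `∫ⁿ V n ⊗ X n`. -/
noncomputable def weightedCoend [HasColimitsOfSize.{0, 0} D] (T : S ⥤ D ⥤ D) :
    (J ⥤ S) ⥤ (Jᵒᵖ ⥤ D) ⥤ D :=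
  weightedBifunctor T ⋙ (Functor.whiskeringRight _ _ _).obj (coendFunctor J D)

/-- The diagram `n ↦ E ^ (V n)`. -/
def weightedCotensor (R : Sᵒᵖ ⥤ D ⥤ D) : (J ⥤ S)ᵒᵖ ⥤ D ⥤ Jᵒᵖ ⥤ D where
  obj V :=
    { obj E := V.unop.op ⋙ R.flip.obj E
      map e := Functor.whiskerLeft _ (R.flip.map e) }
  map φ := { app E := Functor.whiskerRight (NatTrans.op φ.unop) (R.flip.obj E) }

/-- The diagram `n ↦ Map (X n, E)`. -/
def weightedMapping (M : Dᵒᵖ ⥤ D ⥤ S) : (Jᵒᵖ ⥤ D)ᵒᵖ ⥤ D ⥤ J ⥤ S where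
  obj X :=
    { obj E := X.unop.rightOp ⋙ M.flip.obj E
      map e := Functor.whiskerLeft _ (M.flip.map e) }
  map φ := { app E := { app n := (M.flip.obj E).map (φ.unop.app (op n)).op
                        naturality n n' f := by
                          dsimp
                          rw [← NatTrans.comp_app, ← NatTrans.comp_app, ← M.map_comp, ← M.map_comp,
                            ← op_comp, ← op_comp, φ.unop.naturality] } }

variable [HasColimitsOfSize.{0, 0} D] {T : S ⥤ D ⥤ D}

/-- The inclusion `V n ⊗ X n ⟶ ∫ⁿ V n ⊗ X n`. -/
noncomputable def weightedCoend.ι (T : S ⥤ D ⥤ D) (V : J ⥤ S) (X : Jᵒᵖ ⥤ D) (n : J) :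
    (T.obj (V.obj n)).obj (X.obj (op n)) ⟶ ((weightedCoend T).obj V).obj X :=
  coend.ι (((weightedBifunctor T).obj V).obj X) n

theorem weightedCoend.condition (V : J ⥤ S) (X : Jᵒᵖ ⥤ D) {i j : J} (f : i ⟶ j) :
    (T.obj (V.obj i)).map (X.map f.op) ≫ weightedCoend.ι T V X i =
      (T.map (V.map f)).app (X.obj (op j)) ≫ weightedCoend.ι T V X j :=
  coend.condition (((weightedBifunctor T).obj V).obj X) f

theorem weightedCoend.hom_ext {V : J ⥤ S} {X : Jᵒᵖ ⥤ D} {E : D}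
    {f g : ((weightedCoend T).obj V).obj X ⟶ E}
    (h : ∀ n, weightedCoend.ι T V X n ≫ f = weightedCoend.ι T V X n ≫ g) : f = g :=
  coend.hom_ext h

theorem weightedCoend.ι_map_app {V V' : J ⥤ S} (φ : V ⟶ V') (X : Jᵒᵖ ⥤ D) (n : J) :
    weightedCoend.ι T V X n ≫ ((weightedCoend T).map φ).app X =
      (T.map (φ.app n)).app (X.obj (op n)) ≫ weightedCoend.ι T V' X n :=
  coend.ι_map (((weightedBifunctor T).map φ).app X) n

theorem weightedCoend.ι_obj_map (V : J ⥤ S) {X X' : Jᵒᵖ ⥤ D} (φ : X ⟶ X') (n : J) :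
    weightedCoend.ι T V X n ≫ ((weightedCoend T).obj V).map φ =
      (T.obj (V.obj n)).map (φ.app (op n)) ≫ weightedCoend.ι T V X' n :=
  coend.ι_map (((weightedBifunctor T).obj V).map φ) n

/-- Maps out of a weighted coend. -/
noncomputable def weightedCoend.desc {V : J ⥤ S} {X : Jᵒᵖ ⥤ D} {E : D}
    (f : ∀ n, (T.obj (V.obj n)).obj (X.obj (op n)) ⟶ E)
    (hf : ∀ ⦃i j : J⦄ (g : i ⟶ j), (T.obj (V.obj i)).map (X.map g.op) ≫ f i =
      (T.map (V.map g)).app (X.obj (op j)) ≫ f j) : ((weightedCoend T).obj V).obj X ⟶ E :=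
  coend.desc (F := ((weightedBifunctor T).obj V).obj X) f hf

theorem weightedCoend.ι_desc {V : J ⥤ S} {X : Jᵒᵖ ⥤ D} {E : D}
    (f : ∀ n, (T.obj (V.obj n)).obj (X.obj (op n)) ⟶ E)
    (hf : ∀ ⦃i j : J⦄ (g : i ⟶ j), (T.obj (V.obj i)).map (X.map g.op) ≫ f i =
      (T.map (V.map g)).app (X.obj (op j)) ≫ f j) (n : J) :
    weightedCoend.ι T V X n ≫ weightedCoend.desc f hf = f n :=
  coend.ι_desc (F := ((weightedBifunctor T).obj V).obj X) f hf n

/-- Maps out of a weighted coend, in terms of pointwise cotensors. -/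
noncomputable def weightedCoendCotensorEquiv {R : Sᵒᵖ ⥤ D ⥤ D} (adj : T ⊣₂ R) (V : J ⥤ S)
    (X : Jᵒᵖ ⥤ D) (E : D) : (((weightedCoend T).obj V).obj X ⟶ E) ≃
      (X ⟶ ((weightedCotensor R).obj (op V)).obj E) where
  toFun g :=
    { app n := adj.homEquiv (weightedCoend.ι T V X n.unop ≫ g)
      naturality m n f := by
        change X.map f ≫ _ = _ ≫ (R.map (V.map f.unop).op).app E
        rw [← adj.homEquiv_naturality_one, ← adj.homEquiv_naturality_two,
          ← Category.assoc, ← Category.assoc]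
        exact congrArg (fun k => adj.homEquiv (k ≫ g))
          (weightedCoend.condition V X f.unop) }
  invFun h := weightedCoend.desc (fun n => adj.homEquiv.symm (h.app (op n))) (by
    intro i j g
    refine (adj.homEquiv_symm_naturality_two _ _).symm.trans
      (Eq.trans ?_ (adj.homEquiv_symm_naturality_one _ _))
    exact congrArg _ (h.naturality g.op))
  left_inv g := weightedCoend.hom_ext fun n => by
    rw [weightedCoend.ι_desc]
    exact adj.homEquiv.symm_apply_apply _
  right_inv h := by
    ext n
    dsimp only
    rw [weightedCoend.ι_desc]
    exact adj.homEquiv.apply_symm_apply _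

/-- Maps out of a weighted coend, in terms of pointwise mapping objects. -/
noncomputable def weightedCoendMappingEquiv {M : Dᵒᵖ ⥤ D ⥤ S} (adj : T.flip ⊣₂ M) (V : J ⥤ S)
    (X : Jᵒᵖ ⥤ D) (E : D) : (((weightedCoend T).obj V).obj X ⟶ E) ≃
      (V ⟶ ((weightedMapping M).obj (op X)).obj E) where
  toFun g :=
    { app n := adj.homEquiv (X₁ := X.obj (op n)) (weightedCoend.ι T V X n ≫ g)
      naturality m n f := by
        change V.map f ≫ _ = _ ≫ (M.map (X.map f.op).op).app E
        rw [← adj.homEquiv_naturality_one, ← adj.homEquiv_naturality_two,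
          ← Category.assoc, ← Category.assoc]
        exact congrArg (fun k => adj.homEquiv (k ≫ g))
          (weightedCoend.condition V X f).symm }
  invFun h := weightedCoend.desc (fun n => adj.homEquiv.symm (h.app n)) (by
    intro i j g
    refine (adj.homEquiv_symm_naturality_one _ _).symm.trans
      (Eq.trans ?_ (adj.homEquiv_symm_naturality_two _ _))
    exact congrArg _ (h.naturality g).symm)
  left_inv g := weightedCoend.hom_ext fun n => by
    rw [weightedCoend.ι_desc]
    exact adj.homEquiv.symm_apply_apply _
  right_inv h := by
    ext n : 2
    dsimp only
    rw [weightedCoend.ι_desc]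
    exact adj.homEquiv.apply_symm_apply _

/-- Weighted coends are left adjoint to pointwise cotensors. -/
noncomputable def weightedCoendCotensorAdj {R : Sᵒᵖ ⥤ D ⥤ D} (adj : T ⊣₂ R) :
    weightedCoend (J := J) T ⊣₂ weightedCotensor R :=
  ParametrizedAdjunction.mk'
    (fun V => Adjunction.mkOfHomEquiv
      { homEquiv X E := weightedCoendCotensorEquiv adj V X E
        homEquiv_naturality_left_symm {X X' E} f g := by
          have key (g : ((weightedCoend T).obj V).obj X' ⟶ E) :
              weightedCoendCotensorEquiv adj V X E (((weightedCoend T).obj V).map f ≫ g) =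
                f ≫ weightedCoendCotensorEquiv adj V X' E g := by
            ext n
            change adj.homEquiv _ = _ ≫ adj.homEquiv _
            rw [← Category.assoc, weightedCoend.ι_obj_map, Category.assoc]
            exact adj.homEquiv_naturality_two _ _
          rw [Equiv.symm_apply_eq, key, Equiv.apply_symm_apply]
        homEquiv_naturality_right {X E E'} f g := by
          ext n
          change adj.homEquiv _ = adj.homEquiv _ ≫ _
          rw [← Category.assoc]
          exact adj.homEquiv_naturality_three _ _ })
    (fun {V V'} f X E g => by
      rw [Adjunction.mkOfHomEquiv_homEquiv, Adjunction.mkOfHomEquiv_homEquiv]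
      ext n
      change adj.homEquiv _ = adj.homEquiv _ ≫ _
      rw [← Category.assoc, weightedCoend.ι_map_app, Category.assoc]
      exact adj.homEquiv_naturality_one _ _)

/-- Weighted coends are left adjoint to pointwise mapping objects. -/
noncomputable def weightedCoendMappingAdj {M : Dᵒᵖ ⥤ D ⥤ S} (adj : T.flip ⊣₂ M) :
    (weightedCoend (J := J) T).flip ⊣₂ weightedMapping M :=
  ParametrizedAdjunction.mk'
    (fun X => Adjunction.mkOfHomEquiv
      { homEquiv V E := weightedCoendMappingEquiv adj V X E
        homEquiv_naturality_left_symm {V V' E} f g := by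
          have key (g : ((weightedCoend T).obj V').obj X ⟶ E) :
              weightedCoendMappingEquiv adj V X E (((weightedCoend T).map f).app X ≫ g) =
                f ≫ weightedCoendMappingEquiv adj V' X E g := by
            ext n : 2
            change adj.homEquiv _ = _ ≫ adj.homEquiv _
            rw [← Category.assoc, weightedCoend.ι_map_app, Category.assoc]
            exact adj.homEquiv_naturality_two _ _
          rw [Equiv.symm_apply_eq]
          refine Eq.trans ?_ (key _).symm
          rw [Equiv.apply_symm_apply]
        homEquiv_naturality_right {V E E'} f g := by
          ext n : 2
          change adj.homEquiv _ = adj.homEquiv _ ≫ _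
          rw [← Category.assoc]
          exact adj.homEquiv_naturality_three _ _ })
    (fun {X X'} f V E g => by
      rw [Adjunction.mkOfHomEquiv_homEquiv, Adjunction.mkOfHomEquiv_homEquiv]
      ext n : 2
      change adj.homEquiv _ = adj.homEquiv _ ≫ _
      rw [← Category.assoc, Functor.flip_map_app, weightedCoend.ι_obj_map, Category.assoc]
      exact adj.homEquiv_naturality_one _ _)

end WeightedCoend


/-! ### Two-variable Quillen adjunctions -/

/-- A Quillen adjunction of two variables `SSet × D ⟶ D`, stated in terms of the mapping
objects, together with a natural transformation `Δ[0] ⊗ - ⟶ 𝟭 D` which is a weak equivalence on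
cofibrant objects. -/
structure QuillenTensor (D : Type u) [Category.{v} D] [ModelCategory D] where
  tensor : SSet.{v} ⥤ D ⥤ D
  cotensor : SSet.{v}ᵒᵖ ⥤ D ⥤ D
  mapping : Dᵒᵖ ⥤ D ⥤ SSet.{v}
  cotensorAdj : tensor ⊣₂ cotensor
  mappingAdj : tensor.flip ⊣₂ mapping
  -- The pushout-product axiom, transposed to pullback-homs of mapping objects. In this form it is
  -- self-dual: passing to the opposite category exchanges `j` and `p`, hence the first two
  -- conditions, and preserves the third.
  trivialKan_of_trivialFibration {A A' B B' : D} (j : A ⟶ A') (p : B ⟶ B') [Cofibration j]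
    [Fibration p] [WeakEquivalence p] (sq : mapping.PullbackObjObj j p) :
    trivialKanFibrations sq.π
  trivialKan_of_trivialCofibration {A A' B B' : D} (j : A ⟶ A') (p : B ⟶ B') [Cofibration j]
    [WeakEquivalence j] [Fibration p] (sq : mapping.PullbackObjObj j p) :
    trivialKanFibrations sq.π
  hasLiftingProperty {K L : SSet.{v}} (i : K ⟶ L) [Mono i] [WeakEquivalence i]
    {A A' B B' : D} (j : A ⟶ A') (p : B ⟶ B') [Cofibration j] [Fibration p]
    (sq : mapping.PullbackObjObj j p) : HasLiftingProperty i sq.π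
  counit : tensor.obj Δ[0] ⟶ 𝟭 D
  weakEquivalence_counit_app (X : D) [IsCofibrant X] : WeakEquivalence (counit.app X)

section LiftingLemmas

variable {A B E : Type*} [Category A] [Category B] [Category E]
  {F : A ⥤ B ⥤ E} {G : Aᵒᵖ ⥤ E ⥤ B} {H : Bᵒᵖ ⥤ E ⥤ A}

/-- The Leibniz product of `f` with `∅ ⟶ b` is `F(f, b)`, since the partial functors are left
adjoints and preserve the initial object. -/
theorem hasLiftingProperty_map_app_iff [HasInitial B] (adj : F ⊣₂ G) {a a' : A} (f : a ⟶ a')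
    (b : B) {e e' : E} (p : e ⟶ e') (sq : G.PullbackObjObj f p) :
    HasLiftingProperty ((F.map f).app b) p ↔ HasLiftingProperty (initial.to b) sq.π := by
  have := (adj.adj a).isLeftAdjoint
  have := (adj.adj a').isLeftAdjoint
  exact adj.hasLiftingProperty_iff
    (Functor.PushoutObjObj.ofIsInitialRight F f (initial.to b) initialIsInitial) sq

/-- Both sides are transposes of the lifting of the pushout-product of `f` and `g` against `p`. -/
theorem hasLiftingProperty_pullbackObjObj_iff [HasPushouts E] (adj : F ⊣₂ G) (adj' : F.flip ⊣₂ H)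
    {a a' : A} (f : a ⟶ a') {b b' : B} (g : b ⟶ b') {e e' : E} (p : e ⟶ e')
    (sq : G.PullbackObjObj f p) (sq' : H.PullbackObjObj g p) :
    HasLiftingProperty g sq.π ↔ HasLiftingProperty f sq'.π := by
  rw [← adj.hasLiftingProperty_iff (.ofHasPushout F f g) sq,
    ← adj'.hasLiftingProperty_iff (Functor.PushoutObjObj.ofHasPushout F f g).flip sq']
  rfl

/-- The evaluation of a pullback-hom in a category of diagrams of cotensors. -/
noncomputable def pullbackObjObjCotensorEval {S D : Type*} [Category S]
    [Category D] {R : Sᵒᵖ ⥤ D ⥤ D} [HasPullbacks D] {J : Type} [SmallCategory J]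
    {V V' : J ⥤ S} {φ : V ⟶ V'}
    {e e' : D} {p : e ⟶ e'} (sq : (weightedCotensor R).PullbackObjObj φ p) (n : J) :
    R.PullbackObjObj (φ.app n) p where
  pt := sq.pt.obj (op n)
  fst := sq.fst.app (op n)
  snd := sq.snd.app (op n)
  isPullback := sq.isPullback.map ((evaluation _ _).obj (op n))
  π := sq.π.app (op n)
  π_fst := NatTrans.congr_app sq.π_fst (op n)
  π_snd := NatTrans.congr_app sq.π_snd (op n)

/-- The evaluation of a pullback-hom in a category of diagrams of mapping objects. -/
noncomputable def pullbackObjObjMappingEval {S D : Type*} [Category S]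
    [Category D] {M : Dᵒᵖ ⥤ D ⥤ S} [HasPullbacks S] {J : Type} [SmallCategory J]
    {X X' : Jᵒᵖ ⥤ D} {φ : X ⟶ X'}
    {e e' : D} {p : e ⟶ e'} (sq : (weightedMapping M).PullbackObjObj φ p) (n : J) :
    M.PullbackObjObj (φ.app (op n)) p where
  pt := sq.pt.obj n
  fst := sq.fst.app n
  snd := sq.snd.app n
  isPullback := sq.isPullback.map ((evaluation _ _).obj n)
  π := sq.π.app n
  π_fst := NatTrans.congr_app sq.π_fst n
  π_snd := NatTrans.congr_app sq.π_snd n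

end LiftingLemmas

/-! ### Coproduct inclusions and mapping cylinders -/

section CofibrantReplacement

variable {D : Type u} [Category.{v} D] {J : Type w} [Category.{w'} J]

/-- Objectwise, the inclusion is a cobase change of `∅ ⟶ G j`. -/
theorem app_coprod_inl_mem [HasColimitsOfSize.{0, 0} D] (P : MorphismProperty D)
    [P.IsStableUnderCobaseChange] (F G : J ⥤ D) (j : J) (h : P ((initial.to G).app j)) :
    P ((coprod.inl : F ⟶ F ⨿ G).app j) :=
  P.of_isPushout ((IsPushout.of_hasBinaryCoproduct' F G).map ((evaluation J D).obj j)) h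

theorem app_coprod_inr_mem [HasColimitsOfSize.{0, 0} D] (P : MorphismProperty D)
    [P.IsStableUnderCobaseChange] (F G : J ⥤ D) (j : J) (h : P ((initial.to F).app j)) :
    P ((coprod.inr : G ⟶ F ⨿ G).app j) :=
  P.of_isPushout ((IsPushout.of_hasBinaryCoproduct' F G).map ((evaluation J D).obj j)).flip h

theorem isInitial_initial_obj [HasColimitsOfSize.{0, 0} D] (j : J) :
    Nonempty (IsInitial ((⊥_ (J ⥤ D)).obj j)) :=
  ⟨initialIsInitial.isInitialObj ((evaluation J D).obj j)⟩

/-- The mapping cylinder factorization of a map of diagrams. -/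
structure CylinderFactorization {E : Type*} [Category E] {X Y : E} (φ : X ⟶ Y) where
  Z : E
  inl : X ⟶ Z
  inr : Y ⟶ Z
  proj : Z ⟶ Y
  inl_proj : inl ≫ proj = φ
  inr_proj : inr ≫ proj = 𝟙 Y

/-- Ken Brown's argument: `Φ(proj)` is a retraction of the weak equivalence `Φ(inr)`, so it is a
weak equivalence, and `φ = inl ≫ proj`. -/
theorem CylinderFactorization.weakEquivalence_map {E : Type*} [Category E] {X Y : E} {φ : X ⟶ Y}
    (c : CylinderFactorization φ) [CategoryWithWeakEquivalences D]
    [(weakEquivalences D).HasTwoOutOfThreeProperty] [(weakEquivalences D).ContainsIdentities]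
    (Φ : E ⥤ D)
    (hl : WeakEquivalence (Φ.map c.inl)) (hr : WeakEquivalence (Φ.map c.inr)) :
    WeakEquivalence (Φ.map φ) := by
  have h : Φ.map c.inr ≫ Φ.map c.proj = 𝟙 _ := by rw [← Φ.map_comp, c.inr_proj, Φ.map_id]
  have : WeakEquivalence (Φ.map c.proj) := weakEquivalence_of_precomp_of_fac h
  rw [← c.inl_proj, Φ.map_comp]
  infer_instance

/-- The mapping cylinder associated with a factorization of `X ⨿ Y ⟶ Y`. -/
noncomputable def CylinderFactorization.ofFactorization {E : Type*} [Category E] {X Y : E}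
    {φ : X ⟶ Y} [HasBinaryCoproduct X Y] {P Q : MorphismProperty E}
    (d : MorphismProperty.MapFactorizationData P Q (coprod.desc φ (𝟙 Y))) :
    CylinderFactorization φ where
  Z := d.Z
  inl := coprod.inl ≫ d.i
  inr := coprod.inr ≫ d.i
  proj := d.p
  inl_proj := by rw [Category.assoc, d.fac]; exact coprod.inl_desc _ _
  inr_proj := by rw [Category.assoc, d.fac]; exact coprod.inr_desc _ _

end CofibrantReplacement

/-! ### Projectively cofibrant weights and cylinders of weights -/

section Weights

variable {J : Type} [SmallCategory J]

/-- A projectively cofibrant diagram of simplicial sets. -/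
def IsProjectiveWeight (V : J ⥤ SSet.{v}) : Prop :=
  (trivialKanFibrations.{v}.functorCategory J).llp (initial.to V)

instance mono_initial_to_app (V : J ⥤ SSet.{v}) (n : J) : Mono ((initial.to V).app n) := by
  obtain ⟨h⟩ := isInitial_initial_obj (D := SSet.{v}) n
  exact h.mono_from _

instance mono_coprod_inl_app {V V' : J ⥤ SSet.{v}} (n : J) :
    Mono ((coprod.inl : V ⟶ V ⨿ V').app n) :=
  app_coprod_inl_mem (MorphismProperty.monomorphisms _) V V' n (mono_initial_to_app V' n)

instance mono_coprod_inr_app {V V' : J ⥤ SSet.{v}} (n : J) :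
    Mono ((coprod.inr : V' ⟶ V ⨿ V').app n) :=
  app_coprod_inr_mem (MorphismProperty.monomorphisms _) V V' n (mono_initial_to_app V n)

theorem mono_app_of_llp {V V' : J ⥤ SSet.{v}} {i : V ⟶ V'}
    (hi : (trivialKanFibrations.{v}.functorCategory J).llp i) (n : J) : Mono (i.app n) := by
  have := llp_app_of_llp_functorCategory hi n
  change trivialKanFibrations.llp _ at this
  rwa [llp_trivialKanFibrations] at this

/-- The mapping cylinder of a weak equivalence of weights. -/
theorem exists_cylinderFactorization {V V' : J ⥤ SSet.{v}} (φ : V ⟶ V')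
    (hφ : ∀ n, WeakEquivalence (φ.app n)) :
    ∃ (c : CylinderFactorization φ) (i : V ⨿ V' ⟶ c.Z),
      (trivialKanFibrations.{v}.functorCategory J).llp i ∧ c.inl = coprod.inl ≫ i ∧
      c.inr = coprod.inr ≫ i ∧
      ∀ n, WeakEquivalence (c.inl.app n) ∧ WeakEquivalence (c.inr.app n) ∧
        Mono (c.inl.app n) ∧ Mono (c.inr.app n) := by
  -- The weights need not be cofibrant: every `∅ ⟶ V n` is monic, so both coproduct inclusions are
  -- objectwise monomorphisms.
  let d : MorphismProperty.MapFactorizationData (trivialKanFibrations.{v}.functorCategory J).llp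
    (trivialKanFibrations.{v}.functorCategory J) (coprod.desc φ (𝟙 V')) :=
      MorphismProperty.factorizationData _ _ _
  refine ⟨.ofFactorization d, d.i, d.hi, rfl, rfl, fun n => ?_⟩
  have h₁ := NatTrans.congr_app (CylinderFactorization.ofFactorization d).inl_proj n
  have h₂ := NatTrans.congr_app (CylinderFactorization.ofFactorization d).inr_proj n
  have : WeakEquivalence ((CylinderFactorization.ofFactorization d).proj.app n) :=
    weakEquivalence_of_trivialKanFibration _ (d.hp n)
  have := hφ n
  have hm := mono_app_of_llp d.hi n
  have : WeakEquivalence ((𝟙 V' : V' ⟶ V').app n) := by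
    rw [sset_weakEquivalence_iff]
    intro Z _
    exact (HomotopyClasses.precomp_id (V'.obj n) Z) ▸ Function.bijective_id
  refine ⟨weakEquivalence_of_postcomp_of_fac h₁, weakEquivalence_of_postcomp_of_fac h₂, ?_, ?_⟩
  · exact mono_comp ((coprod.inl : V ⟶ V ⨿ V').app n) (d.i.app n)
  · exact mono_comp ((coprod.inr : V' ⟶ V ⨿ V').app n) (d.i.app n)

end Weights

/-! ### Homotopy invariance of weighted coends in the projective setting -/

namespace QuillenTensor

variable {D : Type u} [Category.{v} D] [ModelCategory D] (Q : QuillenTensor D)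
  {J : Type} [SmallCategory J]

/-- Lifting a cofibration `j` against this pullback-hom is the same as lifting `i` against the
pullback-hom of mapping objects of `j` and `p`. -/
theorem trivialFibration_cotensor_of_weakEquivalence {K L : SSet.{v}} (i : K ⟶ L) [Mono i]
    [WeakEquivalence i] {B B' : D} (p : B ⟶ B') [Fibration p] (sq : Q.cotensor.PullbackObjObj i p) :
    trivialFibrations D sq.π := by
  rw [← cofibrations_rlp]
  intro A A' j hj
  have : Cofibration j := ⟨hj⟩
  rw [hasLiftingProperty_pullbackObjObj_iff Q.cotensorAdj Q.mappingAdj i j p sq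
    (.ofHasPullback _ _ _)]
  exact Q.hasLiftingProperty i j p _

theorem weakEquivalence_of_llp_fibrations {A B : D} (i : A ⟶ B) (hi : (fibrations D).llp i) :
    WeakEquivalence i := by
  rw [fibrations_llp] at hi
  exact ⟨hi.2⟩

variable [HasColimitsOfSize.{0, 0} D]

/-- Lifting the induced map against a fibration `p` transposes to lifting `∅ ⟶ F` against the
diagram of pullback-homs of cotensors of `φ n` and `p`, which is objectwise a trivial fibration. -/
theorem weakEquivalence_map_app_of_mono {V V' : J ⥤ SSet.{v}} (φ : V ⟶ V')
    (hm : ∀ n, Mono (φ.app n)) (hw : ∀ n, WeakEquivalence (φ.app n))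
    (F : Jᵒᵖ ⥤ D) (hF : IsProjectivelyCofibrant F) :
    WeakEquivalence (((weightedCoend Q.tensor).map φ).app F) := by
  refine weakEquivalence_of_llp_fibrations _ fun B B' p hp => ?_
  have : Fibration p := ⟨hp⟩
  refine (hasLiftingProperty_map_app_iff (weightedCoendCotensorAdj Q.cotensorAdj) φ F p
    (.ofHasPullback _ _ _)).2 ?_
  refine hF _ fun n => ?_
  have := hm n.unop
  have := hw n.unop
  exact Q.trivialFibration_cotensor_of_weakEquivalence (φ.app n.unop) p
    (pullbackObjObjCotensorEval _ n.unop)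

/-- The transposition in the other variable: `∅ ⟶ V` is lifted against the pullback-homs of mapping
objects of `α n` and `p`, which are trivial Kan fibrations. -/
theorem weakEquivalence_obj_map_of_cofibration {F X : Jᵒᵖ ⥤ D} (α : F ⟶ X)
    (hc : ∀ n, Cofibration (α.app n)) (hw : ∀ n, WeakEquivalence (α.app n))
    (V : J ⥤ SSet.{v}) (hV : IsProjectiveWeight V) :
    WeakEquivalence (((weightedCoend Q.tensor).obj V).map α) := by
  refine weakEquivalence_of_llp_fibrations _ fun B B' p hp => ?_
  have : Fibration p := ⟨hp⟩
  refine (hasLiftingProperty_map_app_iff (weightedCoendMappingAdj Q.mappingAdj) α V p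
    (.ofHasPullback _ _ _)).2 ?_
  refine hV _ fun n => ?_
  have := hc (op n)
  have := hw (op n)
  exact Q.trivialKan_of_trivialCofibration (α.app (op n)) p
    (pullbackObjObjMappingEval _ n)

/-- Weak equivalences of weights induce weak equivalences of weighted colimits of projectively
cofibrant diagrams. -/
theorem weakEquivalence_map_app {V V' : J ⥤ SSet.{v}} (φ : V ⟶ V')
    (hw : ∀ n, WeakEquivalence (φ.app n))
    (F : Jᵒᵖ ⥤ D) (hF : IsProjectivelyCofibrant F) :
    WeakEquivalence (((weightedCoend Q.tensor).map φ).app F) := by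
  obtain ⟨c, i, -, -, -, hc⟩ := exists_cylinderFactorization φ hw
  exact c.weakEquivalence_map ((weightedCoend Q.tensor).flip.obj F)
    (Q.weakEquivalence_map_app_of_mono _ (fun n => (hc n).2.2.1) (fun n => (hc n).1) F hF)
    (Q.weakEquivalence_map_app_of_mono _ (fun n => (hc n).2.2.2) (fun n => (hc n).2.1) F hF)

theorem cofibration_initial_to_app {K : Type*} [Category K]
    (F : K ⥤ D) (n : K) [IsCofibrant (F.obj n)] : Cofibration ((initial.to F).app n) := by
  obtain ⟨h⟩ := isInitial_initial_obj (D := D) n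
  exact (isCofibrant_iff_of_isInitial _ h).1 inferInstance

/-- Projectively cofibrant weights preserve weak equivalences between objectwise cofibrant
diagrams. -/
theorem weakEquivalence_obj_map
    [MorphismProperty.HasFunctorialFactorization (cofibrations D) (trivialFibrations D)]
    {F X : Jᵒᵖ ⥤ D} (α : F ⟶ X) (hF : ∀ n, IsCofibrant (F.obj n))
    (hX : ∀ n, IsCofibrant (X.obj n)) (hw : ∀ n, WeakEquivalence (α.app n))
    (V : J ⥤ SSet.{v}) (hV : IsProjectiveWeight V) :
    WeakEquivalence (((weightedCoend Q.tensor).obj V).map α) := by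
  -- Functoriality of the factorizations in `D` turns the objectwise ones into a factorization of
  -- diagrams. Objectwise cofibrancy of `F` and `X` then makes both legs of the cylinder objectwise
  -- cofibrations.
  let d : MorphismProperty.MapFactorizationData ((cofibrations D).functorCategory Jᵒᵖ)
    ((trivialFibrations D).functorCategory Jᵒᵖ) (coprod.desc α (𝟙 X)) :=
      MorphismProperty.factorizationData _ _ _
  let c := CylinderFactorization.ofFactorization d
  have h (n) : WeakEquivalence (c.inl.app n) ∧ WeakEquivalence (c.inr.app n) ∧
      Cofibration (c.inl.app n) ∧ Cofibration (c.inr.app n) := by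
    have h₁ : c.inl.app n ≫ c.proj.app n = α.app n := NatTrans.congr_app c.inl_proj n
    have h₂ : c.inr.app n ≫ c.proj.app n = 𝟙 _ := NatTrans.congr_app c.inr_proj n
    have : WeakEquivalence (c.proj.app n) := ⟨(d.hp n).2⟩
    have := hw n
    have := hX n
    have := hF n
    have : Cofibration (d.i.app n) := ⟨d.hi n⟩
    have : Cofibration ((coprod.inl : F ⟶ F ⨿ X).app n) :=
      ⟨app_coprod_inl_mem (cofibrations D) F X n (cofibration_initial_to_app X n).1⟩
    have : Cofibration ((coprod.inr : X ⟶ F ⨿ X).app n) :=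
      ⟨app_coprod_inr_mem (cofibrations D) F X n (cofibration_initial_to_app F n).1⟩
    refine ⟨weakEquivalence_of_postcomp_of_fac h₁, weakEquivalence_of_postcomp_of_fac h₂, ?_, ?_⟩
    · exact inferInstanceAs (Cofibration ((coprod.inl : F ⟶ F ⨿ X).app n ≫ d.i.app n))
    · exact inferInstanceAs (Cofibration ((coprod.inr : X ⟶ F ⨿ X).app n ≫ d.i.app n))
  exact c.weakEquivalence_map ((weightedCoend Q.tensor).obj V)
    (Q.weakEquivalence_obj_map_of_cofibration _ (fun n => (h n).2.2.1) (fun n => (h n).1) V hV)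
    (Q.weakEquivalence_obj_map_of_cofibration _ (fun n => (h n).2.2.2) (fun n => (h n).2.1) V hV)

end QuillenTensor


/-! ### Constructions by recursion on the degree -/

section Recursion

variable {ι : Type w} (deg : ι → ℕ) {α : ι → Type w'} (P : ∀ i j, α i → α j → Prop)

/-- Families of elements with pairwise compatibilities can be constructed by recursion on the
degree of the indices. -/
theorem exists_compatible_family (hP : ∀ i j, deg i = deg j → i ≠ j → ∀ a b, P i j a b)
    (step : ∀ i (f : ∀ j, deg j < deg i → α j),
      (∀ j k hj hk, P j k (f j hj) (f k hk)) →
      ∃ a : α i, P i i a a ∧ ∀ j hj, P i j a (f j hj) ∧ P j i (f j hj) a) :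
    ∃ f : ∀ i, α i, ∀ i j, P i j (f i) (f j) := by
  classical
  -- Compatible partial families on the indices of degree below `N`. Each extension to `N + 1`
  -- restricts strictly to the previous family, so values never change once chosen.
  let S (N : ℕ) := { f : ∀ i, deg i < N → α i // ∀ i j hi hj, P i j (f i hi) (f j hj) }
  have next (N : ℕ) (s : S N) : ∃ t : S (N + 1), ∀ i (hi : deg i < N),
      t.1 i (hi.trans N.lt_succ_self) = s.1 i hi := by
    have st (i) (h : ¬ deg i < N) (h' : deg i < N + 1) := step i
      (fun j hj => s.1 j (by omega)) (fun j k hj hk => s.2 j k _ _)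
    choose a ha hab using st
    refine ⟨⟨fun i hi => if h : deg i < N then s.1 i h else a i h hi, ?_⟩, fun i hi => dif_pos hi⟩
    intro i j hi hj
    by_cases h₁ : deg i < N <;> by_cases h₂ : deg j < N
    · simp only [dif_pos h₁, dif_pos h₂]
      exact s.2 i j h₁ h₂
    · simp only [dif_pos h₁, dif_neg h₂]
      exact (hab j h₂ hj i (by omega)).2
    · simp only [dif_neg h₁, dif_pos h₂]
      exact (hab i h₁ hi j (by omega)).1
    -- Both indices are new, hence of degree exactly `N`: either they coincide, or `hP` applies.
    · simp only [dif_neg h₁, dif_neg h₂]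
      by_cases hij : i = j
      · subst hij
        exact ha i h₁ hi
      · exact hP i j (by omega) hij _ _
  choose nx hnx using next
  -- The value at `i` is read off at stage `deg i + 1`, the first at which it is defined.
  let s (N : ℕ) : S N := Nat.rec ⟨fun i hi => (Nat.not_lt_zero _ hi).elim,
    fun i j hi => (Nat.not_lt_zero _ hi).elim⟩ (fun N t => nx N t) N
  have hs (i : ι) (N : ℕ) (hN : deg i + 1 ≤ N) : (s N).1 i hN = (s (deg i + 1)).1 i (Nat.lt_succ_self _) := by
    induction N, hN using Nat.le_induction with
    | base => rfl
    | succ N hN ih => exact (hnx N (s N) i hN).trans ih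
  refine ⟨fun i => (s (deg i + 1)).1 i (Nat.lt_succ_self _), fun i j => ?_⟩
  dsimp only
  rw [← hs i (max (deg i + 1) (deg j + 1)) (le_max_left _ _),
    ← hs j (max (deg i + 1) (deg j + 1)) (le_max_right _ _)]
  exact (s _).2 i j _ _

end Recursion

/-! ### Boundaries in the simplex category -/

section Boundary

theorem exists_epi_mono_factorization {m n : SimplexCategory} (f : m ⟶ n) :
    ∃ (k : SimplexCategory) (e : m ⟶ k) (u : k ⟶ n), Epi e ∧ Mono u ∧ e ≫ u = f :=
  ⟨image f, factorThruImage f, image.ι f, inferInstance, inferInstance, image.fac f⟩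

theorem len_lt_of_mono_of_not_epi {k n : SimplexCategory} (u : k ⟶ n) [Mono u] (hu : ¬ Epi u) :
    k.len < n.len := by
  refine lt_of_le_of_ne (SimplexCategory.len_le_of_mono u) fun h => hu ?_
  obtain rfl : k = n := SimplexCategory.ext h
  rw [SimplexCategory.eq_id_of_mono u]
  infer_instance

theorem not_epi_of_len_lt {k n : SimplexCategory} (u : k ⟶ n) (h : k.len < n.len) : ¬ Epi u :=
  fun _ => (SimplexCategory.len_le_of_epi u).not_gt h

theorem exists_epi_mono_factorization_of_not_epi {m n : SimplexCategory} (f : m ⟶ n)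
    (hf : ¬ Epi f) : ∃ (k : SimplexCategory) (e : m ⟶ k) (u : k ⟶ n),
      Epi e ∧ Mono u ∧ k.len < n.len ∧ e ≫ u = f := by
  obtain ⟨k, e, u, he, hu, rfl⟩ := exists_epi_mono_factorization f
  exact ⟨k, e, u, he, hu, len_lt_of_mono_of_not_epi u fun _ => hf (epi_comp e u), rfl⟩

theorem not_epi_precomp {k m n : SimplexCategory} (g : k ⟶ m) {f : m ⟶ n} (hf : ¬ Epi f) :
    ¬ Epi (g ≫ f) :=
  fun _ => hf (epi_of_epi g f)

/-- A family of elements indexed by the proper faces of `[n]` extends to a family indexed by all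
the simplices of the boundary of `[n]`. -/
theorem exists_boundary_family (P : SimplexCategoryᵒᵖ ⥤ Type w) (n : SimplexCategory)
    (c : ∀ (k : SimplexCategory) (u : k ⟶ n) [Mono u], k.len < n.len → P.obj (op k))
    (hc : ∀ (k k' : SimplexCategory) (w : k' ⟶ k) (u : k ⟶ n) [Mono w] [Mono u]
      (h : k.len < n.len), c k' (w ≫ u) ((SimplexCategory.len_le_of_mono w).trans_lt h) =
        P.map w.op (c k u h)) :
    ∃ d : ∀ (m : SimplexCategory) (f : m ⟶ n), ¬ Epi f → P.obj (op m),
      (∀ (m m' : SimplexCategory) (g : m' ⟶ m) (f : m ⟶ n) (hf : ¬ Epi f),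
        d m' (g ≫ f) (not_epi_precomp g hf) = P.map g.op (d m f hf)) ∧
      ∀ (k : SimplexCategory) (u : k ⟶ n) [Mono u] (h : k.len < n.len),
        d k u (not_epi_of_len_lt u h) = c k u h := by
  choose K e u he hu hlt hfac using
    fun (m : SimplexCategory) (f : m ⟶ n) (hf : ¬ Epi f) =>
      exists_epi_mono_factorization_of_not_epi f hf
  let d (m : SimplexCategory) (f : m ⟶ n) (hf : ¬ Epi f) : P.obj (op m) :=
    P.map (e m f hf).op (c (K m f hf) (u m f hf) (hlt m f hf))
  -- The value at `f` may be computed from any factorization through a proper face: the chosen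
  -- epimorphism is strong, so it lifts against the monomorphism `v` and compares the two.
  have key (m : SimplexCategory) (f : m ⟶ n) (hf : ¬ Epi f) (k : SimplexCategory) (g : m ⟶ k)
      (v : k ⟶ n) [Mono v] (h : k.len < n.len) (hgv : g ≫ v = f) :
      d m f hf = P.map g.op (c k v h) := by
    have := he m f hf
    have := hu m f hf
    have sq : CommSq g (e m f hf) v (u m f hf) := ⟨hgv.trans (hfac m f hf).symm⟩
    have : StrongEpi (e m f hf) := strongEpi_of_epi _
    have hw₁ := sq.fac_left
    have hw₂ := sq.fac_right
    have : Mono sq.lift := mono_of_mono_fac hw₂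
    have := hc _ _ sq.lift v h
    simp only [hw₂] at this
    change P.map _ _ = _
    rw [this, ← Functor.map_comp_apply, ← op_comp, hw₁]
  refine ⟨d, fun m m' g f hf => ?_, fun k v _ h => ?_⟩
  · have := hu m f hf
    rw [key _ _ _ _ (g ≫ e m f hf) (u m f hf) (hlt m f hf) (by rw [Category.assoc, hfac]),
      op_comp, Functor.map_comp_apply]
  · rw [key _ _ _ _ (𝟙 k) v h (Category.id_comp v), op_id, Functor.map_id_apply]

end Boundary


/-! ### Lifting properties of Reedy cofibrant simplicial objects -/

section Reedy

variable {D : Type u} [Category.{v} D]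

/-- The cocone over the latching diagram with point `X n`. -/
def latchingCocone (X : SimplexCategoryᵒᵖ ⥤ D) (n : SimplexCategory) :
    Cocone (latchingDiagram X n) where
  pt := X.obj (op n)
  ι :=
    { app := fun f => X.map f.unop.obj.hom.op
      naturality := fun f g φ => by
        have h : g.unop.obj.hom ≫ φ.unop.hom.right = f.unop.obj.hom := Under.w φ.unop.hom
        change X.map φ.unop.hom.right.op ≫ X.map g.unop.obj.hom.op =
          X.map f.unop.obj.hom.op ≫ 𝟙 _
        rw [← X.map_comp, ← op_comp, h, Category.comp_id] }

/-- Reedy cofibrancy, formulated with arbitrary latching objects. -/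
def HasCofibrantLatchingMaps [CategoryWithCofibrations D] (X : SimplexCategoryᵒᵖ ⥤ D) : Prop :=
  ∀ n, ∃ (c : Cocone (latchingDiagram X n)) (hc : IsColimit c),
    Cofibration (hc.desc (latchingCocone X n))

theorem IsReedyCofibrant.hasCofibrantLatchingMaps [HasColimitsOfSize.{0, 0} D]
    [CategoryWithCofibrations D] {X : SimplexCategoryᵒᵖ ⥤ D} (hX : IsReedyCofibrant X) :
    HasCofibrantLatchingMaps X := fun n =>
  ⟨_, colimit.isColimit _, hX n⟩

variable [CategoryWithCofibrations D]

/-- The universal property of the latching object, freed from under categories. An epimorphism out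
of `[n]` is non-invertible exactly when it lowers the degree, so proper quotients become
epimorphisms `n ⟶ k` with `k.len < n.len`. -/
theorem HasCofibrantLatchingMaps.exists_latching {X : SimplexCategoryᵒᵖ ⥤ D}
    (hX : HasCofibrantLatchingMaps X) (n : SimplexCategory) :
    ∃ (L : D) (ι : ∀ (k : SimplexCategory) (e : n ⟶ k) [Epi e], k.len < n.len → (X.obj (op k) ⟶ L))
      (j : L ⟶ X.obj (op n)), Cofibration j ∧
      (∀ (k) (e : n ⟶ k) [Epi e] (hk : k.len < n.len), ι k e hk ≫ j = X.map e.op) ∧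
      (∀ {E : D} (f g : L ⟶ E), (∀ (k) (e : n ⟶ k) [Epi e] (hk : k.len < n.len),
        ι k e hk ≫ f = ι k e hk ≫ g) → f = g) ∧
      ∀ (E : D) (t : ∀ (k : SimplexCategory) (e : n ⟶ k) [Epi e], k.len < n.len →
          (X.obj (op k) ⟶ E)),
        (∀ (k k' : SimplexCategory) (e : n ⟶ k) (g : k ⟶ k') [Epi e] [Epi (e ≫ g)]
          (hk : k.len < n.len) (hk' : k'.len < n.len), X.map g.op ≫ t k e hk = t k' (e ≫ g) hk') →
        ∃ a : L ⟶ E, ∀ (k) (e : n ⟶ k) [Epi e] (hk : k.len < n.len), ι k e hk ≫ a = t k e hk := by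
  obtain ⟨c, hc, hj⟩ := hX n
  have hlt (i : (isProperQuotient n).FullSubcategory) : i.obj.right.len < n.len := by
    have : Epi i.obj.hom := i.property.1
    refine lt_of_le_of_ne (SimplexCategory.len_le_of_epi i.obj.hom) fun h => i.property.2 ?_
    obtain ⟨⟨⟨⟨⟩⟩, k, e⟩, hi⟩ := i
    obtain rfl : k = n := SimplexCategory.ext h
    have : Epi e := hi.1
    change IsIso e
    rw [SimplexCategory.eq_id_of_epi e]
    infer_instance
  have hiso {k : SimplexCategory} (e : n ⟶ k) (hk : k.len < n.len) : ¬ IsIso e :=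
    fun _ => (SimplexCategory.len_le_of_mono e).not_gt hk
  refine ⟨c.pt, fun k e he hk => c.ι.app (op ⟨Under.mk e, he, hiso e hk⟩),
    hc.desc (latchingCocone X n), hj, fun k e he hk => hc.fac _ _,
    fun f g h => hc.hom_ext fun i => ?_, fun E t ht => ?_⟩
  · obtain ⟨⟨⟨⟨⟨⟩⟩, k, e⟩, hi⟩⟩ := i
    have : Epi e := hi.1
    exact h k e (hlt ⟨_, hi⟩)
  · have he (i : (isProperQuotient n).FullSubcategory) : Epi i.obj.hom := i.property.1
    let s : Cocone (latchingDiagram X n) :=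
      { pt := E
        ι :=
          { app i := @t i.unop.obj.right i.unop.obj.hom (he i.unop) (hlt i.unop)
            naturality i i' φ := by
              have h : i'.unop.obj.hom ≫ φ.unop.hom.right = i.unop.obj.hom := Under.w φ.unop.hom
              refine Eq.trans ?_ (Category.comp_id _).symm
              have h₁ := he i.unop
              have h₂ := he i'.unop
              have : Epi (i'.unop.obj.hom ≫ φ.unop.hom.right) := by rw [h]; exact h₁
              refine (ht _ _ i'.unop.obj.hom φ.unop.hom.right (hlt i'.unop) (hlt i.unop)).trans ?_
              simp only [h] } }
    exact ⟨hc.desc s, fun k e he hk => hc.fac s _⟩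

/-- The elementary form of the right lifting property of relative matching maps with respect to
cofibrations. -/
def HasBoundaryLifting {Z Y : SimplexCategoryᵒᵖ ⥤ D} (q : Z ⟶ Y) : Prop :=
  ∀ (n : SimplexCategory) {A A' : D} (j : A ⟶ A') [Cofibration j] (a : A ⟶ Z.obj (op n))
    (b : A' ⟶ Y.obj (op n))
    (c : ∀ (k : SimplexCategory) (f : k ⟶ n), ¬ Epi f → (A' ⟶ Z.obj (op k))),
    (∀ (m m' : SimplexCategory) (g : m' ⟶ m) (f : m ⟶ n) (hf : ¬ Epi f),
      c m' (g ≫ f) (not_epi_precomp g hf) = c m f hf ≫ Z.map g.op) →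
    a ≫ q.app (op n) = j ≫ b →
    (∀ k f hf, c k f hf ≫ q.app (op k) = b ≫ Y.map f.op) →
    (∀ k f hf, j ≫ c k f hf = a ≫ Z.map f.op) →
    ∃ l : A' ⟶ Z.obj (op n), j ≫ l = a ∧ l ≫ q.app (op n) = b ∧
      ∀ k f hf, l ≫ Z.map f.op = c k f hf

/-- The inductive step of the Reedy lifting argument. The lifts in lower degrees determine a map
from the latching object to `Z n`, through the degeneracies, and the boundary of the desired map,
through the faces. The lifting property is then applied to the latching map. -/
theorem exists_lift_of_hasBoundaryLifting_step {X Z Y : SimplexCategoryᵒᵖ ⥤ D} {q : Z ⟶ Y}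
    (hq : HasBoundaryLifting q) (hX : HasCofibrantLatchingMaps X) (b : X ⟶ Y)
    (n : SimplexCategory)
    (l : ∀ m : SimplexCategory, m.len < n.len →
      { l : X.obj (op m) ⟶ Z.obj (op m) // l ≫ q.app (op m) = b.app (op m) })
    (hl : ∀ k m hk hm (f : k ⟶ m), X.map f.op ≫ (l k hk).1 = (l m hm).1 ≫ Z.map f.op) :
    ∃ l' : X.obj (op n) ⟶ Z.obj (op n), l' ≫ q.app (op n) = b.app (op n) ∧
      (∀ (k) (u : k ⟶ n) [Mono u] (hk : k.len < n.len),
        X.map u.op ≫ (l k hk).1 = l' ≫ Z.map u.op) ∧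
      ∀ (k) (e : n ⟶ k) [Epi e] (hk : k.len < n.len),
        X.map e.op ≫ l' = (l k hk).1 ≫ Z.map e.op := by
  obtain ⟨L, ι, j, _, fac, hom_ext, hdesc⟩ := hX.exists_latching n
  obtain ⟨a, afac⟩ := hdesc (Z.obj (op n)) (fun k e _ hk => (l k hk).1 ≫ Z.map e.op)
    (fun k k' e g _ _ hk hk' => by
      rw [reassoc_of% hl _ _ hk hk' g, op_comp, Z.map_comp])
  obtain ⟨d, hd, hdc⟩ := exists_boundary_family
    (Z ⋙ coyoneda.obj (op (X.obj (op n)))) n (fun k u _ hk => X.map u.op ≫ (l k hk).1)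
    (fun k k' w u _ _ h => by
      change _ = (X.map u.op ≫ (l k h).1) ≫ Z.map w.op
      rw [Category.assoc, ← hl k' k _ h w, op_comp, X.map_comp, Category.assoc])
  have dfac (m : SimplexCategory) (f : m ⟶ n) (hf : ¬ Epi f) :
      ∃ (k : SimplexCategory) (g : m ⟶ k) (u : k ⟶ n) (_ : Mono u) (hk : k.len < n.len),
        g ≫ u = f ∧ d m f hf = X.map u.op ≫ (l k hk).1 ≫ Z.map g.op := by
    obtain ⟨k, e, u, he, hu, hk, rfl⟩ := exists_epi_mono_factorization_of_not_epi f hf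
    refine ⟨k, e, u, hu, hk, rfl, ?_⟩
    rw [hd _ _ e u (not_epi_of_len_lt u hk), hdc k u hk]
    exact Category.assoc _ _ _
  obtain ⟨l', h₁, h₂, h₃⟩ := hq n j a (b.app (op n)) d hd
    (hom_ext _ _ fun k e _ hk => by
      rw [reassoc_of% afac k e hk, reassoc_of% fac k e hk, b.naturality,
        q.naturality, reassoc_of% (l k hk).2])
    (fun m f hf => by
      obtain ⟨k, g, u, hu, hk, rfl, h⟩ := dfac m f hf
      rw [h, Category.assoc, Category.assoc, q.naturality, reassoc_of% (l k hk).2,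
        b.naturality_assoc, op_comp, Y.map_comp])
    (fun m f hf => by
      obtain ⟨k, g, u, hu, hk, rfl, h⟩ := dfac m f hf
      rw [h]
      refine hom_ext _ _ fun k' e _ hk' => ?_
      -- Faces and degeneracies agree because `u ≫ e` goes between objects of degree below that of
      -- `n`, where `hl` is known.
      rw [reassoc_of% fac k' e hk', reassoc_of% afac k' e hk', ← X.map_comp_assoc, ← op_comp,
        reassoc_of% hl _ _ hk hk' (u ≫ e), ← Z.map_comp, ← Z.map_comp,
        ← op_comp, ← op_comp, Category.assoc])
  refine ⟨l', h₂, fun k u _ hk => ?_, fun k e _ hk => ?_⟩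
  · rw [h₃ k u (not_epi_of_len_lt u hk), hdc]
  · rw [← fac k e hk, Category.assoc, h₁, afac]

/-- Reedy cofibrant simplicial objects lift against the maps with the boundary lifting
property. -/
theorem exists_lift_of_hasBoundaryLifting {X Z Y : SimplexCategoryᵒᵖ ⥤ D} {q : Z ⟶ Y}
    (hq : HasBoundaryLifting q) (hX : HasCofibrantLatchingMaps X) (b : X ⟶ Y) :
    ∃ l : X ⟶ Z, l ≫ q = b := by
  obtain ⟨l, hl⟩ := exists_compatible_family (ι := SimplexCategory) (fun n => n.len)
    (α := fun n => { l : X.obj (op n) ⟶ Z.obj (op n) // l ≫ q.app (op n) = b.app (op n) })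
    (fun m n lm ln => ∀ f : m ⟶ n, X.map f.op ≫ lm.1 = ln.1 ≫ Z.map f.op)
    (fun i j h hne => (hne (SimplexCategory.ext h)).elim)
    (fun n l hl => by
      obtain ⟨l', h₁, h₂, h₃⟩ := exists_lift_of_hasBoundaryLifting_step hq hX b n l hl
      refine ⟨⟨l', h₁⟩, fun f => ?_, fun m hm => ⟨fun f => ?_, fun f => ?_⟩⟩
      · obtain ⟨k, e, u, he, hu, rfl⟩ := exists_epi_mono_factorization f
        -- An endomorphism of `[n]` either factors through a lower degree or is the identity.
        obtain hk | hk := (SimplexCategory.len_le_of_mono u).lt_or_eq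
        · rw [op_comp, X.map_comp, Z.map_comp, Category.assoc, h₃ k e hk, reassoc_of% h₂ k u hk]
        · obtain rfl : k = n := SimplexCategory.ext hk
          rw [SimplexCategory.eq_id_of_mono u, SimplexCategory.eq_id_of_epi e]
          simp
      · obtain ⟨k, e, u, he, hu, rfl⟩ := exists_epi_mono_factorization f
        have hk := (SimplexCategory.len_le_of_mono u).trans_lt hm
        rw [op_comp, X.map_comp, Z.map_comp, Category.assoc, h₃ k e hk,
          reassoc_of% hl k m hk hm u]
      · obtain ⟨k, e, u, he, hu, rfl⟩ := exists_epi_mono_factorization f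
        have hk := (SimplexCategory.len_le_of_epi e).trans_lt hm
        rw [op_comp, X.map_comp, Z.map_comp, Category.assoc, hl m k hm hk e,
          reassoc_of% h₂ k u hk])
  exact ⟨{ app n := (l n.unop).1, naturality m n f := hl n.unop m.unop f.unop },
    by ext n; exact (l n.unop).2⟩

end Reedy

/-! ### Cofree diagrams -/

section EvaluationRightAdjoint

variable (D : Type u) [Category.{v} D] [HasLimitsOfSize.{0, 0} D] {K : Type} [SmallCategory K]

/-- The projections of the values of a cofree diagram. -/
noncomputable def evaluationRightAdjointπ (E : D) {t c : K} (g : t ⟶ c) :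
    ((evaluationRightAdjoint D c).obj E).obj t ⟶ E :=
  Pi.π (fun _ : t ⟶ c => E) g

theorem map_evaluationRightAdjointπ (E : D) {s t c : K} (f : s ⟶ t) (g : t ⟶ c) :
    ((evaluationRightAdjoint D c).obj E).map f ≫ evaluationRightAdjointπ D E g =
      evaluationRightAdjointπ D E (f ≫ g) :=
  limit.lift_π _ _

theorem map_app_evaluationRightAdjointπ {E B : D} (p : E ⟶ B) {t c : K} (g : t ⟶ c) :
    ((evaluationRightAdjoint D c).map p).app t ≫ evaluationRightAdjointπ D B g =
      evaluationRightAdjointπ D E g ≫ p :=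
  limit.lift_π _ _

variable {D} in
/-- Maps to the values of a cofree diagram. -/
noncomputable def evaluationRightAdjointLift {A E : D} {t c : K} (l : (t ⟶ c) → (A ⟶ E)) :
    A ⟶ ((evaluationRightAdjoint D c).obj E).obj t :=
  Pi.lift l

variable {D} in
theorem lift_evaluationRightAdjointπ {A E : D} {t c : K} (l : (t ⟶ c) → (A ⟶ E)) (g : t ⟶ c) :
    evaluationRightAdjointLift l ≫
      evaluationRightAdjointπ D E g = l g :=
  limit.lift_π _ _

variable {D} in
theorem lift_evaluationRightAdjointπ_assoc {A E B : D} {t c : K} (l : (t ⟶ c) → (A ⟶ E))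
    (g : t ⟶ c) (h : E ⟶ B) :
    evaluationRightAdjointLift l ≫
      evaluationRightAdjointπ D E g ≫ h = l g ≫ h := by
  rw [← Category.assoc, lift_evaluationRightAdjointπ]

theorem evaluationRightAdjoint_hom_ext {A E : D} {t c : K}
    {f f' : A ⟶ ((evaluationRightAdjoint D c).obj E).obj t}
    (h : ∀ g : t ⟶ c, f ≫ evaluationRightAdjointπ D E g = f' ≫ evaluationRightAdjointπ D E g) :
    f = f' :=
  Pi.hom_ext _ _ h

end EvaluationRightAdjoint

/-! ### Objectwise cofibrancy of Reedy cofibrant objects -/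

section ReedyModel

variable {D : Type u} [Category.{v} D] [ModelCategory D] [HasLimitsOfSize.{0, 0} D]

/-- The value of the cofree diagram at `[n]` is a product of copies of `E` over the maps `m ⟶ n`.
Components at maps that are not epimorphisms are dictated by the boundary data; those at
epimorphisms are unconstrained and are obtained by lifting `j` against `p`. -/
theorem hasBoundaryLifting_evaluationRightAdjoint (m : SimplexCategory) {E B : D} (p : E ⟶ B)
    (hp : trivialFibrations D p) :
    HasBoundaryLifting ((evaluationRightAdjoint D (op m)).map p) := by
  classical
  intro n A A' j _ a b c hc hab hcb hca
  have : Fibration p := ⟨hp.1⟩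
  have : WeakEquivalence p := ⟨hp.2⟩
  have sq (g : op n ⟶ op m) : CommSq (a ≫ evaluationRightAdjointπ D E g) j p
      (b ≫ evaluationRightAdjointπ D B g) := ⟨by
    rw [Category.assoc, ← map_app_evaluationRightAdjointπ, reassoc_of% hab]⟩
  refine ⟨evaluationRightAdjointLift (fun g : op n ⟶ op m => if hg : Epi g.unop then (sq g).lift else
      c m g.unop hg ≫ evaluationRightAdjointπ D E (𝟙 (op m))), ?_, ?_, fun k f hf => ?_⟩
  · refine evaluationRightAdjoint_hom_ext D fun g => ?_
    rw [Category.assoc, lift_evaluationRightAdjointπ]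
    split_ifs with hg
    · exact (sq g).fac_left
    · rw [reassoc_of% hca m g.unop hg, map_evaluationRightAdjointπ, Category.comp_id, Quiver.Hom.op_unop]
  · refine evaluationRightAdjoint_hom_ext D fun g => ?_
    rw [Category.assoc, map_app_evaluationRightAdjointπ, lift_evaluationRightAdjointπ_assoc]
    split_ifs with hg
    · exact (sq g).fac_right
    · rw [Category.assoc, ← map_app_evaluationRightAdjointπ, reassoc_of% hcb m g.unop hg,
        map_evaluationRightAdjointπ, Category.comp_id, Quiver.Hom.op_unop]
  · refine evaluationRightAdjoint_hom_ext D fun g => ?_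
    have hg : ¬ Epi (f.op ≫ g).unop := not_epi_precomp g.unop hf
    rw [Category.assoc, map_evaluationRightAdjointπ, lift_evaluationRightAdjointπ, dif_neg hg]
    have := hc k m g.unop f hf
    refine (congrArg (· ≫ _) this).trans ?_
    rw [Category.assoc, map_evaluationRightAdjointπ, Category.comp_id, Quiver.Hom.op_unop]

/-- Reedy cofibrant simplicial objects are objectwise cofibrant. -/
theorem HasCofibrantLatchingMaps.isCofibrant [HasColimitsOfSize.{0, 0} D] {X : SimplexCategoryᵒᵖ ⥤ D}
    (hX : HasCofibrantLatchingMaps X) (m : SimplexCategoryᵒᵖ) : IsCofibrant (X.obj m) := by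
  have h : (trivialFibrations D).llp (((evaluation _ D).obj m).map (initial.to X)) := by
    intro E B p hp
    rw [(evaluationAdjunctionLeft D m).hasLiftingProperty_iff]
    refine ⟨fun {f g} sq => ?_⟩
    obtain ⟨l, hl⟩ := exists_lift_of_hasBoundaryLifting
      (hasBoundaryLifting_evaluationRightAdjoint m.unop p hp) hX g
    exact ⟨⟨⟨l, initialIsInitial.hom_ext _ _, hl⟩⟩⟩
  rw [trivialFibrations_llp] at h
  obtain ⟨hi⟩ := isInitial_initial_obj (D := D) m
  exact (isCofibrant_iff_of_isInitial _ hi).2 ⟨h⟩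

end ReedyModel


/-! ### Relative latching maps of cosimplicial simplicial sets -/

section ReedyWeights

/-- The elementary form of the lifting property of the relative latching map of `φ` at `n` with
respect to `p`. -/
def HasBoundaryExtension {U Z : SimplexCategory ⥤ SSet.{v}} (φ : U ⟶ Z) (n : SimplexCategory)
    {M N : SSet.{v}} (p : M ⟶ N) : Prop :=
  ∀ (x : U.obj n ⟶ M) (y : Z.obj n ⟶ N)
    (c : ∀ (k : SimplexCategory) (f : k ⟶ n), ¬ Epi f → (Z.obj k ⟶ M)),
    (∀ (m m' : SimplexCategory) (g : m' ⟶ m) (f : m ⟶ n) (hf : ¬ Epi f),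
      c m' (g ≫ f) (not_epi_precomp g hf) = Z.map g ≫ c m f hf) →
    x ≫ p = φ.app n ≫ y →
    (∀ k f hf, c k f hf ≫ p = Z.map f ≫ y) →
    (∀ k f hf, φ.app k ≫ c k f hf = U.map f ≫ x) →
    ∃ z : Z.obj n ⟶ M, φ.app n ≫ z = x ∧ z ≫ p = y ∧ ∀ k f hf, Z.map f ≫ z = c k f hf

/-- A map of cosimplicial simplicial sets is a Reedy monomorphism if its relative latching maps
are monomorphisms; this is expressed by extension of maps to injective simplicial sets. -/
def IsReedyMono {U Z : SimplexCategory ⥤ SSet.{v}} (φ : U ⟶ Z) : Prop :=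
  ∀ (n : SimplexCategory) (E : SSet.{v}) [Injective E] (x : U.obj n ⟶ E)
    (c : ∀ (k : SimplexCategory) (f : k ⟶ n), ¬ Epi f → (Z.obj k ⟶ E)),
    (∀ (m m' : SimplexCategory) (g : m' ⟶ m) (f : m ⟶ n) (hf : ¬ Epi f),
      c m' (g ≫ f) (not_epi_precomp g hf) = Z.map g ≫ c m f hf) →
    (∀ k f hf, φ.app k ≫ c k f hf = U.map f ≫ x) →
    ∃ z : Z.obj n ⟶ E, φ.app n ≫ z = x ∧ ∀ k f hf, Z.map f ≫ z = c k f hf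

/-- A cosimplicial simplicial set is Reedy monomorphic if its latching maps are
monomorphisms. -/
def IsReedyMonomorphic (V : SimplexCategory ⥤ SSet.{v}) : Prop :=
  ∀ (n : SimplexCategory) (E : SSet.{v}) [Injective E]
    (c : ∀ (k : SimplexCategory) (f : k ⟶ n), ¬ Epi f → (V.obj k ⟶ E)),
    (∀ (m m' : SimplexCategory) (g : m' ⟶ m) (f : m ⟶ n) (hf : ¬ Epi f),
      c m' (g ≫ f) (not_epi_precomp g hf) = V.map g ≫ c m f hf) →
    ∃ z : V.obj n ⟶ E, ∀ k f hf, V.map f ≫ z = c k f hf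

variable {U V Z : SimplexCategory ⥤ SSet.{v}}

theorem IsReedyMono.comp {φ : U ⟶ V} {ψ : V ⟶ Z} (hφ : IsReedyMono φ) (hψ : IsReedyMono ψ) :
    IsReedyMono (φ ≫ ψ) := by
  intro n E _ x c hc hx
  obtain ⟨y, hy₁, hy₂⟩ := hφ n E x (fun k f hf => ψ.app k ≫ c k f hf)
    (fun m m' g f hf => by rw [hc, ψ.naturality_assoc])
    (fun k f hf => by rw [← hx k f hf, NatTrans.comp_app, Category.assoc])
  obtain ⟨z, hz₁, hz₂⟩ := hψ n E y c hc (fun k f hf => (hy₂ k f hf).symm)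
  exact ⟨z, by rw [NatTrans.comp_app, Category.assoc, hz₁, hy₁], hz₂⟩

theorem IsReedyMonomorphic.of_isReedyMono_initial (h : IsReedyMono (initial.to V)) :
    IsReedyMonomorphic V := by
  intro n E _ c hc
  have hi (k : SimplexCategory) := isInitial_initial_obj (J := SimplexCategory) (D := SSet.{v}) k
  obtain ⟨z, -, hz⟩ := h n E ((hi n).some.to E) c hc (fun k f hf => (hi k).some.hom_ext _ _)
  exact ⟨z, hz⟩

/-- The coproduct of diagrams is a coproduct objectwise. -/
theorem exists_coprod_desc_app {J : Type*} [Category J] {X Y : J ⥤ SSet.{v}} (j : J) {E : SSet.{v}}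
    (a : X.obj j ⟶ E) (b : Y.obj j ⟶ E) :
    ∃ l : (X ⨿ Y).obj j ⟶ E, (coprod.inl : X ⟶ X ⨿ Y).app j ≫ l = a ∧
      (coprod.inr : Y ⟶ X ⨿ Y).app j ≫ l = b := by
  have sq := (IsPushout.of_hasBinaryCoproduct' X Y).map ((evaluation J SSet.{v}).obj j)
  obtain ⟨h⟩ := isInitial_initial_obj (D := SSet.{v}) j
  exact ⟨sq.desc a b (h.hom_ext _ _), sq.inl_desc _ _ _, sq.inr_desc _ _ _⟩

theorem coprod_app_hom_ext {J : Type*} [Category J] {X Y : J ⥤ SSet.{v}} {j : J} {E : SSet.{v}}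
    {f g : (X ⨿ Y).obj j ⟶ E}
    (hl : (coprod.inl : X ⟶ X ⨿ Y).app j ≫ f = (coprod.inl : X ⟶ X ⨿ Y).app j ≫ g)
    (hr : (coprod.inr : Y ⟶ X ⨿ Y).app j ≫ f = (coprod.inr : Y ⟶ X ⨿ Y).app j ≫ g) : f = g :=
  ((IsPushout.of_hasBinaryCoproduct' X Y).map ((evaluation J SSet.{v}).obj j)).hom_ext hl hr

/-- The relative latching map of `U ⟶ U ⨿ V` is the coproduct of the identity of `U n` and the
latching map of `V`. -/
theorem IsReedyMonomorphic.isReedyMono_coprod_inl (hV : IsReedyMonomorphic V) :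
    IsReedyMono (coprod.inl : U ⟶ U ⨿ V) := by
  intro n E _ x c hc hx
  obtain ⟨y, hy⟩ := hV n E (fun k f hf => (coprod.inr : V ⟶ U ⨿ V).app k ≫ c k f hf)
    (fun m m' g f hf => by rw [hc, (coprod.inr : V ⟶ U ⨿ V).naturality_assoc])
  obtain ⟨z, hz₁, hz₂⟩ := exists_coprod_desc_app n x y
  refine ⟨z, hz₁, fun k f hf => coprod_app_hom_ext ?_ ?_⟩
  · rw [← NatTrans.naturality_assoc, hz₁, hx]
  · rw [← NatTrans.naturality_assoc, hz₂, hy]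

theorem IsReedyMonomorphic.isReedyMono_coprod_inr (hU : IsReedyMonomorphic U) :
    IsReedyMono (coprod.inr : V ⟶ U ⨿ V) := by
  intro n E _ x c hc hx
  obtain ⟨y, hy⟩ := hU n E (fun k f hf => (coprod.inl : U ⟶ U ⨿ V).app k ≫ c k f hf)
    (fun m m' g f hf => by rw [hc, (coprod.inl : U ⟶ U ⨿ V).naturality_assoc])
  obtain ⟨z, hz₁, hz₂⟩ := exists_coprod_desc_app n y x
  refine ⟨z, hz₂, fun k f hf => coprod_app_hom_ext ?_ ?_⟩
  · rw [← NatTrans.naturality_assoc, hz₁, hy]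
  · rw [← NatTrans.naturality_assoc, hz₂, hx]

/-- The diagram `k ↦ ∏_{k ⟶ n not epi} E`. -/
noncomputable def boundaryCofree (n : SimplexCategory) (E : SSet.{v}) :
    SimplexCategory ⥤ SSet.{v} where
  obj k := ∏ᶜ fun _ : { f : k ⟶ n // ¬ Epi f } => E
  map g := Pi.lift fun f => Pi.π (fun _ => E) ⟨g ≫ f.1, not_epi_precomp g f.2⟩
  map_id k := Pi.hom_ext _ _ fun f => by simp
  map_comp g h := Pi.hom_ext _ _ fun f => by simp

/-- The projection from the cofree diagram to its boundary. -/
noncomputable def toBoundaryCofree (n : SimplexCategory) (E : SSet.{v}) :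
    (evaluationRightAdjoint SSet.{v} n).obj E ⟶ boundaryCofree n E where
  app k := Pi.lift fun f => evaluationRightAdjointπ SSet.{v} E f.1
  naturality k k' g := Pi.hom_ext _ _ fun f => by
    change (_ ≫ Pi.lift _) ≫ _ = (Pi.lift _ ≫ Pi.lift _) ≫ _
    rw [Category.assoc, Category.assoc, Pi.lift_π, Pi.lift_π, Pi.lift_π,
      map_evaluationRightAdjointπ]

/-- At each `k` this is the projection away from the factors indexed by epimorphisms `k ⟶ n`. These
are copies of the injective object `E`, so a lift exists componentwise. -/
theorem toBoundaryCofree_mem (n : SimplexCategory) (E : SSet.{v}) [Injective E] :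
    trivialKanFibrations.functorCategory SimplexCategory (toBoundaryCofree n E) := by
  classical
  intro k A B i hi
  have : Mono i := hi
  refine ⟨fun {a b} sq => ?_⟩
  have hw (f : k ⟶ n) (hf : ¬ Epi f) : a ≫ evaluationRightAdjointπ SSet.{v} E f =
      i ≫ b ≫ Pi.π (fun _ : { f : k ⟶ n // ¬ Epi f } => E) ⟨f, hf⟩ := by
    have h := sq.w =≫ Pi.π (fun _ : { f : k ⟶ n // ¬ Epi f } => E) ⟨f, hf⟩
    have h' : (toBoundaryCofree n E).app k ≫ Pi.π (fun _ : { f : k ⟶ n // ¬ Epi f } => E) ⟨f, hf⟩ =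
      evaluationRightAdjointπ SSet.{v} E f := Pi.lift_π _ _
    exact (congrArg (a ≫ ·) h'.symm).trans
      ((Category.assoc _ _ _).symm.trans (h.trans (Category.assoc _ _ _)))
  refine ⟨⟨⟨evaluationRightAdjointLift fun f : k ⟶ n => if hf : ¬ Epi f then
      b ≫ Pi.π (fun _ : { f : k ⟶ n // ¬ Epi f } => E) ⟨f, hf⟩
    else Injective.factorThru (a ≫ evaluationRightAdjointπ SSet.{v} E f) i, ?_, ?_⟩⟩⟩
  · refine evaluationRightAdjoint_hom_ext SSet.{v} fun f => ?_
    rw [Category.assoc, lift_evaluationRightAdjointπ]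
    split_ifs with hf
    · exact Injective.comp_factorThru _ _
    · exact (hw f hf).symm
  · refine Pi.hom_ext _ _ fun f => ?_
    have h : (toBoundaryCofree n E).app k ≫ Pi.π (fun _ : { f : k ⟶ n // ¬ Epi f } => E) f =
      evaluationRightAdjointπ SSet.{v} E f.1 := Pi.lift_π _ _
    refine (Category.assoc _ _ _).trans ((congrArg (_ ≫ ·) h).trans ?_)
    rw [lift_evaluationRightAdjointπ, dif_pos f.2]
    rfl

/-- Projective cofibrations are Reedy monomorphisms. -/
theorem isReedyMono_of_llp {φ : U ⟶ Z}
    (hφ : (trivialKanFibrations.functorCategory SimplexCategory).llp φ) : IsReedyMono φ := by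
  intro n E _ x c hc hx
  have := hφ _ (toBoundaryCofree_mem n E)
  -- The extension problem `(x, c)` is the transpose of a lifting problem of `φ` against
  -- `toBoundaryCofree n E`; the extension is recovered as the component of the lift at `𝟙 n`.
  let a : U ⟶ (evaluationRightAdjoint SSet.{v} n).obj E :=
    { app k := evaluationRightAdjointLift fun f => U.map f ≫ x
      naturality k k' g := evaluationRightAdjoint_hom_ext SSet.{v} fun f => by
        rw [Category.assoc, Category.assoc, lift_evaluationRightAdjointπ,
          map_evaluationRightAdjointπ, lift_evaluationRightAdjointπ, Functor.map_comp,
          Category.assoc] }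
  let b : Z ⟶ boundaryCofree n E :=
    { app k := Pi.lift fun f : { f : k ⟶ n // ¬ Epi f } => c k f.1 f.2
      naturality k k' g := Pi.hom_ext _ _ fun f => by
        change (_ ≫ Pi.lift _) ≫ _ = (Pi.lift _ ≫ Pi.lift _) ≫ _
        rw [Category.assoc, Category.assoc, Pi.lift_π, Pi.lift_π, Pi.lift_π, hc] }
  have sq : CommSq a φ (toBoundaryCofree n E) b := ⟨by
    ext k : 2
    refine Pi.hom_ext _ _ fun f => ?_
    change (evaluationRightAdjointLift _ ≫ Pi.lift _) ≫ _ = (_ ≫ Pi.lift _) ≫ _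
    rw [Category.assoc, Category.assoc, Pi.lift_π, Pi.lift_π, lift_evaluationRightAdjointπ, hx]⟩
  refine ⟨sq.lift.app n ≫ evaluationRightAdjointπ SSet.{v} E (𝟙 n), ?_, fun k f hf => ?_⟩
  · have h := NatTrans.congr_app sq.fac_left n =≫ evaluationRightAdjointπ SSet.{v} E (𝟙 n)
    rw [NatTrans.comp_app, Category.assoc] at h
    refine h.trans ((lift_evaluationRightAdjointπ _ _).trans ?_)
    rw [CategoryTheory.Functor.map_id, Category.id_comp]
  · rw [sq.lift.naturality_assoc, map_evaluationRightAdjointπ, Category.comp_id]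
    have h := NatTrans.congr_app sq.fac_right k =≫ Pi.π (fun _ : { f : k ⟶ n // ¬ Epi f } => E) ⟨f, hf⟩
    have h' : (toBoundaryCofree n E).app k ≫ Pi.π (fun _ : { f : k ⟶ n // ¬ Epi f } => E) ⟨f, hf⟩ =
      evaluationRightAdjointπ SSet.{v} E f := Pi.lift_π _ _
    rw [← h']
    refine (Category.assoc _ _ _).symm.trans (h.trans ?_)
    exact Pi.lift_π _ _

theorem IsProjectiveWeight.isReedyMonomorphic (hV : IsProjectiveWeight V) :
    IsReedyMonomorphic V :=
  .of_isReedyMono_initial (isReedyMono_of_llp hV)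

/-- The subcomplex of `Δ[n]` of the simplices which are not surjective. -/
def nonsurjectiveSimplices (n : SimplexCategory) : (SSet.stdSimplex.{v}.obj n).Subcomplex where
  obj _ := { s | ¬ Epi (SSet.stdSimplex.objEquiv s) }
  map g _ hs := not_epi_precomp g.unop hs

/-- By Yoneda, a compatible family on the maps to `[n]` that are not epimorphisms is a map out of
the subcomplex of non-surjective simplices of `Δ[n]`; it extends along the inclusion because `E` is
injective. -/
theorem isReedyMonomorphic_stdSimplex : IsReedyMonomorphic SSet.stdSimplex.{v} := by
  intro n E _ c hc
  let b : (nonsurjectiveSimplices.{v} n).toSSet ⟶ E :=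
    { app m := ↾fun s => SSet.yonedaEquiv (c m.unop (SSet.stdSimplex.objEquiv s.1) s.2)
      naturality m m' g := by
        ext s
        refine (congrArg SSet.yonedaEquiv (hc m.unop m'.unop g.unop
          (SSet.stdSimplex.objEquiv s.1) s.2)).trans ?_
        exact (SSet.yonedaEquiv_naturality _ _).symm }
  have : Mono (nonsurjectiveSimplices.{v} n).ι := inferInstance
  refine ⟨Injective.factorThru b (nonsurjectiveSimplices.{v} n).ι, fun k f hf => ?_⟩
  apply SSet.yonedaEquiv.injective
  have h := ConcreteCategory.congr_hom (NatTrans.congr_app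
    (Injective.comp_factorThru b (nonsurjectiveSimplices.{v} n).ι) (op k))
      ⟨SSet.stdSimplex.objEquiv.symm f, hf⟩
  refine Eq.trans ?_ h
  rw [SSet.yonedaEquiv_comp, SSet.yonedaEquiv_map]
  rfl

end ReedyWeights


/-! ### Boundary extensions along Reedy trivial cofibrations of weights -/

section PushoutProducts

/-- The Leibniz pushout of a composition is the composition of a pushout of the first Leibniz
pushout with the second one. -/
theorem exists_isPushout_pushoutObjObj_comp {A B E : Type*} [Category A] [Category B] [Category E]
    {F : A ⥤ B ⥤ E} {a a' a'' : A} {f : a ⟶ a'} {g : a' ⟶ a''} {b b' : B} {j : b ⟶ b'}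
    (s : F.PushoutObjObj f j) (t : F.PushoutObjObj g j) (r : F.PushoutObjObj (f ≫ g) j) :
    ∃ (x : s.pt ⟶ r.pt) (y : r.pt ⟶ t.pt), IsPushout x s.ι y t.inr ∧ y ≫ t.ι = r.ι := by
  have hx : (F.map f).app b ≫ (F.map g).app b ≫ r.inl = (F.obj a).map j ≫ r.inr := by
    rw [← r.isPushout.w, F.map_comp, NatTrans.comp_app, Category.assoc]
  let x := s.isPushout.desc ((F.map g).app b ≫ r.inl) r.inr hx
  have hx₁ : s.inl ≫ x = (F.map g).app b ≫ r.inl := s.isPushout.inl_desc _ _ _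
  have hx₂ : s.inr ≫ x = r.inr := s.isPushout.inr_desc _ _ _
  have hy : (F.map (f ≫ g)).app b ≫ t.inl = (F.obj a).map j ≫ (F.map f).app b' ≫ t.inr := by
    rw [F.map_comp, NatTrans.comp_app, Category.assoc, t.isPushout.w, NatTrans.naturality_assoc]
  let y := r.isPushout.desc t.inl ((F.map f).app b' ≫ t.inr) hy
  have hy₁ : r.inl ≫ y = t.inl := r.isPushout.inl_desc _ _ _
  have hy₂ : r.inr ≫ y = (F.map f).app b' ≫ t.inr := r.isPushout.inr_desc _ _ _
  have h₁ : IsPushout ((F.map g).app b) s.inl r.inl x := by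
    refine IsPushout.of_left ?_ hx₁.symm s.isPushout
    rw [hx₂]
    have := r.isPushout
    rwa [F.map_comp, NatTrans.comp_app] at this
  refine ⟨x, y, IsPushout.of_top (v₁₁ := s.inl) (v₁₂ := r.inl) (h₁₁ := (F.map g).app b) ?_ ?_ h₁, ?_⟩
  · rw [hy₁, s.inl_ι]
    exact t.isPushout
  · refine s.hom_ext ?_ ?_
    · rw [reassoc_of% hx₁, hy₁, s.inl_ι_assoc, t.isPushout.w]
    · rw [reassoc_of% hx₂, hy₂, s.inr_ι_assoc]
  · refine r.hom_ext ?_ ?_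
    · rw [reassoc_of% hy₁, t.inl_ι, r.inl_ι]
    · rw [reassoc_of% hy₂, t.inr_ι, r.inr_ι, F.map_comp, NatTrans.comp_app]

end PushoutProducts

/-! ### Latching objects and relative latching maps of weights -/

section Boundaries

/-- The morphisms to `[n]` which are not epimorphisms. -/
def isNotEpi (n : SimplexCategory) : ObjectProperty (Over n) :=
  fun f => ¬ Epi f.hom

/-- The diagram of the values of `U` on the boundary of `[n]`. -/
def boundaryDiagram (U : SimplexCategory ⥤ SSet.{v}) (n : SimplexCategory) :
    (isNotEpi n).FullSubcategory ⥤ SSet.{v} :=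
  ObjectProperty.ι _ ⋙ Over.forget n ⋙ U

/-- The latching object of a cosimplicial simplicial set. -/
noncomputable def boundary (U : SimplexCategory ⥤ SSet.{v}) (n : SimplexCategory) : SSet.{v} :=
  colimit (boundaryDiagram U n)

namespace boundary

variable {U Z : SimplexCategory ⥤ SSet.{v}} {n : SimplexCategory} {E : SSet.{v}}

variable (U) in
/-- The inclusions in the latching object. -/
noncomputable def ι {k : SimplexCategory} (f : k ⟶ n) (hf : ¬ Epi f) : U.obj k ⟶ boundary U n :=
  colimit.ι (boundaryDiagram U n) ⟨Over.mk f, hf⟩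

theorem map_ι {k m : SimplexCategory} (g : m ⟶ k) (f : k ⟶ n) (hf : ¬ Epi f) :
    U.map g ≫ ι U f hf = ι U (g ≫ f) (not_epi_precomp g hf) :=
  colimit.w (boundaryDiagram U n) (show (⟨Over.mk (g ≫ f), not_epi_precomp g hf⟩ :
      (isNotEpi n).FullSubcategory) ⟶ ⟨Over.mk f, hf⟩ from ObjectProperty.homMk (Over.homMk g))

theorem hom_ext {a b : boundary U n ⟶ E}
    (h : ∀ (k : SimplexCategory) (f : k ⟶ n) (hf : ¬ Epi f), ι U f hf ≫ a = ι U f hf ≫ b) :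
    a = b :=
  colimit.hom_ext fun i => h _ i.obj.hom i.property

/-- Maps out of the latching object. -/
noncomputable def desc (c : ∀ (k : SimplexCategory) (f : k ⟶ n), ¬ Epi f → (U.obj k ⟶ E))
    (hc : ∀ (m m' : SimplexCategory) (g : m' ⟶ m) (f : m ⟶ n) (hf : ¬ Epi f),
      c m' (g ≫ f) (not_epi_precomp g hf) = U.map g ≫ c m f hf) : boundary U n ⟶ E :=
  colimit.desc (boundaryDiagram U n)
    { pt := E
      ι :=
        { app i := c _ i.obj.hom i.property
          naturality i i' φ := by
            have h : φ.hom.left ≫ i'.obj.hom = i.obj.hom := Over.w φ.hom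
            refine Eq.trans ?_ (Category.comp_id _).symm
            refine (hc _ _ φ.hom.left i'.obj.hom i'.property).symm.trans ?_
            simp only [h]
            rfl } }

theorem ι_desc (c : ∀ (k : SimplexCategory) (f : k ⟶ n), ¬ Epi f → (U.obj k ⟶ E))
    (hc : ∀ (m m' : SimplexCategory) (g : m' ⟶ m) (f : m ⟶ n) (hf : ¬ Epi f),
      c m' (g ≫ f) (not_epi_precomp g hf) = U.map g ≫ c m f hf) {k : SimplexCategory}
    (f : k ⟶ n) (hf : ¬ Epi f) : ι U f hf ≫ desc c hc = c k f hf :=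
  colimit.ι_desc _ _

/-- The functoriality of the latching object. -/
noncomputable def map (φ : U ⟶ Z) (n : SimplexCategory) : boundary U n ⟶ boundary Z n :=
  desc (fun k f hf => φ.app k ≫ ι Z f hf) fun m m' g f hf => by
    rw [← map_ι, φ.naturality_assoc]

theorem ι_map (φ : U ⟶ Z) {k : SimplexCategory} (f : k ⟶ n) (hf : ¬ Epi f) :
    ι U f hf ≫ map φ n = φ.app k ≫ ι Z f hf :=
  ι_desc _ _ _ _

variable (U) in
/-- The latching map. -/
noncomputable def toObj (n : SimplexCategory) : boundary U n ⟶ U.obj n :=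
  desc (fun _ f _ => U.map f) fun _ _ _ _ _ => U.map_comp _ _

theorem ι_toObj {k : SimplexCategory} (f : k ⟶ n) (hf : ¬ Epi f) :
    ι U f hf ≫ toObj U n = U.map f :=
  ι_desc _ _ _ _

theorem map_toObj (φ : U ⟶ Z) (n : SimplexCategory) :
    map φ n ≫ toObj Z n = toObj U n ≫ φ.app n :=
  hom_ext fun k f hf => by
    rw [← Category.assoc, ι_map, Category.assoc, ι_toObj, ← Category.assoc, ι_toObj, φ.naturality]

end boundary

variable {U Z : SimplexCategory ⥤ SSet.{v}} (φ : U ⟶ Z) (n : SimplexCategory)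

/-- The relative latching map of a map of cosimplicial simplicial sets. -/
noncomputable def relativeLatchingMap :
    pushout (boundary.map φ n) (boundary.toObj U n) ⟶ Z.obj n :=
  pushout.desc (boundary.toObj Z n) (φ.app n) (boundary.map_toObj φ n)

theorem inl_relativeLatchingMap :
    pushout.inl _ _ ≫ relativeLatchingMap φ n = boundary.toObj Z n :=
  pushout.inl_desc _ _ _

theorem inr_relativeLatchingMap : pushout.inr _ _ ≫ relativeLatchingMap φ n = φ.app n :=
  pushout.inr_desc _ _ _

variable {φ n}

theorem exists_desc_relativeLatching {E : SSet.{v}} (x : U.obj n ⟶ E)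
    (c : ∀ (k : SimplexCategory) (f : k ⟶ n), ¬ Epi f → (Z.obj k ⟶ E))
    (hc : ∀ (m m' : SimplexCategory) (g : m' ⟶ m) (f : m ⟶ n) (hf : ¬ Epi f),
      c m' (g ≫ f) (not_epi_precomp g hf) = Z.map g ≫ c m f hf)
    (hx : ∀ k f hf, φ.app k ≫ c k f hf = U.map f ≫ x) :
    ∃ a : pushout (boundary.map φ n) (boundary.toObj U n) ⟶ E,
      pushout.inl _ _ ≫ a = boundary.desc c hc ∧ pushout.inr _ _ ≫ a = x := by
  have h : boundary.map φ n ≫ boundary.desc c hc = boundary.toObj U n ≫ x :=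
    boundary.hom_ext fun k f hf => by
      rw [← Category.assoc, boundary.ι_map, Category.assoc, boundary.ι_desc, hx,
        ← Category.assoc, boundary.ι_toObj]
  exact ⟨pushout.desc _ _ h, pushout.inl_desc _ _ _, pushout.inr_desc _ _ _⟩

theorem hasBoundaryExtension_of_hasLiftingProperty {M N : SSet.{v}} (p : M ⟶ N)
    [HasLiftingProperty (relativeLatchingMap φ n) p] : HasBoundaryExtension φ n p := by
  intro x y c hc hxy hcy hcx
  obtain ⟨a, ha₁, ha₂⟩ := exists_desc_relativeLatching x c hc hcx
  have sq : CommSq a (relativeLatchingMap φ n) p y := ⟨by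
    refine pushout.hom_ext ?_ ?_
    · rw [reassoc_of% ha₁, reassoc_of% inl_relativeLatchingMap φ n]
      refine boundary.hom_ext fun k f hf => ?_
      rw [← Category.assoc, boundary.ι_desc, hcy, ← Category.assoc, boundary.ι_toObj]
    · rw [reassoc_of% ha₂, reassoc_of% inr_relativeLatchingMap φ n, hxy]⟩
  refine ⟨sq.lift, ?_, sq.fac_right, fun k f hf => ?_⟩
  · have h : pushout.inr _ _ ≫ relativeLatchingMap φ n ≫ sq.lift = x := by
      rw [sq.fac_left, ha₂]
    rwa [reassoc_of% inr_relativeLatchingMap φ n] at h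
  · have h : pushout.inl _ _ ≫ relativeLatchingMap φ n ≫ sq.lift = boundary.desc c hc := by
      rw [sq.fac_left, ha₁]
    rw [reassoc_of% inl_relativeLatchingMap φ n] at h
    rw [← boundary.ι_desc c hc f hf, ← h, ← Category.assoc, boundary.ι_toObj]

/-- Embed the source in an injective simplicial set. The extension property factors this embedding
through the relative latching map, which is therefore monic. -/
theorem IsReedyMono.mono_relativeLatchingMap (hφ : IsReedyMono φ) (n : SimplexCategory) :
    Mono (relativeLatchingMap φ n) := by
  obtain ⟨E, i, _, _⟩ := exists_mono_injective (pushout (boundary.map φ n) (boundary.toObj U n))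
  obtain ⟨z, hz₁, hz₂⟩ := hφ n E (pushout.inr _ _ ≫ i)
    (fun k f hf => boundary.ι Z f hf ≫ pushout.inl _ _ ≫ i)
    (fun m m' g f hf => by rw [← boundary.map_ι, Category.assoc])
    (fun k f hf => by
      rw [← Category.assoc, ← boundary.ι_map, Category.assoc, pushout.condition_assoc,
        ← Category.assoc, boundary.ι_toObj])
  have h : relativeLatchingMap φ n ≫ z = i := by
    refine pushout.hom_ext ?_ ?_
    · rw [reassoc_of% inl_relativeLatchingMap φ n]
      refine boundary.hom_ext fun k f hf => ?_
      rw [← Category.assoc, boundary.ι_toObj, hz₂]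
    · rw [reassoc_of% inr_relativeLatchingMap φ n, hz₁]
  exact mono_of_mono_fac h

/-- If the relative latching maps in lower degrees lift against `p`, then so does the map between
the latching objects. -/
theorem hasLiftingProperty_boundaryMap {M N : SSet.{v}} (p : M ⟶ N)
    (h : ∀ k : SimplexCategory, k.len < n.len → HasBoundaryExtension φ k p) :
    HasLiftingProperty (boundary.map φ n) p := by
  refine ⟨fun {s t} sq => ?_⟩
  -- The lift is built on the proper faces `u : k ⟶ n`, by recursion on the degree of `k`.
  obtain ⟨c, hc⟩ := exists_compatible_family
    (ι := Σ k : SimplexCategory, { u : k ⟶ n // Mono u ∧ k.len < n.len }) (fun i => i.1.len)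
    (α := fun i => { c : Z.obj i.1 ⟶ M //
      φ.app i.1 ≫ c = boundary.ι U i.2.1 (not_epi_of_len_lt i.2.1 i.2.2.2) ≫ s ∧
      c ≫ p = boundary.ι Z i.2.1 (not_epi_of_len_lt i.2.1 i.2.2.2) ≫ t })
    (fun i j a b => ∀ w : i.1 ⟶ j.1, w ≫ j.2.1 = i.2.1 → a.1 = Z.map w ≫ b.1)
    (by
      -- A map over `[n]` between faces of equal degree is a monomorphism, hence an identity, so
      -- distinct faces of the same degree impose no condition on each other.
      rintro ⟨k, u, hu, hk⟩ ⟨k', u', hu', hk'⟩ hkk' hne a b w hw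
      obtain rfl : k = k' := SimplexCategory.ext hkk'
      have : Mono w := mono_of_mono_fac hw
      dsimp only at w hw
      obtain rfl := SimplexCategory.eq_id_of_mono w
      rw [Category.id_comp] at hw
      subst hw
      exact (hne rfl).elim)
    (by
      rintro ⟨k, u, hu, hk⟩ c hc
      have hlt {k' : SimplexCategory} (hk' : k'.len < k.len) : k'.len < n.len := hk'.trans hk
      -- The values already chosen on the proper faces of `u` form the boundary datum for the
      -- extension problem at `k`.
      obtain ⟨d, hd, hdc⟩ := exists_boundary_family (Z.op ⋙ yoneda.obj M) k
        (fun k' u' _ hk' => (c ⟨k', u' ≫ u, mono_comp _ _, hlt hk'⟩ hk').1)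
        (fun k' k'' w u' _ _ hk' => by
          change _ = Z.map w ≫ (c ⟨k', u' ≫ u, mono_comp _ _, hlt hk'⟩ hk').1
          exact hc ⟨k'', (w ≫ u') ≫ u, mono_comp _ _,
              hlt ((SimplexCategory.len_le_of_mono w).trans_lt hk')⟩
            ⟨k', u' ≫ u, mono_comp _ _, hlt hk'⟩ _ hk' w (Category.assoc _ _ _).symm)
      have dfac (m : SimplexCategory) (f : m ⟶ k) (hf : ¬ Epi f) :
          ∃ (k' : SimplexCategory) (g : m ⟶ k') (u' : k' ⟶ k) (hu' : Mono u')
            (hk' : k'.len < k.len), g ≫ u' = f ∧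
            d m f hf = Z.map g ≫ (c ⟨k', u' ≫ u, mono_comp _ _, hlt hk'⟩ hk').1 := by
        obtain ⟨k', e, u', he, hu', hk', rfl⟩ := exists_epi_mono_factorization_of_not_epi f hf
        refine ⟨k', e, u', hu', hk', rfl, ?_⟩
        rw [hd _ _ e u' (not_epi_of_len_lt u' hk'), hdc k' u' hk']
        rfl
      obtain ⟨z, hz₁, hz₂, hz₃⟩ := h k hk (boundary.ι U u (not_epi_of_len_lt u hk) ≫ s)
        (boundary.ι Z u (not_epi_of_len_lt u hk) ≫ t) d hd
        (by
          rw [Category.assoc, sq.w, ← Category.assoc, boundary.ι_map, Category.assoc])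
        (fun m f hf => by
          obtain ⟨k', g, u', hu', hk', rfl, hdf⟩ := dfac m f hf
          rw [hdf, Category.assoc, (c _ _).2.2, ← Category.assoc, ← Category.assoc,
            boundary.map_ι, boundary.map_ι]
          simp only [Category.assoc])
        (fun m f hf => by
          obtain ⟨k', g, u', hu', hk', rfl, hdf⟩ := dfac m f hf
          rw [hdf, ← NatTrans.naturality_assoc]
          refine (congrArg (U.map g ≫ ·) (c _ hk').2.1).trans ?_
          dsimp only
          rw [← Category.assoc, ← Category.assoc, boundary.map_ι, boundary.map_ι]
          simp only [Category.assoc])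
      refine ⟨⟨z, hz₁, hz₂⟩, fun w hw => ?_, fun ⟨k', u', hu', hk'⟩ hj => ⟨fun w hw => ?_,
        fun w hw => ?_⟩⟩
      · have : w = 𝟙 _ := by
          rw [← cancel_mono u]
          exact hw.trans (Category.id_comp _).symm
        subst this
        rw [CategoryTheory.Functor.map_id, Category.id_comp]
      · have : Mono w := mono_of_mono_fac hw
        exact ((SimplexCategory.len_le_of_mono w).not_gt hj).elim
      · dsimp only at w hw
        have : Mono w := mono_of_mono_fac hw
        subst hw
        exact ((hz₃ _ w (not_epi_of_len_lt w hj)).trans (hdc _ w hj)).symm)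
  obtain ⟨d, hd, hdc⟩ := exists_boundary_family (Z.op ⋙ yoneda.obj M) n
    (fun k u hu hk => (c ⟨k, u, hu, hk⟩).1)
    (fun k k' w u _ hu hk => by
      change _ = Z.map w ≫ (c ⟨k, u, hu, hk⟩).1
      exact hc ⟨k', w ≫ u, mono_comp _ _, (SimplexCategory.len_le_of_mono w).trans_lt hk⟩
        ⟨k, u, hu, hk⟩ w rfl)
  have dfac (m : SimplexCategory) (f : m ⟶ n) (hf : ¬ Epi f) :
      ∃ (k : SimplexCategory) (g : m ⟶ k) (u : k ⟶ n) (hu : Mono u) (hk : k.len < n.len),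
        g ≫ u = f ∧ d m f hf = Z.map g ≫ (c ⟨k, u, hu, hk⟩).1 := by
    obtain ⟨k, e, u, he, hu, hk, rfl⟩ := exists_epi_mono_factorization_of_not_epi f hf
    refine ⟨k, e, u, hu, hk, rfl, ?_⟩
    rw [hd _ _ e u (not_epi_of_len_lt u hk), hdc k u hk]
    rfl
  refine ⟨⟨⟨boundary.desc d hd, boundary.hom_ext fun m f hf => ?_,
    boundary.hom_ext fun m f hf => ?_⟩⟩⟩
  · obtain ⟨k, g, u, hu, hk, rfl, hdf⟩ := dfac m f hf
    rw [← Category.assoc, boundary.ι_map, Category.assoc, boundary.ι_desc, hdf,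
      ← NatTrans.naturality_assoc]
    refine (congrArg (U.map g ≫ ·) (c _).2.1).trans ?_
    dsimp only
    rw [← Category.assoc, boundary.map_ι]
  · obtain ⟨k, g, u, hu, hk, rfl, hdf⟩ := dfac m f hf
    rw [← Category.assoc, boundary.ι_desc, hdf, Category.assoc, (c _).2.2, ← Category.assoc,
      boundary.map_ι]

end Boundaries

/-! ### Reedy trivial cofibrations of weights -/

namespace QuillenTensor

variable {D : Type u} [Category.{v} D] [ModelCategory D] (Q : QuillenTensor D)

theorem cofibration_pushoutObjObj {K L : SSet.{v}} (i : K ⟶ L) [Mono i] {A A' : D} (j : A ⟶ A')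
    [Cofibration j] (s : Q.tensor.PushoutObjObj i j) : Cofibration s.ι := by
  refine ⟨?_⟩
  rw [← trivialFibrations_llp]
  intro B B' p hp
  have : Fibration p := ⟨hp.1⟩
  have : WeakEquivalence p := ⟨hp.2⟩
  refine (Q.mappingAdj.hasLiftingProperty_iff s.flip (.ofHasPullback _ _ _)).2 ?_
  exact Q.trivialKan_of_trivialFibration j p _ i (MorphismProperty.monomorphisms.infer_property _)

theorem weakEquivalence_pushoutObjObj {K L : SSet.{v}} (i : K ⟶ L) {A A' : D} (j : A ⟶ A')
    (hi : ∀ {B B' : D} (p : B ⟶ B') [Fibration p] (sq : Q.mapping.PullbackObjObj j p),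
      HasLiftingProperty i sq.π) (s : Q.tensor.PushoutObjObj i j) :
    trivialCofibrations D s.ι := by
  rw [← fibrations_llp]
  intro B B' p hp
  have : Fibration p := ⟨hp⟩
  refine (Q.mappingAdj.hasLiftingProperty_iff s.flip (.ofHasPullback _ _ _)).2 ?_
  exact hi p _

/-- Left lifting properties with respect to pullback-homs cancel on the left. -/
theorem hasLiftingProperty_of_comp {K L N : SSet.{v}} (i : K ⟶ L) (l : L ⟶ N) [Mono l]
    {A A' : D} (j : A ⟶ A') [Cofibration j]
    (hi : ∀ {B B' : D} (p : B ⟶ B') [Fibration p] (sq : Q.mapping.PullbackObjObj j p),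
      HasLiftingProperty i sq.π)
    (hil : ∀ {B B' : D} (p : B ⟶ B') [Fibration p] (sq : Q.mapping.PullbackObjObj j p),
      HasLiftingProperty (i ≫ l) sq.π) {B B' : D} (p : B ⟶ B') [Fibration p]
    (sq : Q.mapping.PullbackObjObj j p) : HasLiftingProperty l sq.π := by
  let s := Functor.PushoutObjObj.ofHasPushout Q.tensor i j
  let t := Functor.PushoutObjObj.ofHasPushout Q.tensor l j
  let r := Functor.PushoutObjObj.ofHasPushout Q.tensor (i ≫ l) j
  -- The cancellation takes place in `D`. The pushout-product with `i ≫ l` factors as a cobase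
  -- change `y` of the one with `i`, followed by the one with `l`. Both `y` and the composite are
  -- trivial cofibrations, so two-out-of-three makes the last factor a weak equivalence.
  obtain ⟨x, y, hxy, hy⟩ := exists_isPushout_pushoutObjObj_comp s t r
  have hs := Q.weakEquivalence_pushoutObjObj i j hi s
  have hr := Q.weakEquivalence_pushoutObjObj (i ≫ l) j hil r
  have hy' : trivialCofibrations D y := by
    rw [← fibrations_llp] at hs ⊢
    exact MorphismProperty.of_isPushout hxy hs
  have : WeakEquivalence y := ⟨hy'.2⟩
  have : WeakEquivalence r.ι := ⟨hr.2⟩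
  have : WeakEquivalence t.ι := weakEquivalence_of_precomp_of_fac hy
  have := Q.cofibration_pushoutObjObj l j t
  exact (Q.mappingAdj.hasLiftingProperty_iff t.flip sq).1
    (inferInstanceAs (HasLiftingProperty t.ι p))

/-- Induction on the degree. The map of latching objects lifts by the lower degrees, hence so does
its cobase change `U n ⟶ U n ⨿_{∂U} ∂Z`. Following this by the monic relative latching map gives `φ
n`, which lifts by hypothesis, and `hasLiftingProperty_of_comp` cancels the first factor. -/
theorem hasBoundaryExtension {U Z : SimplexCategory ⥤ SSet.{v}} {φ : U ⟶ Z}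
    (hm : ∀ n, Mono (φ.app n)) (hw : ∀ n, WeakEquivalence (φ.app n)) (hφ : IsReedyMono φ)
    {A A' : D} (j : A ⟶ A') [Cofibration j] (n : SimplexCategory) {B B' : D} (p : B ⟶ B')
    [Fibration p] (sq : Q.mapping.PullbackObjObj j p) : HasBoundaryExtension φ n sq.π := by
  obtain ⟨N, hN⟩ : ∃ N, n.len = N := ⟨_, rfl⟩
  induction N using Nat.strong_induction_on generalizing n B B' with
  | _ N ih =>
    subst hN
    have hb {B B' : D} (p : B ⟶ B') [Fibration p] (sq : Q.mapping.PullbackObjObj j p) :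
        HasLiftingProperty (boundary.map φ n) sq.π :=
      hasLiftingProperty_boundaryMap sq.π fun k hk => ih k.len hk k p sq rfl
    have := hφ.mono_relativeLatchingMap n
    have := Q.hasLiftingProperty_of_comp (pushout.inr (boundary.map φ n) (boundary.toObj U n))
      (relativeLatchingMap φ n) j
      (fun p _ sq => by
        have := hb p sq
        infer_instance)
      (fun p _ sq => by
        have := hm n
        have := hw n
        rw [inr_relativeLatchingMap]
        exact Q.hasLiftingProperty (φ.app n) j p sq) p sq
    exact hasBoundaryExtension_of_hasLiftingProperty sq.π

end QuillenTensor


/-! ### Weak equivalences of weights and Reedy cofibrant simplicial objects -/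

namespace QuillenTensor

variable {D : Type u} [Category.{v} D] [ModelCategory D] (Q : QuillenTensor D)

/-- Maps to cotensors are the same as maps to mapping objects. -/
def transpose {K : SSet.{v}} {A E : D} :
    (A ⟶ (Q.cotensor.obj (op K)).obj E) ≃ (K ⟶ (Q.mapping.obj (op A)).obj E) :=
  Q.cotensorAdj.homEquiv.symm.trans (Q.mappingAdj.homEquiv (X₁ := A) (X₂ := K))

theorem transpose_weight {K L : SSet.{v}} {A E : D} (f : K ⟶ L)
    (g : A ⟶ (Q.cotensor.obj (op L)).obj E) :
    Q.transpose (g ≫ (Q.cotensor.map f.op).app E) = f ≫ Q.transpose g := by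
  refine (congrArg Q.mappingAdj.homEquiv (Q.cotensorAdj.homEquiv_symm_naturality_one f g)).trans ?_
  exact Q.mappingAdj.homEquiv_naturality_two _ _

theorem transpose_precomp {K : SSet.{v}} {A A' E : D} (f : A ⟶ A')
    (g : A' ⟶ (Q.cotensor.obj (op K)).obj E) :
    Q.transpose (f ≫ g) = Q.transpose g ≫ (Q.mapping.map f.op).app E := by
  refine (congrArg Q.mappingAdj.homEquiv (Q.cotensorAdj.homEquiv_symm_naturality_two f g)).trans ?_
  exact Q.mappingAdj.homEquiv_naturality_one _ _

theorem transpose_postcomp {K : SSet.{v}} {A E E' : D} (f : E ⟶ E')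
    (g : A ⟶ (Q.cotensor.obj (op K)).obj E) :
    Q.transpose (g ≫ (Q.cotensor.obj (op K)).map f) =
      Q.transpose g ≫ (Q.mapping.obj (op A)).map f := by
  refine (congrArg Q.mappingAdj.homEquiv
    (Q.cotensorAdj.homEquiv_symm_naturality_three f g)).trans ?_
  exact Q.mappingAdj.homEquiv_naturality_three _ _

/-- The boundary extension property transposed from maps `Z n ⟶ Map(A', B)` to maps `A' ⟶ B ^ Z n`.
-/
theorem exists_cotensor_lift {U Z : SimplexCategory ⥤ SSet.{v}} {φ : U ⟶ Z} {n : SimplexCategory}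
    {A A' B B' : D} {j : A ⟶ A'} {p : B ⟶ B'}
    (h : HasBoundaryExtension φ n (Functor.PullbackObjObj.ofHasPullback Q.mapping j p).π)
    (a : A ⟶ (Q.cotensor.obj (op (Z.obj n))).obj B)
    (b₁ : A' ⟶ (Q.cotensor.obj (op (U.obj n))).obj B)
    (b₂ : A' ⟶ (Q.cotensor.obj (op (Z.obj n))).obj B')
    (hb : b₁ ≫ (Q.cotensor.obj (op (U.obj n))).map p =
      b₂ ≫ (Q.cotensor.map (φ.app n).op).app B')
    (c : ∀ (k : SimplexCategory) (f : k ⟶ n), ¬ Epi f →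
      (A' ⟶ (Q.cotensor.obj (op (Z.obj k))).obj B))
    (hc : ∀ (m m' : SimplexCategory) (g : m' ⟶ m) (f : m ⟶ n) (hf : ¬ Epi f),
      c m' (g ≫ f) (not_epi_precomp g hf) = c m f hf ≫ (Q.cotensor.map (Z.map g).op).app B)
    (hab₁ : a ≫ (Q.cotensor.map (φ.app n).op).app B = j ≫ b₁)
    (hab₂ : a ≫ (Q.cotensor.obj (op (Z.obj n))).map p = j ≫ b₂)
    (hcb₁ : ∀ k f hf, c k f hf ≫ (Q.cotensor.map (φ.app k).op).app B =
      b₁ ≫ (Q.cotensor.map (U.map f).op).app B)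
    (hcb₂ : ∀ k f hf, c k f hf ≫ (Q.cotensor.obj (op (Z.obj k))).map p =
      b₂ ≫ (Q.cotensor.map (Z.map f).op).app B')
    (hca : ∀ k f hf, j ≫ c k f hf = a ≫ (Q.cotensor.map (Z.map f).op).app B) :
    ∃ l : A' ⟶ (Q.cotensor.obj (op (Z.obj n))).obj B, j ≫ l = a ∧
      l ≫ (Q.cotensor.map (φ.app n).op).app B = b₁ ∧
      l ≫ (Q.cotensor.obj (op (Z.obj n))).map p = b₂ ∧
      ∀ k f hf, l ≫ (Q.cotensor.map (Z.map f).op).app B = c k f hf := by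
  let sq := Functor.PullbackObjObj.ofHasPullback Q.mapping j p
  have hy : Q.transpose a ≫ (Q.mapping.obj (op A)).map p =
      Q.transpose b₂ ≫ (Q.mapping.map j.op).app B' := by
    rw [← transpose_postcomp, ← transpose_precomp, hab₂]
  let y : Z.obj n ⟶ sq.pt := sq.isPullback.lift (Q.transpose a) (Q.transpose b₂) hy
  have hy₁ : y ≫ sq.fst = Q.transpose a := sq.isPullback.lift_fst _ _ _
  have hy₂ : y ≫ sq.snd = Q.transpose b₂ := sq.isPullback.lift_snd _ _ _
  obtain ⟨z, hz₁, hz₂, hz₃⟩ := h (Q.transpose b₁) y (fun k f hf => Q.transpose (c k f hf))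
    (fun m m' g f hf => by rw [hc, ← transpose_weight])
    (by
      refine sq.hom_ext ?_ ?_
      · rw [Category.assoc, Category.assoc, hy₁, sq.π_fst, ← transpose_precomp, ← transpose_weight,
          hab₁]
      · rw [Category.assoc, Category.assoc, hy₂, sq.π_snd, ← transpose_postcomp,
          ← transpose_weight, hb])
    (fun k f hf => by
      refine sq.hom_ext ?_ ?_
      · rw [Category.assoc, Category.assoc, hy₁, sq.π_fst, ← transpose_precomp, ← transpose_weight,
          hca]
      · rw [Category.assoc, Category.assoc, hy₂, sq.π_snd, ← transpose_postcomp,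
          ← transpose_weight, hcb₂])
    (fun k f hf => by rw [← transpose_weight, ← transpose_weight, hcb₁])
  obtain ⟨l, rfl⟩ := Q.transpose.surjective z
  refine ⟨l, Q.transpose.injective ?_, Q.transpose.injective ?_, Q.transpose.injective ?_,
    fun k f hf => Q.transpose.injective ?_⟩
  · rw [transpose_precomp, ← hy₁, ← hz₂, Category.assoc, sq.π_fst]
  · rw [transpose_weight, hz₁]
  · rw [transpose_postcomp, ← hy₂, ← hz₂, Category.assoc, sq.π_snd]
  · rw [← hz₃ k f hf, ← transpose_weight]

/-- In Reedy terms: the relative matching maps of the simplicial pullback-hom of `φ` and `p` lift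
against cofibrations. -/
theorem hasBoundaryLifting_pullbackObjObj {U Z : SimplexCategory ⥤ SSet.{v}} {φ : U ⟶ Z}
    {B B' : D} (p : B ⟶ B') (sq : (weightedCotensor Q.cotensor).PullbackObjObj φ p)
    (h : ∀ (n : SimplexCategory) {A A' : D} (j : A ⟶ A') [Cofibration j],
      HasBoundaryExtension φ n (Functor.PullbackObjObj.ofHasPullback Q.mapping j p).π) :
    HasBoundaryLifting sq.π := by
  intro n A A' j _ a b c hc hab hcb hca
  let e (k : SimplexCategory) := pullbackObjObjCotensorEval sq k
  have hfst {k : SimplexCategory} (f : k ⟶ n) : sq.pt.map f.op ≫ (e k).fst =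
      (e n).fst ≫ (Q.cotensor.map (U.map f).op).app B := sq.fst.naturality f.op
  have hsnd {k : SimplexCategory} (f : k ⟶ n) : sq.pt.map f.op ≫ (e k).snd =
      (e n).snd ≫ (Q.cotensor.map (Z.map f).op).app B' := sq.snd.naturality f.op
  have hab' : a ≫ (e n).π = j ≫ b := hab
  have hcb' (k) (f : k ⟶ n) (hf) : c k f hf ≫ (e k).π = b ≫ sq.pt.map f.op := hcb k f hf
  obtain ⟨l, hl₁, hl₂, hl₃, hl₄⟩ := Q.exists_cotensor_lift (h n j) a (b ≫ (e n).fst)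
    (b ≫ (e n).snd)
    ((Category.assoc _ _ _).trans ((congrArg (b ≫ ·) (e n).isPullback.w).trans
      (Category.assoc _ _ _).symm)) c hc
    ((congrArg (a ≫ ·) (e n).π_fst.symm).trans ((Category.assoc _ _ _).symm.trans
      ((congrArg (· ≫ _) hab').trans (Category.assoc _ _ _))))
    ((congrArg (a ≫ ·) (e n).π_snd.symm).trans ((Category.assoc _ _ _).symm.trans
      ((congrArg (· ≫ _) hab').trans (Category.assoc _ _ _))))
    (fun k f hf => (congrArg (c k f hf ≫ ·) (e k).π_fst.symm).trans
      ((Category.assoc _ _ _).symm.trans ((congrArg (· ≫ _) (hcb' k f hf)).trans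
        ((Category.assoc _ _ _).trans ((congrArg (b ≫ ·) (hfst f)).trans
          (Category.assoc _ _ _).symm)))))
    (fun k f hf => (congrArg (c k f hf ≫ ·) (e k).π_snd.symm).trans
      ((Category.assoc _ _ _).symm.trans ((congrArg (· ≫ _) (hcb' k f hf)).trans
        ((Category.assoc _ _ _).trans ((congrArg (b ≫ ·) (hsnd f)).trans
          (Category.assoc _ _ _).symm)))))
    hca
  refine ⟨l, hl₁, (e n).hom_ext ?_ ?_, hl₄⟩
  · exact (Category.assoc _ _ _).trans ((congrArg (l ≫ ·) (e n).π_fst).trans hl₂)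
  · exact (Category.assoc _ _ _).trans ((congrArg (l ≫ ·) (e n).π_snd).trans hl₃)

variable [HasColimitsOfSize.{0, 0} D]

/-- The Reedy counterpart of `weakEquivalence_map_app_of_mono`: after transposition, `∅ ⟶ X` is
lifted degree by degree. -/
theorem weakEquivalence_map_app_of_isReedyMono {U Z : SimplexCategory ⥤ SSet.{v}} {φ : U ⟶ Z}
    (hm : ∀ n, Mono (φ.app n)) (hw : ∀ n, WeakEquivalence (φ.app n)) (hφ : IsReedyMono φ)
    {X : SimplexCategoryᵒᵖ ⥤ D} (hX : HasCofibrantLatchingMaps X) :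
    WeakEquivalence (((weightedCoend Q.tensor).map φ).app X) := by
  refine weakEquivalence_of_llp_fibrations _ fun B B' p hp => ?_
  have : Fibration p := ⟨hp⟩
  let sq := Functor.PullbackObjObj.ofHasPullback (weightedCotensor Q.cotensor) φ p
  refine (hasLiftingProperty_map_app_iff (weightedCoendCotensorAdj Q.cotensorAdj) φ X p sq).2 ?_
  refine ⟨fun {f g} _ => ?_⟩
  obtain ⟨l, hl⟩ := exists_lift_of_hasBoundaryLifting (Q.hasBoundaryLifting_pullbackObjObj p sq
    fun n A A' j _ => Q.hasBoundaryExtension hm hw hφ j n p _) hX g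
  exact ⟨⟨⟨l, initialIsInitial.hom_ext _ _, hl⟩⟩⟩

/-- Weak equivalences between Reedy monomorphic weights induce weak equivalences of weighted
colimits of Reedy cofibrant simplicial objects. -/
theorem weakEquivalence_map_app_of_isReedyMonomorphic {V V' : SimplexCategory ⥤ SSet.{v}}
    (φ : V ⟶ V') (hw : ∀ n, WeakEquivalence (φ.app n)) (hV : IsReedyMonomorphic V)
    (hV' : IsReedyMonomorphic V') {X : SimplexCategoryᵒᵖ ⥤ D} (hX : HasCofibrantLatchingMaps X) :
    WeakEquivalence (((weightedCoend Q.tensor).map φ).app X) := by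
  obtain ⟨c, i, hi, hl, hr, hc⟩ := exists_cylinderFactorization φ hw
  exact c.weakEquivalence_map ((weightedCoend Q.tensor).flip.obj X)
    (Q.weakEquivalence_map_app_of_isReedyMono (fun n => (hc n).2.2.1) (fun n => (hc n).1)
      (hl ▸ hV'.isReedyMono_coprod_inl.comp (isReedyMono_of_llp hi)) hX)
    (Q.weakEquivalence_map_app_of_isReedyMono (fun n => (hc n).2.2.2) (fun n => (hc n).2.1)
      (hr ▸ hV.isReedyMono_coprod_inr.comp (isReedyMono_of_llp hi)) hX)

end QuillenTensor


/-! ### Representable weights -/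

section RepresentableWeights

variable {J : Type} [SmallCategory J]

/-- The diagram `n ↦ ∐_{m ⟶ n} Δ[0]`. -/
noncomputable def representableWeightObj (m : J) : J ⥤ SSet.{v} :=
  (evaluationLeftAdjoint SSet.{v} m).obj Δ[0]

/-- The universal element of the representable weight. -/
noncomputable def representableElement (m : J) :
    (Δ[0] : SSet.{v}) ⟶ (representableWeightObj.{v} m).obj m :=
  (evaluationAdjunctionRight SSet.{v} m).unit.app Δ[0]

/-- The Yoneda lemma for representable weights. -/
noncomputable def representableWeightEquiv (m : J) (Y : J ⥤ SSet.{v}) :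
    (representableWeightObj.{v} m ⟶ Y) ≃ (Δ[0] ⟶ Y.obj m) :=
  (evaluationAdjunctionRight SSet.{v} m).homEquiv Δ[0] Y

theorem representableWeightEquiv_apply {m : J} {Y : J ⥤ SSet.{v}}
    (g : representableWeightObj.{v} m ⟶ Y) :
    representableWeightEquiv m Y g = representableElement m ≫ g.app m :=
  (evaluationAdjunctionRight SSet.{v} m).homEquiv_unit _ _ _

theorem representableWeightEquiv_comp {m : J} {Y Y' : J ⥤ SSet.{v}}
    (g : representableWeightObj.{v} m ⟶ Y) (h : Y ⟶ Y') :
    representableWeightEquiv m Y' (g ≫ h) = representableWeightEquiv m Y g ≫ h.app m := by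
  rw [representableWeightEquiv_apply, representableWeightEquiv_apply, NatTrans.comp_app,
    Category.assoc]

/-- The functoriality of the representable weights. -/
noncomputable def representableWeightMap {m m' : J} (g : m' ⟶ m) :
    representableWeightObj.{v} m ⟶ representableWeightObj.{v} m' :=
  (representableWeightEquiv m _).symm
    (representableElement m' ≫ (representableWeightObj m').map g)

theorem element_representableWeightMap_app {m m' : J} (g : m' ⟶ m) :
    representableElement m ≫ (representableWeightMap.{v} g).app m =
      representableElement m' ≫ (representableWeightObj m').map g := by
  rw [← representableWeightEquiv_apply]
  exact Equiv.apply_symm_apply _ _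

variable (J) in
/-- The representable weights `m ↦ ∐_{m ⟶ -} Δ[0]`. -/
noncomputable def representableWeight : Jᵒᵖ ⥤ J ⥤ SSet.{v} where
  obj m := representableWeightObj m.unop
  map g := representableWeightMap g.unop
  map_id m := (representableWeightEquiv m.unop _).injective (by
    rw [representableWeightEquiv_apply, representableWeightEquiv_apply,
      element_representableWeightMap_app, unop_id, CategoryTheory.Functor.map_id, NatTrans.id_app])
  map_comp {m m' m''} g h := (representableWeightEquiv m.unop _).injective (by
    rw [representableWeightEquiv_apply, representableWeightEquiv_apply,
      element_representableWeightMap_app, NatTrans.comp_app, reassoc_of%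
        element_representableWeightMap_app g.unop, NatTrans.naturality, ← Category.assoc,
      element_representableWeightMap_app, unop_comp, Functor.map_comp, Category.assoc])

/-- The Yoneda lemma reduces the lifting problem to one for `∅ ⟶ Δ[0]`. -/
theorem isProjectiveWeight_representableWeight (m : Jᵒᵖ) :
    IsProjectiveWeight ((representableWeight.{v} J).obj m) := by
  intro Y Y' p hp
  refine ⟨fun {f g} _ => ?_⟩
  have : HasLiftingProperty (initial.to (Δ[0] : SSet.{v})) (p.app m.unop) :=
    hp m.unop _ (MorphismProperty.monomorphisms.infer_property _)
  have sq : CommSq (initial.to (Y.obj m.unop)) (initial.to (Δ[0] : SSet.{v})) (p.app m.unop)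
    (representableWeightEquiv m.unop Y' g) := ⟨initialIsInitial.hom_ext _ _⟩
  refine ⟨⟨⟨(representableWeightEquiv m.unop Y).symm sq.lift, initialIsInitial.hom_ext _ _, ?_⟩⟩⟩
  apply (representableWeightEquiv m.unop Y').injective
  refine (representableWeightEquiv_comp _ _).trans ?_
  rw [Equiv.apply_symm_apply, sq.fac_right]

end RepresentableWeights

theorem llp_initial_to {E : Type*} [Category E] [HasInitial E] {P : MorphismProperty E}
    {A B : E} {i : A ⟶ B} (hA : IsInitial A) (hi : P.llp i) : P.llp (initial.to B) := by
  intro X Y p hp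
  have := hi p hp
  refine ⟨fun {f g} _ => ?_⟩
  have sq : CommSq (hA.to X) i p g := ⟨hA.hom_ext _ _⟩
  exact ⟨⟨⟨sq.lift, initialIsInitial.hom_ext _ _, sq.fac_right⟩⟩⟩

/-- Objectwise trivial Kan fibrations form a right lifting class, so projective cofibrations of
bimodules are objectwise projective cofibrations of weights. -/
theorem isProjectiveWeight_obj {J K : Type} [SmallCategory J] [SmallCategory K]
    {N : K ⥤ J ⥤ SSet.{v}}
    (hN : ((trivialKanFibrations.{v}.functorCategory J).functorCategory K).llp (initial.to N))
    (k : K) : IsProjectiveWeight (N.obj k) := by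
  obtain ⟨h⟩ : Nonempty (IsInitial ((⊥_ (K ⥤ J ⥤ SSet.{v})).obj k)) :=
    ⟨initialIsInitial.isInitialObj ((evaluation K (J ⥤ SSet.{v})).obj k)⟩
  have e : (jointBoundaryInclusions (fun j : J => evaluationLeftAdjoint SSet.{v} j)).rlp =
      trivialKanFibrations.{v}.functorCategory J :=
    jointBoundaryInclusions_rlp (R := fun j : J => (evaluation J SSet.{v}).obj j)
      fun j => evaluationAdjunctionRight SSet.{v} j
  rw [← e] at hN
  have := llp_app_of_llp_functorCategory hN k
  rw [e] at this
  exact llp_initial_to (i := (initial.to N).app k) h this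

/-! ### Projectively cofibrant replacement of Reedy cofibrant objects -/

namespace QuillenTensor

variable {D : Type u} [Category.{v} D] [ModelCategory D] (Q : QuillenTensor D)

theorem trivialKan_mapping (A : D) [IsCofibrant A] {B B' : D} (p : B ⟶ B')
    (hp : trivialFibrations D p) : trivialKanFibrations ((Q.mapping.obj (op A)).map p) := by
  intro K L i hi
  have : Mono i := hi
  have := (Q.cotensorAdj.adj K).isLeftAdjoint
  have := (Q.cotensorAdj.adj L).isLeftAdjoint
  have : Fibration p := ⟨hp.1⟩
  have : WeakEquivalence p := ⟨hp.2⟩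
  have := Q.cofibration_pushoutObjObj i (initial.to A)
    (Functor.PushoutObjObj.ofIsInitialRight Q.tensor i (initial.to A) initialIsInitial)
  refine ((Q.mappingAdj.adj A).hasLiftingProperty_iff i p).1 ?_
  change HasLiftingProperty ((Q.tensor.map i).app A) p
  exact inferInstanceAs (HasLiftingProperty (Functor.PushoutObjObj.ofIsInitialRight Q.tensor i
    (initial.to A) initialIsInitial).ι p)

variable [HasColimitsOfSize.{0, 0} D]

section Representable

variable {J : Type} [SmallCategory J] (X : Jᵒᵖ ⥤ D)

/-- The map `Δ[0] ⊗ X m ⟶ ∫ⁿ (∐_{m ⟶ n} Δ[0]) ⊗ X n`. -/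
noncomputable def toWeightedCoendRepresentable :
    X ⋙ Q.tensor.obj Δ[0] ⟶ representableWeight.{v} J ⋙ (weightedCoend Q.tensor).flip.obj X where
  app m := (Q.tensor.map (representableElement m.unop)).app (X.obj m) ≫
    weightedCoend.ι Q.tensor (representableWeightObj m.unop) X m.unop
  naturality m m' g := by
    have h := NatTrans.congr_app (congrArg Q.tensor.map
      (element_representableWeightMap_app.{v} g.unop)) (X.obj m)
    rw [Functor.map_comp, Functor.map_comp, NatTrans.comp_app, NatTrans.comp_app] at h
    change (Q.tensor.obj Δ[0]).map (X.map g) ≫ (Q.tensor.map _).app (X.obj m') ≫ _ =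
      ((Q.tensor.map _).app (X.obj m) ≫ _) ≫
        ((weightedCoend Q.tensor).map (representableWeightMap g.unop)).app X
    rw [Category.assoc, weightedCoend.ι_map_app, reassoc_of% h]
    refine Eq.trans ?_ (congrArg ((Q.tensor.map (representableElement m'.unop)).app (X.obj m) ≫ ·)
      (weightedCoend.condition (T := Q.tensor) (representableWeightObj m'.unop) X g.unop))
    rw [NatTrans.naturality_assoc]
    rfl

/-- Co-Yoneda: maps to `E` from either side correspond to maps `Δ[0] ⟶ Map(X m, E)`. -/
instance isIso_toWeightedCoendRepresentable_app (m : Jᵒᵖ) :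
    IsIso ((Q.toWeightedCoendRepresentable X).app m) := by
  refine isIso_of_coyoneda_map_bijective _ fun E => ?_
  let e := ((weightedCoendMappingEquiv Q.mappingAdj (representableWeightObj m.unop) X E).trans
    (representableWeightEquiv m.unop _)).trans
    (Q.mappingAdj.homEquiv (X₁ := X.obj m) (X₂ := Δ[0]) (X₃ := E)).symm
  have he : (fun g => (Q.toWeightedCoendRepresentable X).app m ≫ g) = e := by
    funext g
    refine (Q.mappingAdj.homEquiv.eq_symm_apply).2 ?_
    refine Eq.trans ?_ (representableWeightEquiv_apply
      (weightedCoendMappingEquiv Q.mappingAdj (representableWeightObj m.unop) X E g)).symm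
    refine Eq.trans ?_ (Q.mappingAdj.homEquiv_naturality_two (representableElement m.unop) _)
    exact congrArg _ (Category.assoc _ _ _)
  rw [he]
  exact e.bijective

instance : IsIso (Q.toWeightedCoendRepresentable X) := NatIso.isIso_of_isIso_app _

/-- The map `∫ⁿ (∐_{m ⟶ n} Δ[0]) ⊗ X n ⟶ X m`. -/
noncomputable def fromWeightedCoendRepresentable :
    representableWeight.{v} J ⋙ (weightedCoend Q.tensor).flip.obj X ⟶ X :=
  inv (Q.toWeightedCoendRepresentable X) ≫ Functor.whiskerLeft X Q.counit

theorem weakEquivalence_fromWeightedCoendRepresentable (m : Jᵒᵖ) [IsCofibrant (X.obj m)] :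
    WeakEquivalence ((Q.fromWeightedCoendRepresentable X).app m) := by
  have := Q.weakEquivalence_counit_app (X.obj m)
  exact inferInstanceAs (WeakEquivalence ((inv (Q.toWeightedCoendRepresentable X)).app m ≫
    Q.counit.app (X.obj m)))

end Representable

/-- Weighted colimits of objectwise cofibrant diagrams along cofibrant bimodules are projectively
cofibrant. -/
theorem isProjectivelyCofibrant_weightedCoend {J K : Type} [SmallCategory J] [SmallCategory K]
    (X : Jᵒᵖ ⥤ D) (hX : ∀ j, IsCofibrant (X.obj j)) (N : K ⥤ J ⥤ SSet.{v})
    (hN : ((trivialKanFibrations.{v}.functorCategory J).functorCategory K).llp (initial.to N)) :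
    IsProjectivelyCofibrant (N ⋙ (weightedCoend Q.tensor).flip.obj X) := by
  -- The right adjoint forms the mapping objects out of the cofibrant `X j`, and so sends objectwise
  -- trivial fibrations to objectwise trivial Kan fibrations.
  let adj := ((weightedCoendMappingAdj Q.mappingAdj).adj X).whiskerRight K
  have := adj.isLeftAdjoint
  refine llp_initial_to (initialIsInitial.isInitialObj
    ((Functor.whiskeringRight K _ _).obj ((weightedCoend Q.tensor).flip.obj X)))
    (llp_map_of_adjunction adj (fun B B' p hp k j => ?_) hN)
  have := hX (op j)
  exact Q.trivialKan_mapping (X.obj (op j)) (p.app k) (hp k)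

/-- Reedy cofibrant simplicial objects have projectively cofibrant replacements. -/
theorem exists_projectivelyCofibrant (Q : QuillenTensor D) [HasLimitsOfSize.{0, 0} D]
    {X : SimplexCategoryᵒᵖ ⥤ D}
    (hX : HasCofibrantLatchingMaps X) : ∃ (F : SimplexCategoryᵒᵖ ⥤ D) (α : F ⟶ X),
      IsProjectivelyCofibrant F ∧ ∀ n, WeakEquivalence (α.app n) := by
  -- A cofibrant bimodule over the representable one; its coend with `X` is the replacement. For
  -- fixed `n` both weights are projectively cofibrant, so the Reedy invariance applies to the
  -- comparison.
  let d : MorphismProperty.MapFactorizationData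
    ((trivialKanFibrations.{v}.functorCategory SimplexCategory).functorCategory
      SimplexCategoryᵒᵖ).llp
    ((trivialKanFibrations.{v}.functorCategory SimplexCategory).functorCategory
      SimplexCategoryᵒᵖ) (initial.to (representableWeight.{v} SimplexCategory)) :=
      MorphismProperty.factorizationData _ _ _
  have hi : ((trivialKanFibrations.{v}.functorCategory SimplexCategory).functorCategory
      SimplexCategoryᵒᵖ).llp (initial.to d.Z) := llp_initial_to initialIsInitial d.hi
  refine ⟨d.Z ⋙ (weightedCoend Q.tensor).flip.obj X,
    Functor.whiskerRight d.p ((weightedCoend Q.tensor).flip.obj X) ≫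
      Q.fromWeightedCoendRepresentable X,
    Q.isProjectivelyCofibrant_weightedCoend X hX.isCofibrant d.Z hi, fun n => ?_⟩
  have := hX.isCofibrant n
  have := Q.weakEquivalence_fromWeightedCoendRepresentable X n
  have : WeakEquivalence (((weightedCoend Q.tensor).map (d.p.app n)).app X) :=
    Q.weakEquivalence_map_app_of_isReedyMonomorphic (d.p.app n)
      (fun m => weakEquivalence_of_trivialKanFibration _ (d.hp n m))
      (isProjectiveWeight_obj hi n).isReedyMonomorphic
      (isProjectiveWeight_representableWeight n).isReedyMonomorphic hX
  exact inferInstanceAs (WeakEquivalence (((weightedCoend Q.tensor).map (d.p.app n)).app X ≫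
    (Q.fromWeightedCoendRepresentable X).app n))

end QuillenTensor


/-! ### Realizations and homotopy colimits -/

section ProjectivelyCofibrant

variable {D : Type u} [Category.{v} D] [ModelCategory D] {J : Type} [SmallCategory J]

theorem IsProjectivelyCofibrant.isCofibrant_obj [HasLimitsOfSize.{0, 0} D]
    [HasColimitsOfSize.{0, 0} D] {F : J ⥤ D} (hF : IsProjectivelyCofibrant F) (j : J) :
    IsCofibrant (F.obj j) := by
  have h : ((cofibrations D).rlp.functorCategory J).llp (initial.to F) := by
    rw [cofibrations_rlp]
    exact hF
  have := llp_app_of_llp_functorCategory h j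
  rw [cofibrations_rlp, trivialFibrations_llp] at this
  obtain ⟨hi⟩ := isInitial_initial_obj (D := D) j
  exact (isCofibrant_iff_of_isInitial _ hi).2 ⟨this⟩

/-- The constant diagram functor preserves trivial fibrations, so its left adjoint preserves
cofibrancy. -/
theorem IsProjectivelyCofibrant.isCofibrant_pt {F : J ⥤ D} (hF : IsProjectivelyCofibrant F)
    {c : Cocone F} (hc : IsColimit c) : IsCofibrant c.pt := by
  rw [isCofibrant_iff, cofibration_iff, ← trivialFibrations_llp]
  intro A B p hp
  refine ⟨fun {f g} _ => ?_⟩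
  have := hF ((Functor.const J).map p) (fun _ => hp)
  have sq : CommSq (initial.to ((Functor.const J).obj A)) (initial.to F) ((Functor.const J).map p)
    (c.ι ≫ (Functor.const J).map g) := ⟨initialIsInitial.hom_ext _ _⟩
  refine ⟨⟨⟨hc.desc ⟨A, sq.lift⟩, initialIsInitial.hom_ext _ _, hc.hom_ext fun j => ?_⟩⟩⟩
  rw [← Category.assoc, hc.fac]
  exact NatTrans.congr_app sq.fac_right j

end ProjectivelyCofibrant

theorem tensor_map_id_app_comp {S D : Type*} [Category S] [Category D] (T : S ⥤ D ⥤ D) (K : S)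
    {A B : D} (g : (T.obj K).obj A ⟶ B) : (T.map (𝟙 K)).app A ≫ g = g :=
  (congrArg (· ≫ g) (NatTrans.congr_app (T.map_id K) A)).trans (Category.id_comp g)

/-- The standard cosimplicial simplicial set, as a weight. -/
def standardWeight : SimplexCategory ⥤ SSet.{v} := SSet.stdSimplex

/-- The map from the standard cosimplicial simplicial set to the point. -/
noncomputable def standardWeightToConst :
    standardWeight.{v} ⟶ (Functor.const SimplexCategory).obj Δ[0] where
  app n := SSet.stdSimplex.map (SimplexCategory.isTerminalZero.from n)
  naturality _ _ _ := (Functor.map_comp _ _ _).symm.trans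
    ((congrArg _ (SimplexCategory.isTerminalZero.hom_ext _ _)).trans (Category.comp_id _).symm)

theorem weakEquivalence_standardWeightToConst_app (n : SimplexCategory) :
    WeakEquivalence (standardWeightToConst.{v}.app n) :=
  weakEquivalence_stdSimplex_map _

namespace QuillenTensor

variable {D : Type u} [Category.{v} D] [ModelCategory D] (Q : QuillenTensor D)

section ConstantWeights

variable [HasColimitsOfSize.{0, 0} D] {J : Type} [SmallCategory J]

/-- The map from the weighted colimit with a constant weight. -/
noncomputable def constantWeightDesc (K : SSet.{v}) {F : Jᵒᵖ ⥤ D} (c : Cocone F) :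
    ((weightedCoend Q.tensor).obj ((Functor.const J).obj K)).obj F ⟶ (Q.tensor.obj K).obj c.pt :=
  weightedCoend.desc (fun n => (Q.tensor.obj K).map (c.ι.app (op n))) fun m n f => by
    refine Eq.trans ?_ (tensor_map_id_app_comp Q.tensor K _).symm
    exact ((Q.tensor.obj K).map_comp _ _).symm.trans (congrArg _ (c.w f.op))

theorem ι_constantWeightDesc (K : SSet.{v}) {F : Jᵒᵖ ⥤ D} (c : Cocone F) (n : J) :
    weightedCoend.ι Q.tensor ((Functor.const J).obj K) F n ≫ Q.constantWeightDesc K c =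
      (Q.tensor.obj K).map (c.ι.app (op n)) :=
  weightedCoend.ι_desc _ _ _

/-- For a constant weight the coend condition is that of a cocone under `K ⊗ F`, and `K ⊗ -`
preserves colimits. -/
theorem isIso_constantWeightDesc (K : SSet.{v}) {F : Jᵒᵖ ⥤ D} {c : Cocone F} (hc : IsColimit c) :
    IsIso (Q.constantWeightDesc K c) := by
  have := (Q.cotensorAdj.adj K).isLeftAdjoint
  let h := isColimitOfPreserves (Q.tensor.obj K) hc
  let s : Cocone (F ⋙ Q.tensor.obj K) :=
    { pt := ((weightedCoend Q.tensor).obj ((Functor.const J).obj K)).obj F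
      ι :=
        { app n := weightedCoend.ι Q.tensor ((Functor.const J).obj K) F n.unop
          naturality n m f := by
            have h := weightedCoend.condition (T := Q.tensor) ((Functor.const J).obj K) F f.unop
            exact h.trans ((tensor_map_id_app_comp Q.tensor K _).trans
              (Category.comp_id _).symm) } }
  have fac (n : J) : (Q.tensor.obj K).map (c.ι.app (op n)) ≫ h.desc s =
      weightedCoend.ι Q.tensor ((Functor.const J).obj K) F n := h.fac s (op n)
  refine ⟨h.desc s, weightedCoend.hom_ext fun n => ?_, h.hom_ext fun n => ?_⟩
  · rw [← Category.assoc, ι_constantWeightDesc, fac, Category.comp_id]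
  · refine (Category.assoc _ _ _).symm.trans ((congrArg (· ≫ _) (fac n.unop)).trans ?_)
    exact (Q.ι_constantWeightDesc K c n.unop).trans (Category.comp_id _).symm

end ConstantWeights

/-- The map `Δ[n] ⊗ A ⟶ Δ[0] ⊗ A ⟶ A`. -/
noncomputable def collapse (n : SimplexCategory) : Q.tensor.obj (standardWeight.obj n) ⟶ 𝟭 D :=
  Q.tensor.map (standardWeightToConst.app n) ≫ Q.counit

variable [HasColimitsOfSize.{0, 0} D]

/-- The map from the realization to the colimit. -/
noncomputable def realizationDesc {X : SimplexCategoryᵒᵖ ⥤ D} (c : Cocone X) :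
    ((weightedCoend Q.tensor).obj standardWeight).obj X ⟶ c.pt :=
  ((weightedCoend Q.tensor).map standardWeightToConst).app X ≫ Q.constantWeightDesc Δ[0] c ≫
    Q.counit.app c.pt

theorem ι_realizationDesc {X : SimplexCategoryᵒᵖ ⥤ D} (c : Cocone X) (n : SimplexCategory) :
    weightedCoend.ι Q.tensor standardWeight X n ≫ Q.realizationDesc c =
      (Q.collapse n).app (X.obj (op n)) ≫ c.ι.app (op n) := by
  have h : (Q.tensor.obj Δ[0]).map (c.ι.app (op n)) ≫ Q.counit.app c.pt =
    Q.counit.app (X.obj (op n)) ≫ c.ι.app (op n) := Q.counit.naturality (c.ι.app (op n))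
  rw [realizationDesc, ← Category.assoc, weightedCoend.ι_map_app, Category.assoc]
  rw [← Category.assoc (weightedCoend.ι _ _ _ _), ι_constantWeightDesc]
  exact (congrArg (_ ≫ ·) h).trans (Category.assoc _ _ _).symm

/-- A composite of three weak equivalences: `Δ[•] ⟶ Δ[0]` induces one since `F` is projectively
cofibrant, the comparison with `Δ[0] ⊗ colim F` is invertible, and the counit is one since `colim F`
is cofibrant. -/
theorem weakEquivalence_realizationDesc {F : SimplexCategoryᵒᵖ ⥤ D}
    (hF : IsProjectivelyCofibrant F) {c : Cocone F} (hc : IsColimit c) :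
    WeakEquivalence (Q.realizationDesc c) := by
  have := Q.weakEquivalence_map_app standardWeightToConst weakEquivalence_standardWeightToConst_app F hF
  have := Q.isIso_constantWeightDesc Δ[0] hc
  have := hF.isCofibrant_pt hc
  have := Q.weakEquivalence_counit_app c.pt
  exact inferInstanceAs (WeakEquivalence (_ ≫ _ ≫ _))

variable [HasLimitsOfSize.{0, 0} D]
  [MorphismProperty.HasFunctorialFactorization (cofibrations D) (trivialFibrations D)]

/-- Replace `Δ[•]` by a projectively cofibrant weight `V`. The coend with `V` preserves `α`;
changing `V` back to `Δ[•]` is harmless on `F` by projective cofibrancy and on `X` by Reedy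
cofibrancy. -/
theorem weakEquivalence_realization_map {F X : SimplexCategoryᵒᵖ ⥤ D} (α : F ⟶ X)
    (hF : IsProjectivelyCofibrant F) (hX : HasCofibrantLatchingMaps X)
    (hα : ∀ n, WeakEquivalence (α.app n)) :
    WeakEquivalence (((weightedCoend Q.tensor).obj standardWeight).map α) := by
  let d : MorphismProperty.MapFactorizationData
    (trivialKanFibrations.{v}.functorCategory SimplexCategory).llp
    (trivialKanFibrations.{v}.functorCategory SimplexCategory) (initial.to standardWeight.{v}) :=
      MorphismProperty.factorizationData _ _ _
  have hV : IsProjectiveWeight d.Z := llp_initial_to initialIsInitial d.hi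
  have hp (n) : WeakEquivalence (d.p.app n) := weakEquivalence_of_trivialKanFibration _ (d.hp n)
  have h₁ := Q.weakEquivalence_obj_map α hF.isCofibrant_obj hX.isCofibrant hα d.Z hV
  have h₂ := Q.weakEquivalence_map_app d.p hp F hF
  have h₃ := Q.weakEquivalence_map_app_of_isReedyMonomorphic d.p hp hV.isReedyMonomorphic
    isReedyMonomorphic_stdSimplex hX
  have h := ((weightedCoend Q.tensor).map d.p).naturality α
  exact weakEquivalence_of_precomp_of_fac
    (fac := h.symm)

/-- The realization of a Reedy cofibrant simplicial object is a homotopy colimit. -/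
theorem weakEquivalence_desc_iff {F X : SimplexCategoryᵒᵖ ⥤ D} (α : F ⟶ X)
    (hF : IsProjectivelyCofibrant F) (hX : HasCofibrantLatchingMaps X)
    (hα : ∀ n, WeakEquivalence (α.app n)) {c : Cocone F} (hc : IsColimit c) {c' : Cocone X}
    (a : c.pt ⟶ c'.pt) (ha : ∀ n, c.ι.app n ≫ a = α.app n ≫ c'.ι.app n)
    {Y : D} (f : c'.pt ⟶ Y) :
    WeakEquivalence (a ≫ f) ↔ WeakEquivalence (Q.realizationDesc c' ≫ f) := by
  have h₁ := Q.weakEquivalence_realization_map α hF hX hα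
  have h₂ := Q.weakEquivalence_realizationDesc hF hc
  have h : Q.realizationDesc c ≫ a ≫ f =
      ((weightedCoend Q.tensor).obj standardWeight).map α ≫ Q.realizationDesc c' ≫ f := by
    refine weightedCoend.hom_ext fun n => ?_
    rw [← Category.assoc, ι_realizationDesc, ← Category.assoc
      (weightedCoend.ι _ _ _ _), weightedCoend.ι_obj_map, Category.assoc, Category.assoc,
      reassoc_of% ha (op n), ← Category.assoc (weightedCoend.ι _ _ _ _), ι_realizationDesc,
      Category.assoc]
    exact (NatTrans.naturality_assoc (Q.collapse n) (α.app (op n)) _).symm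
  rw [← weakEquivalence_precomp_iff (Q.realizationDesc c) (a ≫ f), h, weakEquivalence_precomp_iff]

end QuillenTensor


/-! ### Weak equivalences and the homotopy category -/

section Saturation

variable {D : Type u} [Category.{v} D] [ModelCategory D]

/-- A fibration between bifibrant objects which becomes invertible in the homotopy category is a
weak equivalence. -/
theorem weakEquivalence_of_isIso_map_of_fibration {X Y : D} [IsCofibrant X] [IsFibrant X]
    [IsCofibrant Y] [IsFibrant Y] (q : X ⟶ Y) [Fibration q]
    [IsIso ((weakEquivalences D).Q.map q)] : WeakEquivalence q := by
  obtain ⟨s₀, hs₀⟩ := map_surjective_of_isLocalization (weakEquivalences D).Q Y X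
    (inv ((weakEquivalences D).Q.map q))
  have h₀ : LeftHomotopyRel (s₀ ≫ q) (𝟙 Y) := by
    rw [LeftHomotopyRel.iff_map_eq (weakEquivalences D).Q, Functor.map_comp, hs₀,
      IsIso.inv_hom_id, CategoryTheory.Functor.map_id]
  obtain ⟨P, _, ⟨h₀⟩⟩ := h₀.exists_good_cylinder
  obtain ⟨s, hs, hsq⟩ := h₀.covering_homotopy q s₀ rfl
  -- The covering homotopy property has replaced the homotopy section `s₀` by a strict section `s`
  -- in the same homotopy class.
  have hsq' : s ≫ q = 𝟙 Y := by rw [← hs.h₁, Category.assoc, hsq, h₀.h₁]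
  have hs' : (weakEquivalences D).Q.map s = inv ((weakEquivalences D).Q.map q) := by
    rw [← hs₀, (LeftHomotopyRel.iff_map_eq (weakEquivalences D).Q _ _).1 hs.leftHomotopyRel]
  have h₁ : LeftHomotopyRel (q ≫ s) (𝟙 X) := by
    rw [LeftHomotopyRel.iff_map_eq (weakEquivalences D).Q, Functor.map_comp, hs',
      IsIso.hom_inv_id, CategoryTheory.Functor.map_id]
  obtain ⟨P', ⟨h₁⟩⟩ := h₁
  have hw : WeakEquivalence (q ≫ s) := h₁.weakEquivalence_iff.2 inferInstance
  -- Since `s` is a strict section, `q` is a retract of `q ≫ s`, which is homotopic to the identity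
  -- and hence a weak equivalence.
  let r : RetractArrow q (q ≫ s) :=
    { i := Arrow.homMk (𝟙 X) s (by simp)
      r := Arrow.homMk (𝟙 X) q (by simp [hsq'])
      retract := by ext <;> simp [hsq'] }
  exact ⟨MorphismProperty.of_retract r hw.1⟩

/-- A map between bifibrant objects which becomes invertible in the homotopy category is a
weak equivalence. -/
theorem weakEquivalence_of_isIso_map {X Y : D} [IsCofibrant X] [IsFibrant X]
    [IsCofibrant Y] [IsFibrant Y] (f : X ⟶ Y)
    [IsIso ((weakEquivalences D).Q.map f)] : WeakEquivalence f := by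
  let d := MorphismProperty.factorizationData (trivialCofibrations D) (fibrations D) f
  have : Cofibration d.i := ⟨d.hi.1⟩
  have : WeakEquivalence d.i := ⟨d.hi.2⟩
  have : Fibration d.p := ⟨d.hp⟩
  have : IsCofibrant d.Z := isCofibrant_of_cofibration d.i
  have : IsFibrant d.Z := isFibrant_of_fibration d.p
  have : IsIso ((weakEquivalences D).Q.map d.i) :=
    Localization.inverts (weakEquivalences D).Q (weakEquivalences D) d.i d.hi.2
  have : IsIso ((weakEquivalences D).Q.map d.i ≫ (weakEquivalences D).Q.map d.p) := by
    rw [← Functor.map_comp, d.fac]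
    infer_instance
  have : IsIso ((weakEquivalences D).Q.map d.p) :=
    IsIso.of_isIso_comp_left ((weakEquivalences D).Q.map d.i) _
  have := weakEquivalence_of_isIso_map_of_fibration d.p
  rw [← d.fac]
  infer_instance

end Saturation

/-! ### The cotensor with a point -/

namespace QuillenTensor

variable {D : Type u} [Category.{v} D] [ModelCategory D] (Q : QuillenTensor D)

theorem cofibration_tensor_map (K : SSet.{v}) {A A' : D} (j : A ⟶ A') [Cofibration j] :
    Cofibration ((Q.tensor.obj K).map j) := by
  refine ⟨?_⟩
  rw [← trivialFibrations_llp]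
  intro B B' p hp
  have : Fibration p := ⟨hp.1⟩
  have : WeakEquivalence p := ⟨hp.2⟩
  refine (hasLiftingProperty_map_app_iff Q.mappingAdj j K p (.ofHasPullback _ _ _)).2 ?_
  exact Q.trivialKan_of_trivialFibration j p _ _ (MorphismProperty.monomorphisms.infer_property _)

theorem trivialCofibration_tensor_map (K : SSet.{v}) {A A' : D} (j : A ⟶ A') [Cofibration j]
    [WeakEquivalence j] : trivialCofibrations D ((Q.tensor.obj K).map j) := by
  rw [← fibrations_llp]
  intro B B' p hp
  have : Fibration p := ⟨hp⟩
  refine (hasLiftingProperty_map_app_iff Q.mappingAdj j K p (.ofHasPullback _ _ _)).2 ?_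
  exact Q.trivialKan_of_trivialCofibration j p _ _
    (MorphismProperty.monomorphisms.infer_property _)

theorem isCofibrant_tensor (K : SSet.{v}) (A : D) [IsCofibrant A] :
    IsCofibrant ((Q.tensor.obj K).obj A) := by
  have := (Q.cotensorAdj.adj K).isLeftAdjoint
  exact (isCofibrant_iff_of_isInitial ((Q.tensor.obj K).map (initial.to A))
    (initialIsInitial.isInitialObj (Q.tensor.obj K))).2 (Q.cofibration_tensor_map K _)

theorem fibration_cotensor_map (K : SSet.{v}) {B B' : D} (p : B ⟶ B') [hp : Fibration p] :
    Fibration ((Q.cotensor.obj (op K)).map p) := by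
  refine ⟨?_⟩
  rw [← trivialCofibrations_rlp]
  intro A A' j hj
  have : Cofibration j := ⟨hj.1⟩
  have : WeakEquivalence j := ⟨hj.2⟩
  have h := Q.trivialCofibration_tensor_map K j
  rw [← fibrations_llp] at h
  exact ((Q.cotensorAdj.adj K).hasLiftingProperty_iff j p).1 (h p hp.1)

theorem trivialFibration_cotensor_map (K : SSet.{v}) {B B' : D} (p : B ⟶ B') [Fibration p]
    [WeakEquivalence p] : trivialFibrations D ((Q.cotensor.obj (op K)).map p) := by
  rw [← cofibrations_rlp]
  intro A A' j hj
  have : Cofibration j := ⟨hj⟩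
  have := Q.cofibration_tensor_map K j
  exact ((Q.cotensorAdj.adj K).hasLiftingProperty_iff j p).1 inferInstance

theorem isFibrant_cotensor (K : SSet.{v}) (B : D) [IsFibrant B] :
    IsFibrant ((Q.cotensor.obj (op K)).obj B) := by
  have := (Q.cotensorAdj.adj K).isRightAdjoint
  exact (isFibrant_iff_of_isTerminal ((Q.cotensor.obj (op K)).map (terminal.from B))
    (terminalIsTerminal.isTerminalObj (Q.cotensor.obj (op K)))).2 (Q.fibration_cotensor_map K _)

/-- The map `A ⟶ A ^ Δ[0]`. -/
def unit : 𝟭 D ⟶ Q.cotensor.obj (op Δ[0]) where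
  app A := Q.cotensorAdj.homEquiv (Q.counit.app A)
  naturality A B f := by
    refine (Q.cotensorAdj.homEquiv_naturality_two _ _).symm.trans (Eq.trans ?_
      (Q.cotensorAdj.homEquiv_naturality_three _ _))
    exact congrArg _ (Q.counit.naturality f)

/-- Transposition is compatible with homotopies. -/
theorem map_homEquiv_eq {K : SSet.{v}} {A B : D} [IsCofibrant A] [IsFibrant B]
    {f g : (Q.tensor.obj K).obj A ⟶ B}
    (h : (weakEquivalences D).Q.map f = (weakEquivalences D).Q.map g) :
    (weakEquivalences D).Q.map (Q.cotensorAdj.homEquiv f) =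
      (weakEquivalences D).Q.map (Q.cotensorAdj.homEquiv g) := by
  have := Q.isCofibrant_tensor K A
  rw [← RightHomotopyRel.iff_map_eq] at h
  obtain ⟨P, _, ⟨⟨h, rfl, rfl⟩⟩⟩ := h.exists_good_pathObject
  let R := Q.cotensor.obj (op K)
  have h₁ : (weakEquivalences D).Q.map (R.map P.ι) ≫ (weakEquivalences D).Q.map (R.map P.p₀) =
      𝟙 _ := by
    rw [← Functor.map_comp, ← Functor.map_comp, P.ι_p₀, CategoryTheory.Functor.map_id,
      CategoryTheory.Functor.map_id]
  have h₂ : (weakEquivalences D).Q.map (R.map P.ι) ≫ (weakEquivalences D).Q.map (R.map P.p₁) =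
      𝟙 _ := by
    rw [← Functor.map_comp, ← Functor.map_comp, P.ι_p₁, CategoryTheory.Functor.map_id,
      CategoryTheory.Functor.map_id]
  -- The cotensor keeps the trivial fibration `P.p₀` a weak equivalence, so it sends `P.ι` to an
  -- isomorphism of the homotopy category. Both projections are left inverted by it, hence become
  -- equal.
  have : IsIso ((weakEquivalences D).Q.map (R.map P.p₀)) :=
    Localization.inverts _ _ _ (Q.trivialFibration_cotensor_map K P.p₀).2
  have : IsIso ((weakEquivalences D).Q.map (R.map P.ι)) := by
    rw [← IsIso.eq_comp_inv] at h₁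
    rw [h₁]
    infer_instance
  have h₃ : (weakEquivalences D).Q.map (R.map P.p₀) = (weakEquivalences D).Q.map (R.map P.p₁) := by
    rw [← cancel_epi ((weakEquivalences D).Q.map (R.map P.ι)), h₁, h₂]
  rw [Q.cotensorAdj.homEquiv_naturality_three,
    Q.cotensorAdj.homEquiv_naturality_three, Functor.map_comp, Functor.map_comp]
  exact congrArg (_ ≫ ·) h₃

/-- The derived functor of `Δ[0] ⊗ -` is the identity through the counit, so its right adjoint is
the identity through the mate. Concretely, lift the unit to `g : A ⟶ S` along a cofibrant resolution
`p` of `A ^ Δ[0]`. The transpose of `p`, precomposed with the inverse of the counit at `S`, is an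
inverse of `g` in the homotopy category, so `g` is a weak equivalence by saturation. -/
theorem weakEquivalence_unit_app_of_isCofibrant (A : D) [IsCofibrant A] [IsFibrant A] :
    WeakEquivalence (Q.unit.app A) := by
  let W := (weakEquivalences D).Q
  let R := Q.cotensor.obj (op Δ[0])
  have := Q.isFibrant_cotensor Δ[0] A
  obtain ⟨S, _, p, _, _⟩ := CofibrantObject.HoCat.exists_resolution (R.obj A)
  have : IsFibrant S := isFibrant_of_fibration p
  have sq : CommSq (initial.to S) (initial.to A) p (Q.unit.app A) := ⟨initialIsInitial.hom_ext _ _⟩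
  let g : A ⟶ S := sq.lift
  have hg : g ≫ p = Q.unit.app A := sq.fac_right
  let p' : (Q.tensor.obj Δ[0]).obj S ⟶ A := Q.cotensorAdj.homEquiv.symm p
  have hp' : Q.cotensorAdj.homEquiv p' = p := Equiv.apply_symm_apply _ _
  have hS := Q.weakEquivalence_counit_app S
  have hA := Q.weakEquivalence_counit_app A
  have : IsIso (W.map (Q.counit.app S)) := Localization.inverts _ _ _ hS.1
  have : IsIso (W.map (Q.counit.app A)) := Localization.inverts _ _ _ hA.1
  have hp : WeakEquivalence p := inferInstance
  have : IsIso (W.map p) := Localization.inverts _ _ _ hp.1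
  have := Q.isCofibrant_tensor Δ[0] S
  obtain ⟨h, hh⟩ := map_surjective_of_isLocalization W S A (inv (W.map (Q.counit.app S)) ≫ W.map p')
  have h₁ : (Q.tensor.obj Δ[0]).map g ≫ p' = Q.counit.app A := by
    apply Q.cotensorAdj.homEquiv.injective
    rw [Q.cotensorAdj.homEquiv_naturality_two, hp', hg]
    rfl
  have h₂ : (Q.tensor.obj Δ[0]).map g ≫ Q.counit.app S = Q.counit.app A ≫ g :=
    Q.counit.naturality g
  have h₃ : W.map g ≫ W.map h = 𝟙 _ := by
    rw [hh, ← cancel_epi (W.map (Q.counit.app A)), ← Category.assoc, ← Functor.map_comp]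
    change W.map (Q.counit.app A ≫ g) ≫ _ = _
    rw [← h₂, Functor.map_comp, Category.assoc, IsIso.hom_inv_id_assoc, ← Functor.map_comp, h₁]
    exact (Category.comp_id _).symm
  have h₄ : h ≫ Q.unit.app A = Q.cotensorAdj.homEquiv (Q.counit.app S ≫ h) := by
    refine (Q.cotensorAdj.homEquiv_naturality_two _ _).symm.trans ?_
    exact congrArg _ (Q.counit.naturality h)
  have h₅ : W.map (Q.counit.app S ≫ h) = W.map p' := by
    rw [Functor.map_comp, hh]
    exact IsIso.hom_inv_id_assoc _ _
  have h₆ : W.map h ≫ W.map g = 𝟙 _ := by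
    rw [← cancel_mono (W.map p), Category.assoc, ← Functor.map_comp, ← Functor.map_comp, hg, h₄,
      Q.map_homEquiv_eq h₅, hp', Category.id_comp]
  have : IsIso (W.map g) := ⟨W.map h, h₃, h₆⟩
  have := weakEquivalence_of_isIso_map g
  rw [← hg]
  infer_instance

theorem weakEquivalence_unit_app (A : D) [IsFibrant A] : WeakEquivalence (Q.unit.app A) := by
  obtain ⟨P, _, p, _, _⟩ := CofibrantObject.HoCat.exists_resolution A
  have : IsFibrant P := isFibrant_of_fibration p
  have h₁ := Q.weakEquivalence_unit_app_of_isCofibrant P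
  have h₂ : WeakEquivalence ((Q.cotensor.obj (op Δ[0])).map p) :=
    ⟨(Q.trivialFibration_cotensor_map Δ[0] p).2⟩
  have h : p ≫ Q.unit.app A = Q.unit.app P ≫ (Q.cotensor.obj (op Δ[0])).map p :=
    Q.unit.naturality p
  have : WeakEquivalence (p ≫ Q.unit.app A) := by
    rw [h]
    infer_instance
  exact weakEquivalence_of_precomp p _

end QuillenTensor


/-! ### The two-variable adjunction of a weak simplicial tensoring -/

section ParametrizedRightAdjoint

variable {A B E : Type*} [Category A] [Category B] [Category E] (F : A ⥤ B ⥤ E)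
  [∀ a, (F.obj a).IsLeftAdjoint]

/-- The right adjoints of the partial functors of a bifunctor. -/
noncomputable def parametrizedRightAdjoint : Aᵒᵖ ⥤ E ⥤ B where
  obj a := (F.obj a.unop).rightAdjoint
  map {a b} f := conjugateEquiv (Adjunction.ofIsLeftAdjoint (F.obj a.unop))
    (Adjunction.ofIsLeftAdjoint (F.obj b.unop)) (F.map f.unop)
  map_id a := by simp
  map_comp f g := by simp

/-- The adjunctions between the partial functors of a bifunctor and their right adjoints. -/
noncomputable def parametrizedRightAdjointAdj : F ⊣₂ parametrizedRightAdjoint F where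
  adj a := Adjunction.ofIsLeftAdjoint (F.obj a)
  unit_whiskerRight_map {a b} f := by
    ext X
    exact (unit_conjugateEquiv (Adjunction.ofIsLeftAdjoint (F.obj b))
      (Adjunction.ofIsLeftAdjoint (F.obj a)) (F.map f) X).symm

end ParametrizedRightAdjoint

theorem isLeftAdjoint_of_preservesColimits_sset {C : Type u} [Category.{v} C] [HasColimits C]
    (F : SSet.{v} ⥤ C) [PreservesColimitsOfSize.{v, v} F] : F.IsLeftAdjoint := by
  have : PreservesColimitsOfSize.{0, v} F := preservesColimitsOfSize_of_univLE.{v, v} F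
  exact Presheaf.isLeftAdjoint_of_preservesColimits.{v} F

namespace WeakSimplicialTensoring

variable {C : Type u} [Category.{v} C] [ModelCategory C] (T : WeakSimplicialTensoring C)
  [IsCombinatorial C]

open scoped SSet.modelCategoryQuillen

instance (X : C) : (T.tensor.flip.obj X).IsLeftAdjoint :=
  have := T.isLeftQuillenBifunctor.preservesColimits_flip_obj X
  isLeftAdjoint_of_preservesColimits_sset _

/-- The two-variable Quillen adjunction of a weak simplicial tensoring. -/
noncomputable def quillenTensor : QuillenTensor C where
  tensor := T.tensor
  cotensor := cotensor T.tensor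
  mapping := parametrizedRightAdjoint T.tensor.flip
  cotensorAdj := cotensorAdj T.tensor
  mappingAdj := parametrizedRightAdjointAdj T.tensor.flip
  trivialKan_of_trivialFibration j p _ _ _ sq K L i hi := by
    have : Cofibration i := (SSet.modelCategoryQuillen.cofibration_iff i).2 hi
    have := T.isLeftQuillenBifunctor.cofibration i j
    refine ((parametrizedRightAdjointAdj T.tensor.flip).hasLiftingProperty_iff
      (Functor.PushoutObjObj.ofHasPushout T.tensor i j).flip sq).1 ?_
    exact inferInstanceAs (HasLiftingProperty (Functor.PushoutObjObj.ofHasPushout T.tensor i j).ι p)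
  trivialKan_of_trivialCofibration j p _ _ _ sq K L i hi := by
    have : Cofibration i := (SSet.modelCategoryQuillen.cofibration_iff i).2 hi
    have := T.isLeftQuillenBifunctor.cofibration i j
    have := T.isLeftQuillenBifunctor.weakEquivalence_right i j
    refine ((parametrizedRightAdjointAdj T.tensor.flip).hasLiftingProperty_iff
      (Functor.PushoutObjObj.ofHasPushout T.tensor i j).flip sq).1 ?_
    exact inferInstanceAs (HasLiftingProperty (Functor.PushoutObjObj.ofHasPushout T.tensor i j).ι p)
  hasLiftingProperty {K L} i hi hw {A A' B B'} j p hj hp sq := by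
    have : Cofibration i := (SSet.modelCategoryQuillen.cofibration_iff i).2 hi
    have := T.isLeftQuillenBifunctor.cofibration i j
    have := T.isLeftQuillenBifunctor.weakEquivalence_left i j
    refine ((parametrizedRightAdjointAdj T.tensor.flip).hasLiftingProperty_iff
      (Functor.PushoutObjObj.ofHasPushout T.tensor i j).flip sq).1 ?_
    exact inferInstanceAs (HasLiftingProperty (Functor.PushoutObjObj.ofHasPushout T.tensor i j).ι p)
  counit := T.counit
  weakEquivalence_counit_app := T.weakEquivalence_counit_app

end WeakSimplicialTensoring

/-! ### The opposite two-variable adjunction -/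

namespace QuillenTensor

variable {C : Type u} [Category.{v} C] [ModelCategory C] (Q : QuillenTensor C)

/-- The adjunctions of the opposite two-variable adjunction, for the cotensors. -/
def opCotensorAdj : (Q.cotensor.rightOp ⋙ Functor.opHom C C) ⊣₂
    (Q.tensor.op ⋙ Functor.opHom C C) :=
  ParametrizedAdjunction.mk'
    (fun K => (Q.cotensorAdj.adj K).op)
    (fun {K L} f {A E} g => by
      have h (K : SSet.{v}) (g : op ((Q.cotensor.obj (op K)).obj A.unop) ⟶ E) :
          ((Q.cotensorAdj.adj K).op.homEquiv A E) g = (Q.cotensorAdj.homEquiv.symm g.unop).op :=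
        ((Q.cotensorAdj.adj K).op.homEquiv_unit A E g).trans
          (congrArg Quiver.Hom.op ((Q.cotensorAdj.adj K).homEquiv_counit E.unop A.unop g.unop).symm)
      refine (h K _).trans (Eq.trans ?_ (congrArg (fun t => t ≫ _) (h L g).symm))
      exact congrArg Quiver.Hom.op (Q.cotensorAdj.homEquiv_symm_naturality_one f g.unop))

/-- The natural bijections of the opposite two-variable adjunction, for the mapping objects. -/
def opMappingHomEquiv (A : Cᵒᵖ) : Adjunction.CoreHomEquiv
    ((Q.cotensor.rightOp ⋙ Functor.opHom C C).flip.obj A)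
    ((unopUnop C ⋙ Q.mapping.flip).obj (op A)) where
  homEquiv _ _ := (opEquiv _ _).trans Q.transpose
  homEquiv_naturality_left_symm f g :=
    Quiver.Hom.unop_inj (Q.transpose.injective ((Q.transpose.apply_symm_apply _).trans
      ((congrArg (f ≫ ·) (Q.transpose.apply_symm_apply g).symm).trans
        (Q.transpose_weight f (Q.transpose.symm g)).symm)))
  homEquiv_naturality_right g f := Q.transpose_precomp f.unop g.unop

/-- The adjunctions of the opposite two-variable adjunction, for the mapping objects. -/
def opMappingAdj : (Q.cotensor.rightOp ⋙ Functor.opHom C C).flip ⊣₂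
    (unopUnop C ⋙ Q.mapping.flip) :=
  ParametrizedAdjunction.mk'
    (fun A => Adjunction.mkOfHomEquiv (Q.opMappingHomEquiv A))
    (fun {A B} f {K E} g => by
      have h (A : Cᵒᵖ) (g : ((Q.cotensor.rightOp ⋙ Functor.opHom C C).flip.obj A).obj K ⟶ E) :
          (Adjunction.mkOfHomEquiv (Q.opMappingHomEquiv A)).homEquiv K E g = Q.transpose g.unop :=
        congrFun (congrArg DFunLike.coe (congrFun (congrFun
          (Adjunction.mkOfHomEquiv_homEquiv (Q.opMappingHomEquiv A)) K) E)) g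
      refine (h A _).trans (Eq.trans ?_ (congrArg (fun t => t ≫ _) (h B g).symm))
      exact Q.transpose_postcomp f.unop g.unop)

/-- A pullback-hom for the opposite mapping objects is a pullback-hom for the mapping objects. -/
def unopPullbackObjObj {A A' B B' : Cᵒᵖ} {j : A ⟶ A'} {p : B ⟶ B'}
    (sq : (unopUnop C ⋙ Q.mapping.flip).PullbackObjObj j p) :
    Q.mapping.PullbackObjObj p.unop j.unop where
  pt := sq.pt
  fst := sq.snd
  snd := sq.fst
  isPullback := sq.isPullback.flip
  π := sq.π
  π_fst := sq.π_snd
  π_snd := sq.π_fst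

/-- The opposite of a two-variable Quillen adjunction. -/
def op : QuillenTensor Cᵒᵖ where
  tensor := Q.cotensor.rightOp ⋙ Functor.opHom C C
  cotensor := Q.tensor.op ⋙ Functor.opHom C C
  mapping := unopUnop C ⋙ Q.mapping.flip
  cotensorAdj := Q.opCotensorAdj
  mappingAdj := Q.opMappingAdj
  -- Trivial fibrations and trivial cofibrations are exchanged by opposites, so the two axioms trade
  -- places.
  trivialKan_of_trivialFibration j p _ _ _ sq :=
    Q.trivialKan_of_trivialCofibration p.unop j.unop (Q.unopPullbackObjObj sq)
  trivialKan_of_trivialCofibration j p _ _ _ sq :=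
    Q.trivialKan_of_trivialFibration p.unop j.unop (Q.unopPullbackObjObj sq)
  hasLiftingProperty {K L} i hi hw {A A' B B'} j p hj hp sq :=
    Q.hasLiftingProperty i p.unop j.unop (Q.unopPullbackObjObj sq)
  counit := NatTrans.op Q.unit
  weakEquivalence_counit_app A _ := by
    have : IsFibrant A.unop :=
      (isFibrant_iff_of_isTerminal (initial.to A).unop (initialIsInitial.unop)).2 inferInstance
    have := Q.weakEquivalence_unit_app A.unop
    exact inferInstanceAs (WeakEquivalence (Q.unit.app A.unop).op)

end QuillenTensor


/-! ### Functorial factorizations in combinatorial model categories -/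

/-- Each source of a map in `I` is presentable, and `I` is small, so a single regular cardinal
exceeds all their ranks. -/
theorem hasSmallObjectArgument_of_isLocallyPresentable {C : Type u} [Category.{v} C]
    [IsLocallyPresentable.{v} C] (I : MorphismProperty C) [MorphismProperty.IsSmall.{v} I] :
    MorphismProperty.HasSmallObjectArgument.{v} I := by
  obtain ⟨_, _, _⟩ := IsLocallyPresentable.exists_cardinal.{v} C
  have (f : I.toSet) : IsPresentable.{v} f.1.left := inferInstance
  choose k hk hk' using fun f : I.toSet => (this f).exists_cardinal
  obtain ⟨κ, hκ, h⟩ := HasCardinalLT.exists_regular_cardinal_forall.{v}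
    (fun f : I.toSet => (k f).ord.ToType)
  have : Fact κ.IsRegular := ⟨hκ⟩
  have : Nonempty κ.ord.ToType := by simpa using hκ.ne_zero
  have := WellFoundedLT.toOrderBot κ.ord.ToType
  refine ⟨κ, inferInstance, inferInstance, { preservesColimit := ?_ }⟩
  intro A B X Y i hi f hf
  have := hk ⟨Arrow.mk i, hi⟩
  have h₁ : IsCardinalPresentable A (k ⟨Arrow.mk i, hi⟩) := hk' ⟨Arrow.mk i, hi⟩
  have hle : k ⟨Arrow.mk i, hi⟩ ≤ κ := by
    have := h ⟨Arrow.mk i, hi⟩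
    rw [hasCardinalLT_iff_cardinal_mk_lt, Cardinal.mk_ord_toType] at this
    exact this.le
  have := isCardinalPresentable_of_le A hle
  have := preservesColimitsOfShape_of_isCardinalPresentable A κ κ.ord.ToType
  infer_instance

theorem hasFunctorialFactorization_op {C : Type u} [Category.{v} C] (P R : MorphismProperty C)
    [MorphismProperty.HasFunctorialFactorization P R] :
    MorphismProperty.HasFunctorialFactorization R.op P.op := by
  let d := MorphismProperty.functorialFactorizationData P R
  let unop : Arrow Cᵒᵖ → Arrow C := fun f => Arrow.mk f.hom.unop
  let unopMap {f g : Arrow Cᵒᵖ} (φ : f ⟶ g) : unop g ⟶ unop f :=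
    Arrow.homMk φ.right.unop φ.left.unop (Quiver.Hom.op_inj φ.w.symm)
  exact ⟨⟨{
    Z :=
      { obj f := op (d.Z.obj (unop f))
        map φ := (d.Z.map (unopMap φ)).op
        map_id f := congrArg Quiver.Hom.op (d.Z.map_id (unop f))
        map_comp φ ψ := congrArg Quiver.Hom.op (d.Z.map_comp (unopMap ψ) (unopMap φ)) }
    i :=
      { app f := (d.p.app (unop f)).op
        naturality f g φ := congrArg Quiver.Hom.op (d.p.naturality (unopMap φ)).symm }
    p :=
      { app f := (d.i.app (unop f)).op
        naturality f g φ := congrArg Quiver.Hom.op (d.i.naturality (unopMap φ)).symm }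
    fac := by
      ext f
      exact congrArg Quiver.Hom.op (d.fac_app (f := unop f))
    hi f := d.hp (unop f)
    hp f := d.hi (unop f) }⟩⟩

section

variable (C : Type u) [Category.{v} C] [ModelCategory C] [IsCombinatorial C]

theorem hasFunctorialFactorization_of_isSmall {P R : MorphismProperty C}
    [P.IsWeakFactorizationSystem R] (I : MorphismProperty C) [MorphismProperty.IsSmall.{v} I]
    (h : R = I.rlp) : MorphismProperty.HasFunctorialFactorization P R := by
  have := hasSmallObjectArgument_of_isLocallyPresentable I
  rw [← MorphismProperty.llp_eq_of_wfs P R, h]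
  infer_instance

instance hasFunctorialFactorization_cofibrations :
    MorphismProperty.HasFunctorialFactorization (cofibrations C) (trivialFibrations C) := by
  obtain ⟨I, _, h⟩ := IsCombinatorial.exists_generatingCofibrations (C := C)
  exact hasFunctorialFactorization_of_isSmall C I h

instance hasFunctorialFactorization_trivialCofibrations :
    MorphismProperty.HasFunctorialFactorization (trivialCofibrations C) (fibrations C) := by
  obtain ⟨J, _, h⟩ := IsCombinatorial.exists_generatingTrivialCofibrations (C := C)
  exact hasFunctorialFactorization_of_isSmall C J h

/-- Since `Cᵒᵖ` need not be combinatorial, its factorization is the opposite of the one of `C` into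
a trivial cofibration and a fibration. -/
instance hasFunctorialFactorization_cofibrations_op :
    MorphismProperty.HasFunctorialFactorization (cofibrations Cᵒᵖ) (trivialFibrations Cᵒᵖ) :=
  hasFunctorialFactorization_op (trivialCofibrations C) (fibrations C)

end

/-! ### The homotopy colimit of a Reedy cofibrant simplicial object -/

namespace WeakSimplicialTensoring

variable {C : Type u} [Category.{v} C] [ModelCategory C] (T : WeakSimplicialTensoring C)
  [IsCombinatorial C]

theorem realizationToColimit_eq (X : SimplexCategoryᵒᵖ ⥤ C) :
    T.realizationToColimit X = T.quillenTensor.realizationDesc (colimit.cocone X) :=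
  weightedCoend.hom_ext fun n =>
    (coend.ι_desc (F := realizationBifunctor T.tensor X) _ _ n).trans
      (T.quillenTensor.ι_realizationDesc (colimit.cocone X) n).symm

theorem exhibitsHomotopyColimit_iff (X : SimplexCategoryᵒᵖ ⥤ C) (hX : IsReedyCofibrant X) (Y : C)
    (f : colimit X ⟶ Y) :
    ExhibitsHomotopyColimit X f ↔ WeakEquivalence (T.realizationToColimit X ≫ f) := by
  -- The criterion holds for every projectively cofibrant replacement, so the converse direction
  -- only needs one to exist.
  have key (F : SimplexCategoryᵒᵖ ⥤ C) (α : F ⟶ X) (hF : IsProjectivelyCofibrant F)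
      (hα : ∀ n, WeakEquivalence (α.app n)) :
      WeakEquivalence (colimMap α ≫ f) ↔ WeakEquivalence (T.realizationToColimit X ≫ f) :=
    T.realizationToColimit_eq X ▸ T.quillenTensor.weakEquivalence_desc_iff α hF hX.hasCofibrantLatchingMaps hα
      (colimit.isColimit F) (c' := colimit.cocone X) (colimMap α) (fun n => ι_colimMap α n) f
  constructor
  · rintro ⟨F, α, hα, hF, h⟩
    exact (key F α hF fun n => ⟨hα n⟩).1 h
  · intro h
    obtain ⟨F, α, hF, hα⟩ := T.quillenTensor.exists_projectivelyCofibrant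
      hX.hasCofibrantLatchingMaps
    exact ⟨F, α, fun n => (hα n).mem, hF, (key F α hF hα).2 h⟩

end WeakSimplicialTensoring

/-! ### The homotopy limit of a Reedy fibrant cosimplicial object -/

/-- The opposite of the matching cone is a colimit cocone, but not the chosen one;
`HasCofibrantLatchingMaps` allows any. -/
theorem IsReedyFibrant.op {C : Type u} [Category.{v} C] [HasLimitsOfSize.{0, 0} C]
    [CategoryWithFibrations C] {X : SimplexCategory ⥤ C} (hX : IsReedyFibrant X) :
    HasCofibrantLatchingMaps X.op := fun n => by
  have := hX n
  exact ⟨(limit.cone (matchingDiagram X n)).op, (limit.isLimit (matchingDiagram X n)).op,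
    inferInstanceAs (Cofibration (matchingMap X n).op)⟩

section

variable {C : Type u} [Category.{v} C] [ModelCategory C] {J : Type w} [Category.{w'} J]

theorem isProjectivelyCofibrant_iff (F : J ⥤ C) :
    IsProjectivelyCofibrant F ↔ ∀ (Z Y : J ⥤ C) (q : Z ⟶ Y),
      (trivialFibrations C).functorCategory J q → ∀ b : F ⟶ Y, ∃ l : F ⟶ Z, l ≫ q = b := by
  refine ⟨fun h Z Y q hq b => ?_, fun h Z Y q hq => ⟨fun {t b} _ => ?_⟩⟩
  · have := h q hq
    have sq : CommSq (initial.to Z) (initial.to F) q b := ⟨initialIsInitial.hom_ext _ _⟩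
    exact ⟨sq.lift, sq.fac_right⟩
  · obtain ⟨l, hl⟩ := h Z Y q hq b
    exact ⟨⟨⟨l, initialIsInitial.hom_ext _ _, hl⟩⟩⟩

theorem isInjectivelyFibrant_iff (F : J ⥤ C) :
    IsInjectivelyFibrant F ↔ ∀ (Z Y : J ⥤ C) (i : Z ⟶ Y),
      (trivialCofibrations C).functorCategory J i → ∀ b : Z ⟶ F, ∃ l : Y ⟶ F, i ≫ l = b := by
  refine ⟨fun h Z Y i hi b => ?_, fun h Z Y i hi => ⟨fun {t b} _ => ?_⟩⟩
  · have := h i hi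
    have sq : CommSq b i (terminal.from F) (terminal.from Y) := ⟨terminalIsTerminal.hom_ext _ _⟩
    exact ⟨sq.lift, sq.fac_left⟩
  · obtain ⟨l, hl⟩ := h Z Y i hi t
    exact ⟨⟨⟨l, hl, terminalIsTerminal.hom_ext _ _⟩⟩⟩

/-- Trivial fibrations of `Cᵒᵖ` are the opposites of trivial cofibrations of `C`, so the two
extension problems are dual. -/
theorem isProjectivelyCofibrant_op_iff (F : J ⥤ C) :
    IsProjectivelyCofibrant F.op ↔ IsInjectivelyFibrant F := by
  rw [isProjectivelyCofibrant_iff, isInjectivelyFibrant_iff]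
  constructor
  · intro h Z Y i hi b
    obtain ⟨l, hl⟩ := h Y.op Z.op (NatTrans.op i) (fun j => hi j.unop) (NatTrans.op b)
    exact ⟨NatTrans.unop l, congrArg NatTrans.unop hl⟩
  · intro h Z Y q hq b
    obtain ⟨l, hl⟩ := h Y.unop Z.unop (NatTrans.unop q) (fun j => hq (op j)) (NatTrans.unop b)
    exact ⟨NatTrans.op l, congrArg NatTrans.op hl⟩

end

namespace WeakSimplicialTensoring

variable {C : Type u} [Category.{v} C] [ModelCategory C] (T : WeakSimplicialTensoring C)
  [IsCombinatorial C]

/-- The projection `Tot X ⟶ (X^n) ^ Δ[n]`, in the opposite category. -/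
noncomputable def totalizationπOp (X : SimplexCategory ⥤ C) (n : SimplexCategory) :
    (T.quillenTensor.op.tensor.obj (standardWeight.obj n)).obj (X.op.obj (op n)) ⟶
      op (totalization T.tensor X) :=
  (end_.π (totalizationBifunctor T.tensor X) n).op

theorem totalizationπOp_hom_ext {X : SimplexCategory ⥤ C} {E : Cᵒᵖ}
    {f g : op (totalization T.tensor X) ⟶ E}
    (h : ∀ n, T.totalizationπOp X n ≫ f = T.totalizationπOp X n ≫ g) : f = g :=
  Quiver.Hom.unop_inj (end_.hom_ext fun n => congrArg Quiver.Hom.unop (h n))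

theorem totalizationπOp_limitToTotalization (X : SimplexCategory ⥤ C) (n : SimplexCategory) :
    T.totalizationπOp X n ≫ (T.limitToTotalization X).op =
      (T.toCotensor n (X.obj n)).op ≫ (limit.π X n).op := by
  have h : T.limitToTotalization X ≫ end_.π (totalizationBifunctor T.tensor X) n =
      limit.π X n ≫ T.toCotensor n (X.obj n) := end_.lift_π _ _ n
  exact congrArg Quiver.Hom.op h

/-- The map from the realization in the opposite category to the totalization. -/
noncomputable def opRealizationHom (X : SimplexCategory ⥤ C) :
    ((weightedCoend T.quillenTensor.op.tensor).obj standardWeight).obj X.op ⟶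
      op (totalization T.tensor X) :=
  weightedCoend.desc (T.totalizationπOp X)
    (fun _ _ f => congrArg Quiver.Hom.op (end_.condition (totalizationBifunctor T.tensor X) f))

/-- The map from the realization in the opposite category, as an object of `C`, to the
totalization. -/
noncomputable def totalizationLift (X : SimplexCategory ⥤ C) :
    (((weightedCoend T.quillenTensor.op.tensor).obj standardWeight).obj X.op).unop ⟶
      totalization T.tensor X :=
  end_.lift (F := totalizationBifunctor T.tensor X)
    (fun n => (weightedCoend.ι T.quillenTensor.op.tensor standardWeight X.op n).unop)
    (fun _ _ f => congrArg Quiver.Hom.unop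
      (weightedCoend.condition (T := T.quillenTensor.op.tensor) standardWeight X.op f))

theorem ι_opRealizationHom (X : SimplexCategory ⥤ C) (n : SimplexCategory) :
    weightedCoend.ι T.quillenTensor.op.tensor standardWeight X.op n ≫ T.opRealizationHom X =
      T.totalizationπOp X n :=
  weightedCoend.ι_desc _ _ n

theorem totalizationπOp_totalizationLift (X : SimplexCategory ⥤ C) (n : SimplexCategory) :
    T.totalizationπOp X n ≫ (T.totalizationLift X).op =
      weightedCoend.ι T.quillenTensor.op.tensor standardWeight X.op n := by
  have h : T.totalizationLift X ≫ end_.π (totalizationBifunctor T.tensor X) n =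
      (weightedCoend.ι T.quillenTensor.op.tensor standardWeight X.op n).unop := end_.lift_π _ _ n
  exact congrArg Quiver.Hom.op h

/-- A coend in `Cᵒᵖ` is an end in `C`; the two chosen universal objects are compared by their
universal maps. -/
instance isIso_opRealizationHom (X : SimplexCategory ⥤ C) : IsIso (T.opRealizationHom X) where
  out := ⟨(T.totalizationLift X).op, weightedCoend.hom_ext fun n => by
      rw [← Category.assoc, ι_opRealizationHom, totalizationπOp_totalizationLift, Category.comp_id],
    T.totalizationπOp_hom_ext fun n => by
      rw [← Category.assoc, totalizationπOp_totalizationLift, ι_opRealizationHom, Category.comp_id]⟩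

theorem realizationDesc_op (X : SimplexCategory ⥤ C) :
    T.quillenTensor.op.realizationDesc (limit.cone X).op =
      T.opRealizationHom X ≫ (T.limitToTotalization X).op := by
  refine weightedCoend.hom_ext fun n => ?_
  refine (T.quillenTensor.op.ι_realizationDesc _ n).trans ?_
  rw [← Category.assoc, ι_opRealizationHom, totalizationπOp_limitToTotalization]
  -- The unit is the transpose of the counit, so naturality of transposition in the weight
  -- identifies the collapse map of the opposite tensor with `toCotensor`.
  have h : (T.quillenTensor.op.collapse n).app (op (X.obj n)) = (T.toCotensor n (X.obj n)).op :=
    congrArg Quiver.Hom.op ((cotensorAdj T.tensor).homEquiv_naturality_one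
      (SSet.stdSimplex.map (SimplexCategory.isTerminalZero.from n)) (T.counit.app (X.obj n))).symm
  exact congrArg (· ≫ (limit.π X n).op) h

theorem exhibitsHomotopyLimit_iff (X : SimplexCategory ⥤ C) (hX : IsReedyFibrant X) (Y : C)
    (f : Y ⟶ limit X) :
    ExhibitsHomotopyLimit X f ↔ WeakEquivalence (f ≫ T.limitToTotalization X) := by
  have key (F : SimplexCategory ⥤ C) (α : X ⟶ F) (hF : IsProjectivelyCofibrant F.op)
      (hα : ∀ n, WeakEquivalence (α.app n)) :
      WeakEquivalence (f ≫ limMap α) ↔ WeakEquivalence (f ≫ T.limitToTotalization X) := by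
    have h := T.quillenTensor.op.weakEquivalence_desc_iff (NatTrans.op α) hF hX.op
      (fun n => inferInstanceAs (WeakEquivalence (α.app n.unop).op))
      (limit.isLimit F).op (c' := (limit.cone X).op) (limMap α).op
      (fun n => congrArg Quiver.Hom.op (limMap_π α n.unop)) f.op
    rw [T.realizationDesc_op, Category.assoc,
      weakEquivalence_precomp_iff (T.opRealizationHom X)] at h
    exact (weakEquivalences_op_iff (f ≫ limMap α)).symm.trans
      (h.trans (weakEquivalences_op_iff (f ≫ T.limitToTotalization X)))
  constructor
  · rintro ⟨F, α, hα, hF, h⟩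
    exact (key F α ((isProjectivelyCofibrant_op_iff F).2 hF) fun n => ⟨hα n⟩).1 h
  · intro h
    obtain ⟨F, α, hF, hα⟩ := T.quillenTensor.op.exists_projectivelyCofibrant hX.op
    have hα' (n) : WeakEquivalence ((NatTrans.unop α).app n) :=
      (weakEquivalences_op_iff _).1 (hα (op n))
    exact ⟨F.unop, NatTrans.unop α, fun n => (hα' n).mem,
      (isProjectivelyCofibrant_op_iff F.unop).1 hF, (key F.unop (NatTrans.unop α) hF hα').2 h⟩

end WeakSimplicialTensoring

end WeakSimplicial

theorem mainTheorem5 {C : Type u} [Category.{v} C] [ModelCategory C] [IsCombinatorial C]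
    (T : WeakSimplicialTensoring C) :
    (∀ X : SimplexCategoryᵒᵖ ⥤ C, IsReedyCofibrant X → ∀ (Y : C) (f : colimit X ⟶ Y),
      ExhibitsHomotopyColimit X f ↔ WeakEquivalence (T.realizationToColimit X ≫ f)) ∧
    (∀ X : SimplexCategory ⥤ C, IsReedyFibrant X → ∀ (Y : C) (f : Y ⟶ limit X),
      ExhibitsHomotopyLimit X f ↔ WeakEquivalence (f ≫ T.limitToTotalization X)) :=
  ⟨fun X hX Y f => T.exhibitsHomotopyColimit_iff X hX Y f,
    fun X hX Y f => T.exhibitsHomotopyLimit_iff X hX Y f⟩
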